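/- **Setting.** Inputs are $z\in\{0,1\}^{\binom n2}$, encoding graphs on the vertex set $V=[n]$, with neighbourhoods $N_t$; $\mathsf{Triangle}(z)=1$ iff the graph has a triangle. An *extended learning graph* for a function $f$ on a set $Z$ of inputs is a finite rooted acyclic directed (multi)graph whose vertices $v$ carry labels (index sets) $S(v)$, with empty root label. Every edge $e=(u,v)$ either loads one index $j\notin S(u)$, i.e. $S(v)=S(u)\cup\{j\}$, or is an empty transition, $S(v)=S(u)$, which is not counted in any complexity. It has weights $w^0_z(e),w^1_z(e)\ge 0$ depending on $z$ only through $z_{S(v)}$, with $w^0_x(e)=w^1_y(e)$ whenever $f(x)=0$, $f(y)=1$, $x_{S(u)}=y_{S(u)}$, $x_j\ne y_j$; and for every $y\in f^{-1}(1)$ a unit flow $p_y\ge 0$ from the root, vanishing on loading edges with $w_y^1(e)=0$, all of whose sinks have labels containing a $1$-certificate of $f$ for $y$. Put $C^0(x)=\sum_e w^0_x(e)$ and $C^1(y)=\sum_e p_y(e)^2/w^1_y(e)$, sums over loading edges. Its *complexity over graphs with $m$ edges* is $\sqrt{\max_x C^0(x)\cdot\max_y C^1(y)}$, with $x$ (resp.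 $y$) ranging over the negative (resp. positive) inputs with exactly $m$ edges (an empty maximum is $0$). $\mathsf{SparseLoad}_S$ is the path that loads $S=\{s_1,\dots,s_N\}$ one element at a time, the $k$-th edge having weight $w^b_z=3(|z_{\{s_1,\dots,s_{k-1}\}}|+1)\log(N+1)$ if $z_{s_k}=b$ and $w_z^b=3N\log(N+1)$ otherwise. **The learning graph $\mathcal G_{n,x,a,b}$.** Every edge below is a copy of $\mathsf{SparseLoad}$ loading the part of the new label not yet loaded, with weights multiplied by the factor in brackets. Write $u(N,k)=1/\binom Nk$, $c=u(n,x)$, $c'=c\,u(n-2,a-2)$. $X$ ranges over the $x$-subsets of $V$, and $X\times A$ is the set of pairs between $X$ and $A$. 1. For every $X$ and $t\in X$: load $\{t\}\times V$ $[c]$; then, for every pair $e$, load $e$ $[c$ if $e\subseteq N_t$, else $0]$. 2. For every $X$, a Johnson walk on the $a$-subsets $A$ of $V$, with label $X\times A$: from the root to every $(a-2)$-subset $[c\,u(n,a-2)]$; add one element $[c\,u(n,a-2)]$; add one more element $[c\,u(n-1,a-2)]$. 3. From every $(X,A)$ and for every $w\in V$, a Johnson walk on the $b$-subsets $B$ of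 $A$, with label $X\times A\cup\{w\}\times B$: to every $(b-2)$-subset of $A$ $[c'u(a,b-2)]$; add one element of $A$ $[c'u(a,b-2)]$; add one more $[c'u(a-1,b-2)]$. 4. From every $(X,A,w,B)$ and for every pair $e\subseteq B$: load $e$ $[c'u(a-2,b-2)$ if $e\subseteq N_w$ and $e\not\subseteq N_s$ for all $s\in X$; else $0]$. On a positive input each $X$ receives flow $c$. If there is a triangle with a vertex in $X$, one such triangle $(t,u,v)$ with $t\in X$ is fixed, and the flow goes through $\{t\}\times V$ and then $e=uv$. Otherwise a triangle $(t,u,v)$ is fixed, and the flow goes through the first walk, then $w=t$, then the second walk, then $e=uv$. In each walk all the initial subsets receive equal flow; then $u$ and, in the next stage, $v$ is added, and where that element is already in the set the flow is spread uniformly over all possible additions. **Theorem.** There is an absolute constant $C>0$ such that the following holds. (i) For all integers $1\le x\le n$ and $2\le b\le a\le n$, $\mathcal G_{n,x,a,b}$ is an extended learning graph for $\mathsf{Triangle}$ on all $n$-vertex graphs, and for every $m$ its complexity over graphs with $m$ edges is at most $$C\sqrt{\left(xm+(ax)^2\frac m{n^2}+\Big(\frac na\Big)^2\left(a x^2\frac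 m{n^2}+n\left(b^2\frac m{n^2}+\Big(\frac ab\Big)^2\Big(b+\frac{b^2}x\Big)\right)\right)\right)\log n}\,.$$ (ii) If $n\ge1$, $n^{5/4}\le m\le\binom n2$, $a=\lceil n^{3/4}\rceil$ and $b=x=\lceil \sqrt n/(m/n^2)^{1/3}\rceil$, then $\mathcal G_{n,x,a,b}$ is an extended learning graph for $\mathsf{Triangle}$, and its complexity over graphs with $m$ edges is at most $C\,n^{11/12}m^{1/6}\sqrt{\log n}$. -/

import Mathlib

/-! ## Extended learning graphs

Inputs are Boolean strings `z : ι → Bool` indexed by a finite set `ι`. -/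

/-- The data of an extended learning graph over the index set `ι`: a finite directed (multi)graph
with a root, a label `label v ⊆ ι` for every vertex, weights `weight b z e` (`b = false` is the
weight `w_z^0`, `b = true` is the weight `w_z^1`), and a flow `flow y e` for every input `y`.
The vertices of the graph are the root and the end points of the edges. -/
structure LGraph (ι : Type) where
  Vert : Type
  Edge : Type
  [fintypeEdge : Fintype Edge]
  root : Vert
  src : Edge → Vert
  tgt : Edge → Vert
  label : Vert → Finset ι
  weight : Bool → (ι → Bool) → Edge → ℝ
  flow : (ι → Bool) → Edge → ℝ

attribute [instance] LGraph.fintypeEdge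

/-- `x` and `y` agree on the index set `S`. -/
def AgreeOn {ι : Type} (S : Finset ι) (x y : ι → Bool) : Prop := ∀ i ∈ S, x i = y i

/-- `S` is a `1`-certificate for the function `f` with domain `Z` on the input `y`. -/
def IsOneCertificate {ι : Type} (Z : Set (ι → Bool)) (f : (ι → Bool) → Prop)
    (y : ι → Bool) (S : Finset ι) : Prop :=
  ∀ z ∈ Z, AgreeOn S z y → f z

namespace LGraph

variable {ι : Type}

/-- There is an edge from `u` to `v`. -/
def Adj (G : LGraph ι) (u v : G.Vert) : Prop := ∃ e, G.src e = u ∧ G.tgt e = v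

/-- The edge `e` loads an index. The other edges are the empty transitions, between two vertices
with the same label; they do not contribute to any complexity. -/
def Loading (G : LGraph ι) (e : G.Edge) : Prop := G.label (G.tgt e) ≠ G.label (G.src e)

open Classical in
/-- Outgoing flow minus incoming flow at the vertex `v`, for the input `y`. -/
noncomputable def netOut (G : LGraph ι) (y : ι → Bool) (v : G.Vert) : ℝ :=
  (∑ e, if G.src e = v then G.flow y e else 0) - ∑ e, if G.tgt e = v then G.flow y e else 0

/-- `G` is an extended learning graph for the Boolean function `f` with domain `Z`. -/
structure IsLearningGraphFor [DecidableEq ι] (G : LGraph ι) (Z : Set (ι → Bool))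
    (f : (ι → Bool) → Prop) : Prop where
  acyclic : ∀ v, ¬ Relation.TransGen G.Adj v v
  rooted : ∀ e, Relation.ReflTransGen G.Adj G.root (G.src e)
  label_root : G.label G.root = ∅
  label_step : ∀ e, G.Loading e →
    ∃ j, j ∉ G.label (G.src e) ∧ G.label (G.tgt e) = insert j (G.label (G.src e))
  weight_nonneg : ∀ b, ∀ z ∈ Z, ∀ e, 0 ≤ G.weight b z e
  weight_local : ∀ b, ∀ z ∈ Z, ∀ z' ∈ Z, ∀ e,
    AgreeOn (G.label (G.tgt e)) z z' → G.weight b z e = G.weight b z' e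
  weight_compat : ∀ x ∈ Z, ¬ f x → ∀ y ∈ Z, f y → ∀ e j, j ∉ G.label (G.src e) →
    G.label (G.tgt e) = insert j (G.label (G.src e)) →
    AgreeOn (G.label (G.src e)) x y → x j ≠ y j → G.weight false x e = G.weight true y e
  flow_nonneg : ∀ y ∈ Z, f y → ∀ e, 0 ≤ G.flow y e
  flow_root : ∀ y ∈ Z, f y → G.netOut y G.root = 1
  flow_source : ∀ y ∈ Z, f y → ∀ v, v ≠ G.root → G.netOut y v ≤ 0
  flow_support : ∀ y ∈ Z, f y → ∀ e, G.Loading e → G.weight true y e = 0 → G.flow y e = 0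
  sink_certificate : ∀ y ∈ Z, f y → ∀ v, G.netOut y v < 0 → IsOneCertificate Z f y (G.label v)

open Classical in
/-- Negative complexity on the input `x`. -/
noncomputable def negComplexity (G : LGraph ι) (x : ι → Bool) : ℝ :=
  ∑ e, if G.Loading e then G.weight false x e else 0

open Classical in
/-- Positive complexity on the input `y`. -/
noncomputable def posComplexity (G : LGraph ι) (y : ι → Bool) : ℝ :=
  ∑ e, if G.Loading e then (G.flow y e) ^ 2 / G.weight true y e else 0

/-- Complexity of `G` over the inputs in `Z`, for the function `f`: the geometric mean of the
maximal negative complexity over the negative inputs in `Z` and of the maximal positive complexity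
over the positive inputs in `Z` (for finite `ι` these are suprema of finite sets; the maximum over
an empty set is `0`). -/
noncomputable def complexity (G : LGraph ι) (Z : Set (ι → Bool)) (f : (ι → Bool) → Prop) : ℝ :=
  Real.sqrt ((⨆ x : {x // x ∈ Z ∧ ¬ f x}, G.negComplexity x.1) *
    ⨆ y : {y // y ∈ Z ∧ f y}, G.posComplexity y.1)

end LGraph

/-! ## The super edge `SparseLoad` -/

/-- The element of `S` loaded by the `k`-th edge of the path `SparseLoad S`, for a fixed
enumeration of `S`. -/
noncomputable def sparseElem {ι : Type} (S : Finset ι) (k : Fin S.card) : ι :=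
  (S.equivFin.symm k).1

/-- The set of the first `k` elements of `S` in the enumeration. -/
noncomputable def sparsePrefix {ι : Type} [DecidableEq ι] (S : Finset ι) (k : ℕ) : Finset ι :=
  (Finset.univ.filter fun i : Fin S.card => i.val < k).image (sparseElem S)

/-- The weight `w_z^b` of the `k`-th edge of the path `SparseLoad S`. -/
noncomputable def sparseWeight {ι : Type} [DecidableEq ι] (S : Finset ι) (b : Bool)
    (z : ι → Bool) (k : Fin S.card) : ℝ :=
  if z (sparseElem S k) = b then
    3 * ((((sparsePrefix S k).filter fun i => z i = true).card : ℝ) + 1)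
      * Real.log ((S.card : ℝ) + 1)
  else 3 * (S.card : ℝ) * Real.log ((S.card : ℝ) + 1)

/-- A learning graph all of whose edges are super edges of type `SparseLoad`: the edge `e` is
a copy of `SparseLoad` loading `label (tgt e) \ label (src e)`, with both weights multiplied by
`scale z e`, and it carries the flow `flow y e`. -/
structure SuperGraph (ι : Type) where
  Vert : Type
  Edge : Type
  [fintypeEdge : Fintype Edge]
  root : Vert
  src : Edge → Vert
  tgt : Edge → Vert
  label : Vert → Finset ι
  scale : (ι → Bool) → Edge → ℝ
  flow : (ι → Bool) → Edge → ℝ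

attribute [instance] SuperGraph.fintypeEdge

namespace SuperGraph

variable {ι : Type} [DecidableEq ι]

/-- The set loaded by the super edge `e`. -/
def loadSet (H : SuperGraph ι) (e : H.Edge) : Finset ι := H.label (H.tgt e) \ H.label (H.src e)

/-- The expansion: the super edge `e`, loading a set `S`, is replaced by the path `SparseLoad S`,
which starts at `src e`, goes through `|S|` new vertices, loading one element of `S` on every step,
and is closed by an empty transition from its last vertex to `tgt e`. -/
noncomputable def expansion (H : SuperGraph ι) : LGraph ι where
  Vert := H.Vert ⊕ (Σ e : H.Edge, Fin (H.loadSet e).card)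
  Edge := Σ e : H.Edge, Fin ((H.loadSet e).card + 1)
  root := Sum.inl H.root
  src p := Fin.cases (motive := fun _ => H.Vert ⊕ (Σ e : H.Edge, Fin (H.loadSet e).card))
    (Sum.inl (H.src p.1)) (fun i => Sum.inr ⟨p.1, i⟩) p.2
  tgt p := Fin.lastCases (motive := fun _ => H.Vert ⊕ (Σ e : H.Edge, Fin (H.loadSet e).card))
    (Sum.inl (H.tgt p.1)) (fun i => Sum.inr ⟨p.1, i⟩) p.2
  label v := match v with
    | Sum.inl v => H.label v
    | Sum.inr ⟨e, i⟩ => H.label (H.src e) ∪ sparsePrefix (H.loadSet e) (i.val + 1)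
  weight b z p := Fin.lastCases (motive := fun _ => ℝ) 0
    (fun i => H.scale z p.1 * sparseWeight (H.loadSet p.1) b z i) p.2
  flow y p := H.flow y p.1

end SuperGraph

/-! ## Graphs as inputs -/

/-- The `n choose 2` possible edges of a graph with vertex set `Fin n`: the index set of the
inputs. -/
abbrev Slot (n : ℕ) : Type := {e : Sym2 (Fin n) // ¬ e.IsDiag}

/-- The graph encoded by the input `z`. -/
def graphOf {n : ℕ} (z : Slot n → Bool) : SimpleGraph (Fin n) where
  Adj u v := ∃ h : ¬ (s(u, v)).IsDiag, z ⟨s(u, v), h⟩ = true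
  symm := ⟨by
    rintro u v ⟨h, hz⟩
    have key : s(u, v) = s(v, u) := Sym2.eq_swap
    refine ⟨key ▸ h, ?_⟩
    have hs : (⟨s(v, u), key ▸ h⟩ : Slot n) = ⟨s(u, v), h⟩ := Subtype.ext key.symm
    rw [hs]
    exact hz⟩
  loopless := ⟨by
    rintro u ⟨h, -⟩
    exact h (by simp)⟩

/-- The function `Triangle`. -/
def HasTriangle {n : ℕ} (z : Slot n → Bool) : Prop :=
  ∃ t u v, (graphOf z).Adj t u ∧ (graphOf z).Adj t v ∧ (graphOf z).Adj u v

/-- The inputs that encode a graph with `m` edges. -/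
def graphsWithEdges (n m : ℕ) : Set (Slot n → Bool) := {z | (graphOf z).edgeSet.ncard = m}

open Classical in
/-- The possible edges `X × A` between a vertex of `X` and a vertex of `A`. -/
noncomputable def crossSlots {n : ℕ} (X A : Finset (Fin n)) : Finset (Slot n) :=
  Finset.univ.filter fun e => ∃ u ∈ X, ∃ v ∈ A, e.1 = s(u, v)

/-- The pair `e` is in `(N_t)²`: both its ends are neighbours of `t`. -/
def InNbhd {n : ℕ} (z : Slot n → Bool) (t : Fin n) (e : Slot n) : Prop :=
  ∀ u ∈ e.1, (graphOf z).Adj t u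

/-- The pair `e` is in `Δ(X)`: its ends have no common neighbour in `X`. -/
def InDelta {n : ℕ} (z : Slot n → Bool) (X : Finset (Fin n)) (e : Slot n) : Prop :=
  ∀ t ∈ X, ¬ InNbhd z t e

/-! ## The learning graph for `Triangle` -/

/-- The vertices.
* `root` carries the empty label.
* `star X t` and `starPair X t e` belong to the part that searches for a triangle with a vertex
  `t` in `X`: first `{t} × V` is loaded, then a pair `e`.
* `walkA X A` belongs to the walk on the sets `A`, with `X × A` loaded.
* `walkB X A w B` belongs to the walk on the subsets `B` of `A`, with `{w} × B` also loaded.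
* `pair X A w B e` is reached when the pair `e` is loaded as well. -/
inductive TriVert (n : ℕ) : Type
  | root
  | star (X : Finset (Fin n)) (t : Fin n)
  | starPair (X : Finset (Fin n)) (t : Fin n) (e : Slot n)
  | walkA (X A : Finset (Fin n))
  | walkB (X A : Finset (Fin n)) (w : Fin n) (B : Finset (Fin n))
  | pair (X A : Finset (Fin n)) (w : Fin n) (B : Finset (Fin n)) (e : Slot n)

/-- The super edges, for `|X| = x`, `|A| = a` and `|B| = b`. Each of the two Johnson walks has one
stage (`walkA0`, `walkB0`) that loads all but two elements of the set, and two stages that add one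
element `j`. -/
inductive TriEdge (n x a b : ℕ) : Type
  | star (X : Finset (Fin n)) (t : Fin n) (hX : X.card = x) (ht : t ∈ X)
  | starPair (X : Finset (Fin n)) (t : Fin n) (e : Slot n) (hX : X.card = x) (ht : t ∈ X)
  | walkA0 (X A : Finset (Fin n)) (hX : X.card = x) (hA : A.card = a - 2)
  | walkA1 (X A : Finset (Fin n)) (j : Fin n) (hX : X.card = x) (hA : A.card = a - 2)
      (hj : j ∉ A)
  | walkA2 (X A : Finset (Fin n)) (j : Fin n) (hX : X.card = x) (hA : A.card = a - 1)
      (hj : j ∉ A)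
  | walkB0 (X A : Finset (Fin n)) (w : Fin n) (B : Finset (Fin n)) (hX : X.card = x)
      (hA : A.card = a) (hBA : B ⊆ A) (hB : B.card = b - 2)
  | walkB1 (X A : Finset (Fin n)) (w : Fin n) (B : Finset (Fin n)) (j : Fin n) (hX : X.card = x)
      (hA : A.card = a) (hBA : B ⊆ A) (hB : B.card = b - 2) (hjA : j ∈ A) (hj : j ∉ B)
  | walkB2 (X A : Finset (Fin n)) (w : Fin n) (B : Finset (Fin n)) (j : Fin n) (hX : X.card = x)
      (hA : A.card = a) (hBA : B ⊆ A) (hB : B.card = b - 1) (hjA : j ∈ A) (hj : j ∉ B)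
  | pair (X A : Finset (Fin n)) (w : Fin n) (B : Finset (Fin n)) (e : Slot n) (hX : X.card = x)
      (hA : A.card = a) (hBA : B ⊆ A) (hB : B.card = b) (he : ∀ u ∈ e.1, u ∈ B)

namespace TriEdge

variable {n x a b : ℕ}

/-- An injective code, used only to see that there are finitely many super edges. -/
def code : TriEdge n x a b → ℕ × Finset (Fin n) × Finset (Fin n) × Finset (Fin n) ×
    Option (Fin n) × Option (Fin n) × Option (Slot n)
  | star X t _ _ => (0, X, ∅, ∅, some t, none, none)
  | starPair X t e _ _ => (1, X, ∅, ∅, some t, none, some e)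
  | walkA0 X A _ _ => (2, X, A, ∅, none, none, none)
  | walkA1 X A j _ _ _ => (3, X, A, ∅, none, some j, none)
  | walkA2 X A j _ _ _ => (4, X, A, ∅, none, some j, none)
  | walkB0 X A w B _ _ _ _ => (5, X, A, B, some w, none, none)
  | walkB1 X A w B j _ _ _ _ _ _ => (6, X, A, B, some w, some j, none)
  | walkB2 X A w B j _ _ _ _ _ _ => (7, X, A, B, some w, some j, none)
  | pair X A w B e _ _ _ _ _ => (8, X, A, B, some w, none, some e)

theorem code_fst_lt (e : TriEdge n x a b) : e.code.1 < 9 := by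
  cases e <;> simp [code]

theorem code_injective : Function.Injective (code : TriEdge n x a b → _) := by
  intro e e' h
  cases e <;> cases e' <;> simp_all [code]

noncomputable instance : Fintype (TriEdge n x a b) :=
  Fintype.ofInjective
    (fun e => ((⟨e.code.1, e.code_fst_lt⟩ : Fin 9), e.code.2))
    (fun e e' h => code_injective (by
      simp only [Prod.mk.injEq, Fin.mk.injEq] at h
      exact Prod.ext h.1 h.2))

def src : TriEdge n x a b → TriVert n
  | star _ _ _ _ => .root
  | starPair X t _ _ _ => .star X t
  | walkA0 _ _ _ _ => .root
  | walkA1 X A _ _ _ _ => .walkA X A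
  | walkA2 X A _ _ _ _ => .walkA X A
  | walkB0 X A _ _ _ _ _ _ => .walkA X A
  | walkB1 X A w B _ _ _ _ _ _ _ => .walkB X A w B
  | walkB2 X A w B _ _ _ _ _ _ _ => .walkB X A w B
  | pair X A w B _ _ _ _ _ _ => .walkB X A w B

def tgt : TriEdge n x a b → TriVert n
  | star X t _ _ => .star X t
  | starPair X t e _ _ => .starPair X t e
  | walkA0 X A _ _ => .walkA X A
  | walkA1 X A j _ _ _ => .walkA X (insert j A)
  | walkA2 X A j _ _ _ => .walkA X (insert j A)
  | walkB0 X A w B _ _ _ _ => .walkB X A w B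
  | walkB1 X A w B j _ _ _ _ _ _ => .walkB X A w (insert j B)
  | walkB2 X A w B j _ _ _ _ _ _ => .walkB X A w (insert j B)
  | pair X A w B e _ _ _ _ _ => .pair X A w B e

end TriEdge

/-- The labels of the vertices. -/
noncomputable def triLabel {n : ℕ} : TriVert n → Finset (Slot n)
  | .root => ∅
  | .star _ t => crossSlots {t} Finset.univ
  | .starPair _ t e => crossSlots {t} Finset.univ ∪ {e}
  | .walkA X A => crossSlots X A
  | .walkB X A w B => crossSlots X A ∪ crossSlots {w} B
  | .pair X A w B e => (crossSlots X A ∪ crossSlots {w} B) ∪ {e}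

/-- The factor `1 / (N choose k)` of a uniform distribution on the `k`-subsets of an `N`-set. -/
noncomputable def unif (N k : ℕ) : ℝ := 1 / (N.choose k : ℝ)

open Classical in
/-- The rescaling factors of the super edges. The factor `unif n x` comes from the search on `X`,
and each Johnson walk on the `k`-subsets of an `N`-set has the factors `unif N (k - 2)`,
`unif N (k - 2)` and `unif (N - 1) (k - 2)` on its three stages and `unif (N - 2) (k - 2)` on what
follows. Only pairs in `(N_t)²` and in `Δ(X, B, w) = (N_w)² ∩ Δ(X) ∩ B²` are queried in the last
stages. -/
noncomputable def triScale {n x a b : ℕ} (z : Slot n → Bool) : TriEdge n x a b → ℝ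
  | .star _ _ _ _ => unif n x
  | .starPair _ t e _ _ => if InNbhd z t e then unif n x else 0
  | .walkA0 _ _ _ _ => unif n x * unif n (a - 2)
  | .walkA1 _ _ _ _ _ _ => unif n x * unif n (a - 2)
  | .walkA2 _ _ _ _ _ _ => unif n x * unif (n - 1) (a - 2)
  | .walkB0 _ _ _ _ _ _ _ _ => unif n x * unif (n - 2) (a - 2) * unif a (b - 2)
  | .walkB1 _ _ _ _ _ _ _ _ _ _ _ => unif n x * unif (n - 2) (a - 2) * unif a (b - 2)
  | .walkB2 _ _ _ _ _ _ _ _ _ _ _ => unif n x * unif (n - 2) (a - 2) * unif (a - 1) (b - 2)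
  | .pair X _ w _ e _ _ _ _ _ =>
      if InNbhd z w e ∧ InDelta z X e then
        unif n x * unif (n - 2) (a - 2) * unif (a - 2) (b - 2) else 0

open Classical in
/-- A triangle `(t, u, v)` of the graph encoded by `z`, with `t` in `X` if the graph has a triangle
with a vertex in `X`. -/
noncomputable def chosenTriangle {n : ℕ} (z : Slot n → Bool) (X : Finset (Fin n)) :
    Option (Fin n × Fin n × Fin n) :=
  if h : ∃ p : Fin n × Fin n × Fin n, p.1 ∈ X ∧ (graphOf z).Adj p.1 p.2.1 ∧
      (graphOf z).Adj p.1 p.2.2 ∧ (graphOf z).Adj p.2.1 p.2.2 then some h.choose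
  else if h : ∃ p : Fin n × Fin n × Fin n, (graphOf z).Adj p.1 p.2.1 ∧
      (graphOf z).Adj p.1 p.2.2 ∧ (graphOf z).Adj p.2.1 p.2.2 then some h.choose
  else none

/-- Flow in the first incremental stage of a Johnson walk on the `k`-subsets of an `N`-set, on the
edge that adds `j` to the `(k-2)`-set `A`: every `A` receives the same flow; it goes to `u`, or
uniformly to all `j ∉ A` if `u` is already in `A`. -/
noncomputable def walkFlow1 {n : ℕ} (N k : ℕ) (u : Fin n) (A : Finset (Fin n)) (j : Fin n) : ℝ :=
  if u ∈ A then unif N (k - 2) / ((N : ℝ) - k + 2)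
  else if j = u then unif N (k - 2) else 0

/-- Flow in the second incremental stage, on the edge that adds `j` to the `(k-1)`-set `A`: every
`A` that contains `u` receives the same flow; it goes to `v`, or uniformly to all `j ∉ A` if `v` is
already in `A`. -/
noncomputable def walkFlow2 {n : ℕ} (N k : ℕ) (u v : Fin n) (A : Finset (Fin n)) (j : Fin n) : ℝ :=
  if u ∈ A then
    if v ∈ A then unif (N - 1) (k - 2) / ((N : ℝ) - k + 1)
    else if j = v then unif (N - 1) (k - 2) else 0
  else 0

/-- The flow in the part of the graph that belongs to `X`, when it is routed towards the triangle
`(t, u, v)`: if `t ∈ X` it goes to `star X t` and then to the pair `uv`; otherwise it follows the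
walk towards the sets `A` that contain `u` and `v`, the vertex `w = t`, the walk towards the subsets
`B` that contain `u` and `v`, and then the pair `uv`. -/
noncomputable def triFlowTo {n x a b : ℕ} (t u v : Fin n) : TriEdge n x a b → ℝ
  | .star X t' _ _ => if t ∈ X ∧ t' = t then unif n x else 0
  | .starPair X t' e _ _ => if t ∈ X ∧ t' = t ∧ e.1 = s(u, v) then unif n x else 0
  | .walkA0 X _ _ _ => if t ∉ X then unif n x * unif n (a - 2) else 0
  | .walkA1 X A j _ _ _ => if t ∉ X then unif n x * walkFlow1 n a u A j else 0
  | .walkA2 X A j _ _ _ => if t ∉ X then unif n x * walkFlow2 n a u v A j else 0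
  | .walkB0 X A w _ _ _ _ _ =>
      if t ∉ X ∧ u ∈ A ∧ v ∈ A ∧ w = t then
        unif n x * unif (n - 2) (a - 2) * unif a (b - 2) else 0
  | .walkB1 X A w B j _ _ _ _ _ _ =>
      if t ∉ X ∧ u ∈ A ∧ v ∈ A ∧ w = t then
        unif n x * unif (n - 2) (a - 2) * walkFlow1 a b u B j else 0
  | .walkB2 X A w B j _ _ _ _ _ _ =>
      if t ∉ X ∧ u ∈ A ∧ v ∈ A ∧ w = t then
        unif n x * unif (n - 2) (a - 2) * walkFlow2 a b u v B j else 0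
  | .pair X _ w _ e _ _ _ _ _ =>
      if t ∉ X ∧ w = t ∧ e.1 = s(u, v) then
        unif n x * unif (n - 2) (a - 2) * unif (a - 2) (b - 2) else 0

/-- The set `X` to which a super edge belongs. -/
def TriEdge.setX {n x a b : ℕ} : TriEdge n x a b → Finset (Fin n)
  | .star X _ _ _ => X
  | .starPair X _ _ _ _ => X
  | .walkA0 X _ _ _ => X
  | .walkA1 X _ _ _ _ _ => X
  | .walkA2 X _ _ _ _ _ => X
  | .walkB0 X _ _ _ _ _ _ _ => X
  | .walkB1 X _ _ _ _ _ _ _ _ _ _ => X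
  | .walkB2 X _ _ _ _ _ _ _ _ _ _ => X
  | .pair X _ _ _ _ _ _ _ _ _ => X

/-- The flow on the input `y`. -/
noncomputable def triFlow {n x a b : ℕ} (y : Slot n → Bool) (e : TriEdge n x a b) : ℝ :=
  match chosenTriangle y e.setX with
  | none => 0
  | some (t, u, v) => triFlowTo t u v e

/-- The learning graph for `Triangle` with super edges `SparseLoad` and parameters `|X| = x`,
`|A| = a`, `|B| = b`. -/
noncomputable def triangleSuperGraph (n x a b : ℕ) : SuperGraph (Slot n) where
  Vert := TriVert n
  Edge := TriEdge n x a b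
  root := .root
  src := TriEdge.src
  tgt := TriEdge.tgt
  label := triLabel
  scale := triScale
  flow := triFlow

/-- The learning graph for `Triangle`: the expansion of `triangleSuperGraph`. -/
noncomputable def triangleLearningGraph (n x a b : ℕ) : LGraph (Slot n) :=
  (triangleSuperGraph n x a b).expansion

/-! `SparseLoad S` costs a negative input `O(|S| (|z_S| + 1) log n)`, since only the edges that load
a one of `z` have weight `3 |S| log (|S| + 1)`. It costs a positive input `O(1)`: the edge that
loads the `j`-th one has weight `3 j log (|S| + 1)`, and the sum of `1 / j` is harmonic. Each super
edge carries a flow `p` bounded by its scale `s`, so `p² / s ≤ p`, and as no path has more than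
seven super edges the total flow, and with it the positive complexity, is `O(1)`.

The negative complexity is thus the sum of `s |S| (|z_S| + 1)` over the super edges. The scales make
each kind of super edge contribute an average over the subsets `X`, `A` and `B` of fixed sizes, and
averaging `|z_S|` over these sets replaces it by a fraction of the number of edges. For the final
loading of a pair `e` inside `B`, a vertex `w` counts when `e ⊆ N_w` while no `s ∈ X` has `e ⊆ N_s`.
Then `w ∉ X`, and since `X` avoids all vertices that count for `e`, the set `X ∪ {w}` determines
`w`. So at most `n choose (x + 1)` pairs `(X, w)` count, on average `n / x` vertices `w` for each
`e`. -/

section SparseLoad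

variable {ι : Type}

theorem sparseElem_mem (S : Finset ι) (k : Fin S.card) : sparseElem S k ∈ S :=
  (S.equivFin.symm k).2

theorem sparseElem_injective (S : Finset ι) : Function.Injective (sparseElem S) := fun _ _ h =>
  S.equivFin.symm.injective (Subtype.ext h)

theorem sum_sparseElem {M : Type*} [AddCommMonoid M] (S : Finset ι) (g : ι → M) :
    ∑ k, g (sparseElem S k) = ∑ i ∈ S, g i := by
  rw [← Finset.sum_coe_sort S, ← S.equivFin.symm.sum_comp]
  rfl

/-- The number of ones of the input `z` on the index set `S`, written `|z_S|` in the definition of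
`SparseLoad`. -/
def onesOn (z : ι → Bool) (S : Finset ι) : ℕ := (S.filter fun i => z i = true).card

theorem onesOn_mono (z : ι → Bool) {S T : Finset ι} (h : S ⊆ T) : onesOn z S ≤ onesOn z T :=
  Finset.card_le_card (Finset.filter_subset_filter _ h)

theorem onesOn_le_card (z : ι → Bool) (S : Finset ι) : onesOn z S ≤ S.card :=
  Finset.card_filter_le _ _

theorem onesOn_congr {S : Finset ι} {z z' : ι → Bool} (h : AgreeOn S z z') :
    onesOn z S = onesOn z' S :=
  congrArg Finset.card (Finset.filter_congr fun i hi => by rw [h i hi])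

theorem onesOn_insert [DecidableEq ι] (z : ι → Bool) {S : Finset ι} {i : ι} (hi : i ∉ S) :
    onesOn z (insert i S) = onesOn z S + if z i = true then 1 else 0 := by
  rw [onesOn, Finset.filter_insert]
  split_ifs
  · exact Finset.card_insert_of_notMem fun h => hi (Finset.mem_of_mem_filter i h)
  · rfl

variable [DecidableEq ι]

theorem mem_sparsePrefix {S : Finset ι} {k : ℕ} {i : ι} :
    i ∈ sparsePrefix S k ↔ ∃ l : Fin S.card, l.val < k ∧ sparseElem S l = i := by
  simp [sparsePrefix]

@[simp] theorem sparsePrefix_zero (S : Finset ι) : sparsePrefix S 0 = ∅ := by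
  simp [sparsePrefix]

theorem sparsePrefix_subset (S : Finset ι) (k : ℕ) : sparsePrefix S k ⊆ S := by
  intro i hi
  obtain ⟨l, -, rfl⟩ := mem_sparsePrefix.1 hi
  exact sparseElem_mem S l

@[simp] theorem sparsePrefix_card (S : Finset ι) : sparsePrefix S S.card = S :=
  (sparsePrefix_subset S _).antisymm fun i hi =>
    mem_sparsePrefix.2 ⟨S.equivFin ⟨i, hi⟩, Fin.is_lt _, by simp [sparseElem]⟩

theorem sparsePrefix_succ (S : Finset ι) (k : Fin S.card) :
    sparsePrefix S (k.val + 1) = insert (sparseElem S k) (sparsePrefix S k.val) := by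
  ext i
  simp only [mem_sparsePrefix, Finset.mem_insert, Nat.lt_succ_iff_lt_or_eq, or_and_right,
    exists_or, ← Fin.ext_iff, exists_eq_left, eq_comm (a := i)]
  exact or_comm

theorem sparseElem_notMem_sparsePrefix (S : Finset ι) (k : Fin S.card) :
    sparseElem S k ∉ sparsePrefix S k.val := by
  intro h
  obtain ⟨l, hl, hlk⟩ := mem_sparsePrefix.1 h
  exact hl.ne (congrArg Fin.val (sparseElem_injective S hlk))

theorem sparseWeight_eq (S : Finset ι) (b : Bool) (z : ι → Bool) (k : Fin S.card) :
    sparseWeight S b z k =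
      if z (sparseElem S k) = b then
        3 * ((onesOn z (sparsePrefix S k) : ℝ) + 1) * Real.log ((S.card : ℝ) + 1)
      else 3 * (S.card : ℝ) * Real.log ((S.card : ℝ) + 1) :=
  rfl

theorem sparseWeight_pos (S : Finset ι) (b : Bool) (z : ι → Bool) (k : Fin S.card) :
    0 < sparseWeight S b z k := by
  have hcard : (0 : ℝ) < S.card := Nat.cast_pos.2 k.pos
  have hlog : 0 < Real.log ((S.card : ℝ) + 1) := Real.log_pos (lt_add_of_pos_left 1 hcard)
  rw [sparseWeight_eq]
  split_ifs <;> positivity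

theorem sparseWeight_congr {S : Finset ι} (b : Bool) {z z' : ι → Bool} (k : Fin S.card)
    (h : AgreeOn (sparsePrefix S (k.val + 1)) z z') :
    sparseWeight S b z k = sparseWeight S b z' k := by
  rw [sparsePrefix_succ] at h
  rw [sparseWeight_eq, sparseWeight_eq, h _ (Finset.mem_insert_self _ _),
    onesOn_congr fun i hi => h i (Finset.mem_insert_of_mem hi)]

theorem sparseWeight_false_eq_true {S : Finset ι} {z z' : ι → Bool} (k : Fin S.card)
    (h : AgreeOn (sparsePrefix S k.val) z z') (hk : z (sparseElem S k) ≠ z' (sparseElem S k)) :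
    sparseWeight S false z k = sparseWeight S true z' k := by
  have hiff : z (sparseElem S k) = false ↔ z' (sparseElem S k) = true := by
    rw [Bool.eq_not_of_ne hk, Bool.not_eq_false']
  rw [sparseWeight_eq, sparseWeight_eq, onesOn_congr h]
  simp only [hiff]

theorem sum_sparseWeight_false_le (S : Finset ι) (z : ι → Bool) :
    ∑ k, sparseWeight S false z k ≤
      6 * ((S.card : ℝ) * (onesOn z S + 1)) * Real.log ((S.card : ℝ) + 1) := by
  set L := Real.log ((S.card : ℝ) + 1)
  have hL : 0 ≤ L := Real.log_nonneg (le_add_of_nonneg_left S.card.cast_nonneg)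
  have hweight (k : Fin S.card) : sparseWeight S false z k ≤
      3 * ((onesOn z S : ℝ) + 1) * L +
        3 * (S.card : ℝ) * L * if z (sparseElem S k) = true then (1 : ℝ) else 0 := by
    have hprefix : (onesOn z (sparsePrefix S k) : ℝ) ≤ onesOn z S :=
      Nat.cast_le.2 (onesOn_mono z (sparsePrefix_subset S k))
    rw [sparseWeight_eq]
    cases z (sparseElem S k)
    · simp only [if_true, Bool.false_eq_true, if_false, mul_zero, add_zero]
      gcongr
    · simp only [Bool.true_eq_false, if_false, if_true, mul_one]
      exact le_add_of_nonneg_left (by positivity)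
  have hones : ∑ k, (if z (sparseElem S k) = true then (1 : ℝ) else 0) = onesOn z S := by
    rw [sum_sparseElem S fun i => if z i = true then (1 : ℝ) else 0, Finset.sum_boole, onesOn]
  calc ∑ k, sparseWeight S false z k
      ≤ S.card * (3 * ((onesOn z S : ℝ) + 1) * L) + 3 * (S.card : ℝ) * L * onesOn z S := by
        refine (Finset.sum_le_sum fun k _ => hweight k).trans_eq ?_
        rw [Finset.sum_add_distrib, ← Finset.mul_sum _ _ (3 * (S.card : ℝ) * L),
          hones, Finset.sum_const, Finset.card_univ, Fintype.card_fin, nsmul_eq_mul]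
    _ = 6 * ((S.card : ℝ) * (onesOn z S + 1)) * L - 3 * (S.card : ℝ) * L := by ring
    _ ≤ 6 * ((S.card : ℝ) * (onesOn z S + 1)) * L := sub_le_self _ (by positivity)

-- The sum telescopes: loading the `j`-th one of `z` contributes `1 / j`.
theorem sum_inv_onesOn_sparsePrefix (S : Finset ι) (z : ι → Bool) :
    ∑ k : Fin S.card, (if z (sparseElem S k) = true
      then ((onesOn z (sparsePrefix S k) : ℝ) + 1)⁻¹ else 0) = harmonic (onesOn z S) := by
  have hstep (k : Fin S.card) : (if z (sparseElem S k) = true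
      then ((onesOn z (sparsePrefix S k) : ℝ) + 1)⁻¹ else 0) =
      (harmonic (onesOn z (sparsePrefix S (k + 1))) : ℝ) -
        harmonic (onesOn z (sparsePrefix S k)) := by
    rw [sparsePrefix_succ, onesOn_insert z (sparseElem_notMem_sparsePrefix S k)]
    split_ifs
    · simp [harmonic_succ]
    · simp
  simp only [hstep]
  rw [Fin.sum_univ_eq_sum_range fun k => (harmonic (onesOn z (sparsePrefix S (k + 1))) : ℝ) -
    harmonic (onesOn z (sparsePrefix S k)),
    Finset.sum_range_sub fun k => (harmonic (onesOn z (sparsePrefix S k)) : ℝ)]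
  simp [onesOn]

theorem harmonic_le_one_add_log_succ {k N : ℕ} (h : k ≤ N) :
    (harmonic k : ℝ) ≤ 1 + Real.log ((N : ℝ) + 1) := by
  rcases k.eq_zero_or_pos with rfl | hk
  · have := Real.log_nonneg (le_add_of_nonneg_left (N.cast_nonneg : (0 : ℝ) ≤ N))
    simp only [harmonic_zero, Rat.cast_zero]
    positivity
  · have hkN : (k : ℝ) ≤ N + 1 := by exact_mod_cast h.trans N.le_succ
    have := Real.log_le_log (Nat.cast_pos.2 hk) hkN
    exact (harmonic_le_one_add_log k).trans (by gcongr)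

theorem sum_inv_sparseWeight_true_le (S : Finset ι) (z : ι → Bool) :
    ∑ k, (sparseWeight S true z k)⁻¹ ≤ 2 := by
  rcases S.eq_empty_or_nonempty with hS | hS
  · have : IsEmpty (Fin S.card) := by rw [hS, Finset.card_empty]; exact Fin.isEmpty
    simp
  have hcard : (1 : ℝ) ≤ S.card := Nat.one_le_cast.2 hS.card_pos
  set L := Real.log ((S.card : ℝ) + 1) with hLdef
  have hL : (2 / 3 : ℝ) ≤ L := by
    have : Real.log 2 ≤ L := Real.log_le_log two_pos (by linarith)
    linarith [Real.log_two_gt_d9]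
  have hinv (k : Fin S.card) : (sparseWeight S true z k)⁻¹ ≤
      (3 * L)⁻¹ * ((if z (sparseElem S k) = true
        then ((onesOn z (sparsePrefix S k) : ℝ) + 1)⁻¹ else 0) + (S.card : ℝ)⁻¹) := by
    rw [sparseWeight_eq, ← hLdef]
    split_ifs
    · rw [mul_right_comm, mul_inv]
      gcongr
      exact le_add_of_nonneg_right (by positivity)
    · rw [mul_right_comm, mul_inv, zero_add]
  calc ∑ k, (sparseWeight S true z k)⁻¹
      ≤ (3 * L)⁻¹ * ((harmonic (onesOn z S) : ℝ) + 1) := by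
        refine (Finset.sum_le_sum fun k _ => hinv k).trans_eq ?_
        rw [← Finset.mul_sum, Finset.sum_add_distrib, sum_inv_onesOn_sparsePrefix,
          Finset.sum_const, Finset.card_univ, Fintype.card_fin, nsmul_eq_mul,
          mul_inv_cancel₀ (by positivity)]
    _ ≤ (3 * L)⁻¹ * (1 + L + 1) := by
        gcongr
        exact harmonic_le_one_add_log_succ (onesOn_le_card z S)
    _ ≤ 2 := by
        rw [inv_mul_le_iff₀ (by positivity)]
        linarith

end SparseLoad

namespace SuperGraph

section Layered

variable {ι : Type}

/-- Adjacency of two vertices by a super edge, the analogue of `LGraph.Adj`. -/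
def Adj (H : SuperGraph ι) (u v : H.Vert) : Prop := ∃ e, H.src e = u ∧ H.tgt e = v

open Classical in
/-- Outgoing flow minus incoming flow at a vertex, the analogue of `LGraph.netOut`. -/
noncomputable def netOut (H : SuperGraph ι) (y : ι → Bool) (v : H.Vert) : ℝ :=
  (∑ e, if H.src e = v then H.flow y e else 0) - ∑ e, if H.tgt e = v then H.flow y e else 0

/-- The super graph `H` computes the total function `f`, and `level` increases by one along every
super edge. Two conditions are stronger than what the expansion needs to be an extended learning
graph: the scale of an edge is determined by the label of its source, and it dominates the flow;
the latter bounds the positive complexity by the length of the paths. -/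
structure IsLayeredFor (H : SuperGraph ι) (f : (ι → Bool) → Prop) (level : H.Vert → ℕ) :
    Prop where
  level_root : level H.root = 0
  level_step : ∀ e, level (H.tgt e) = level (H.src e) + 1
  rooted : ∀ e, Relation.ReflTransGen H.Adj H.root (H.src e)
  label_root : H.label H.root = ∅
  label_mono : ∀ e, H.label (H.src e) ⊆ H.label (H.tgt e)
  scale_nonneg : ∀ z e, 0 ≤ H.scale z e
  scale_local : ∀ z z' e, AgreeOn (H.label (H.src e)) z z' → H.scale z e = H.scale z' e
  flow_nonneg : ∀ y, f y → ∀ e, 0 ≤ H.flow y e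
  flow_le_scale : ∀ y, f y → ∀ e, H.flow y e ≤ H.scale y e
  flow_root : ∀ y, f y → H.netOut y H.root = 1
  flow_source : ∀ y, f y → ∀ v, v ≠ H.root → H.netOut y v ≤ 0
  sink_certificate : ∀ y, f y → ∀ v, H.netOut y v < 0 →
    IsOneCertificate Set.univ f y (H.label v)

theorem sum_mul_netOut (H : SuperGraph ι) (y : ι → Bool) (g : H.Vert → ℝ) {V : Finset H.Vert}
    (hsrc : ∀ e, H.src e ∈ V) (htgt : ∀ e, H.tgt e ∈ V) :
    ∑ v ∈ V, g v * H.netOut y v = ∑ e, (g (H.src e) - g (H.tgt e)) * H.flow y e := by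
  classical
  have hend (s : H.Edge → H.Vert) (hs : ∀ e, s e ∈ V) :
      ∑ v ∈ V, g v * (∑ e, if s e = v then H.flow y e else 0) = ∑ e, g (s e) * H.flow y e := by
    simp_rw [Finset.mul_sum]
    rw [Finset.sum_comm]
    refine Finset.sum_congr rfl fun e _ => ?_
    simp only [mul_ite, mul_zero, Finset.sum_ite_eq, hs e, if_true]
  simp only [sub_mul, Finset.sum_sub_distrib]
  rw [← hend H.src hsrc, ← hend H.tgt htgt, ← Finset.sum_sub_distrib]
  refine Finset.sum_congr rfl fun v _ => ?_
  rw [← mul_sub, netOut]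

theorem IsLayeredFor.level_le {H : SuperGraph ι} {f : (ι → Bool) → Prop} {level : H.Vert → ℕ}
    (h : H.IsLayeredFor f level) {L : ℕ} (hL : ∀ e, level (H.tgt e) ≤ L) (e : H.Edge) :
    level (H.src e) ≤ L :=
  (Nat.le_of_lt (h.level_step e ▸ Nat.lt_succ_self _)).trans (hL e)

-- Every unit of flow descends one level per edge, so the total flow is the mean level of the sinks.
theorem IsLayeredFor.sum_flow_le {H : SuperGraph ι} {f : (ι → Bool) → Prop} {level : H.Vert → ℕ}
    (h : H.IsLayeredFor f level) {L : ℕ} (hL : ∀ e, level (H.tgt e) ≤ L)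
    {y : ι → Bool} (hy : f y) : ∑ e, H.flow y e ≤ L := by
  classical
  let V : Finset H.Vert :=
    insert H.root (Finset.univ.image H.src ∪ Finset.univ.image H.tgt)
  have hsrc (e) : H.src e ∈ V := by simp [V]
  have htgt (e) : H.tgt e ∈ V := by simp [V]
  have hlevel : ∀ v ∈ V, level v ≤ L := by
    simp only [V, Finset.forall_mem_insert, Finset.forall_mem_union, Finset.forall_mem_image,
      Finset.mem_univ, true_imp_iff]
    exact ⟨h.level_root ▸ zero_le, h.level_le hL, hL⟩
  have hterm : ∀ v ∈ V, (L - level v : ℝ) * H.netOut y v ≤ if v = H.root then (L : ℝ) else 0 := by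
    intro v hv
    split_ifs with hroot
    · rw [hroot, h.flow_root y hy, h.level_root, Nat.cast_zero, sub_zero, mul_one]
    · exact mul_nonpos_of_nonneg_of_nonpos (sub_nonneg.2 (Nat.cast_le.2 (hlevel v hv)))
        (h.flow_source y hy v hroot)
  calc ∑ e, H.flow y e
      = ∑ v ∈ V, (L - level v : ℝ) * H.netOut y v := by
        rw [H.sum_mul_netOut y (fun v => (L - level v : ℝ)) hsrc htgt]
        refine Finset.sum_congr rfl fun e _ => ?_
        rw [h.level_step e]
        push_cast
        ring
    _ ≤ ∑ v ∈ V, if v = H.root then (L : ℝ) else 0 := Finset.sum_le_sum hterm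
    _ = L := by simp [V]

end Layered

section Expansion

variable {ι : Type} [DecidableEq ι] (H : SuperGraph ι)

theorem sum_expansion_castSucc (F : H.expansion.Edge → ℝ) :
    ∑ p, F p = ∑ e, ((∑ i : Fin (H.loadSet e).card, F ⟨e, i.castSucc⟩) + F ⟨e, Fin.last _⟩) :=
  (Fintype.sum_sigma F).trans (Finset.sum_congr rfl fun _ _ => Fin.sum_univ_castSucc _)

theorem sum_expansion_succ (F : H.expansion.Edge → ℝ) :
    ∑ p, F p = ∑ e, (F ⟨e, 0⟩ + ∑ i : Fin (H.loadSet e).card, F ⟨e, i.succ⟩) :=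
  (Fintype.sum_sigma F).trans (Finset.sum_congr rfl fun _ _ => Fin.sum_univ_succ _)

theorem expansion_src_zero (e : H.Edge) : H.expansion.src ⟨e, 0⟩ = Sum.inl (H.src e) := rfl

theorem expansion_src_succ (e : H.Edge) (i : Fin (H.loadSet e).card) :
    H.expansion.src ⟨e, i.succ⟩ = Sum.inr ⟨e, i⟩ := rfl

theorem expansion_tgt_last (e : H.Edge) :
    H.expansion.tgt ⟨e, Fin.last _⟩ = Sum.inl (H.tgt e) := by
  simp [expansion]

theorem expansion_tgt_castSucc (e : H.Edge) (i : Fin (H.loadSet e).card) :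
    H.expansion.tgt ⟨e, i.castSucc⟩ = Sum.inr ⟨e, i⟩ := by
  simp [expansion]

theorem expansion_weight_last (b : Bool) (z : ι → Bool) (e : H.Edge) :
    H.expansion.weight b z ⟨e, Fin.last _⟩ = 0 := by
  simp [expansion]

theorem expansion_weight_castSucc (b : Bool) (z : ι → Bool) (e : H.Edge)
    (i : Fin (H.loadSet e).card) :
    H.expansion.weight b z ⟨e, i.castSucc⟩ = H.scale z e * sparseWeight (H.loadSet e) b z i := by
  simp [expansion]

theorem expansion_label_src (e : H.Edge) (k : Fin ((H.loadSet e).card + 1)) :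
    H.expansion.label (H.expansion.src ⟨e, k⟩) =
      H.label (H.src e) ∪ sparsePrefix (H.loadSet e) k.val := by
  cases k using Fin.cases with
  | zero => rw [expansion_src_zero]; simp [expansion]
  | succ i => rfl

theorem expansion_label_tgt_castSucc (e : H.Edge) (i : Fin (H.loadSet e).card) :
    H.expansion.label (H.expansion.tgt ⟨e, i.castSucc⟩) =
      H.label (H.src e) ∪ sparsePrefix (H.loadSet e) (i.val + 1) := by
  rw [expansion_tgt_castSucc]
  rfl

theorem expansion_label_tgt_castSucc_eq_insert (e : H.Edge) (i : Fin (H.loadSet e).card) :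
    H.expansion.label (H.expansion.tgt ⟨e, i.castSucc⟩) =
      insert (sparseElem (H.loadSet e) i)
        (H.expansion.label (H.expansion.src ⟨e, i.castSucc⟩)) := by
  rw [expansion_label_tgt_castSucc, expansion_label_src, sparsePrefix_succ, Finset.union_insert]
  rfl

theorem sparseElem_notMem_label_src (e : H.Edge) (i : Fin (H.loadSet e).card) :
    sparseElem (H.loadSet e) i ∉ H.expansion.label (H.expansion.src ⟨e, i.castSucc⟩) := by
  rw [expansion_label_src, Finset.mem_union, not_or]
  exact ⟨(Finset.mem_sdiff.1 (sparseElem_mem (H.loadSet e) i)).2,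
    sparseElem_notMem_sparsePrefix _ i⟩

theorem expansion_loading_castSucc (e : H.Edge) (i : Fin (H.loadSet e).card) :
    H.expansion.Loading ⟨e, i.castSucc⟩ := by
  unfold LGraph.Loading
  rw [expansion_label_tgt_castSucc_eq_insert]
  exact Finset.insert_ne_self.2 (H.sparseElem_notMem_label_src e i)

theorem not_expansion_loading_last {e : H.Edge} (h : H.label (H.src e) ⊆ H.label (H.tgt e)) :
    ¬ H.expansion.Loading ⟨e, Fin.last _⟩ := by
  unfold LGraph.Loading
  rw [not_not, expansion_label_src, Fin.val_last, sparsePrefix_card,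
    expansion_tgt_last, loadSet, Finset.union_sdiff_of_subset h]
  rfl

open Classical in
theorem sum_expansion_loading (hmono : ∀ e, H.label (H.src e) ⊆ H.label (H.tgt e))
    (F : H.expansion.Edge → ℝ) :
    ∑ p, (if H.expansion.Loading p then F p else 0) = ∑ e, ∑ i, F ⟨e, Fin.castSucc i⟩ := by
  refine (H.sum_expansion_castSucc _).trans (Finset.sum_congr rfl fun e _ => ?_)
  rw [if_neg (H.not_expansion_loading_last (hmono e)), add_zero]
  exact Finset.sum_congr rfl fun i _ => if_pos (H.expansion_loading_castSucc e i)

open Classical in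
theorem netOut_expansion_inl (y : ι → Bool) (v : H.Vert) :
    H.expansion.netOut y (Sum.inl v) = H.netOut y v := by
  unfold LGraph.netOut netOut
  congr 1
  · refine (H.sum_expansion_succ _).trans (Finset.sum_congr rfl fun e _ => ?_)
    rw [Finset.sum_eq_zero fun i _ => if_neg (by rw [expansion_src_succ]; exact Sum.inr_ne_inl),
      add_zero, expansion_src_zero]
    exact if_congr Sum.inl_injective.eq_iff rfl rfl
  · refine (H.sum_expansion_castSucc _).trans (Finset.sum_congr rfl fun e _ => ?_)
    rw [Finset.sum_eq_zero fun i _ =>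
      if_neg (by rw [expansion_tgt_castSucc]; exact Sum.inr_ne_inl), zero_add, expansion_tgt_last]
    exact if_congr Sum.inl_injective.eq_iff rfl rfl

theorem netOut_expansion_inr (y : ι → Bool) (p : Σ e : H.Edge, Fin (H.loadSet e).card) :
    H.expansion.netOut y (Sum.inr p) = 0 := by
  unfold LGraph.netOut
  rw [sub_eq_zero]
  refine (H.sum_expansion_succ _).trans
    ((Finset.sum_congr rfl fun e _ => ?_).trans (H.sum_expansion_castSucc _).symm)
  rw [if_neg (by rw [expansion_src_zero]; exact Sum.inl_ne_inr),
    if_neg (by rw [expansion_tgt_last]; exact Sum.inl_ne_inr), add_zero, zero_add]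
  refine Finset.sum_congr rfl fun i _ => ?_
  rw [expansion_src_succ, expansion_tgt_castSucc]
  rfl

theorem reflTransGen_expansion_src (e : H.Edge) (k : Fin ((H.loadSet e).card + 1)) :
    Relation.ReflTransGen H.expansion.Adj (Sum.inl (H.src e)) (H.expansion.src ⟨e, k⟩) := by
  induction k using Fin.induction with
  | zero => exact .refl
  | succ i ih => exact ih.tail ⟨⟨e, i.castSucc⟩, rfl, expansion_tgt_castSucc H e i⟩

theorem reflTransGen_expansion_inl {u v : H.Vert} (h : Relation.ReflTransGen H.Adj u v) :
    Relation.ReflTransGen H.expansion.Adj (Sum.inl u) (Sum.inl v) := by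
  induction h with
  | refl => exact .refl
  | tail _ hab ih =>
    obtain ⟨e, rfl, rfl⟩ := hab
    exact (ih.trans (H.reflTransGen_expansion_src e (Fin.last _))).tail
      ⟨⟨e, Fin.last _⟩, rfl, H.expansion_tgt_last e⟩

/-- A level function on the expansion that refines `level` and increases along every edge: the inner
vertices of the path that replaces `e` come after `src e`, in their order, and before all vertices
of higher level. -/
def expansionLevel (level : H.Vert → ℕ) : H.expansion.Vert → ℕ ×ₗ ℕ
  | Sum.inl v => toLex (level v, 0)
  | Sum.inr ⟨e, i⟩ => toLex (level (H.src e), i.val + 1)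

theorem expansionLevel_src (level : H.Vert → ℕ) (e : H.Edge)
    (k : Fin ((H.loadSet e).card + 1)) :
    H.expansionLevel level (H.expansion.src ⟨e, k⟩) = toLex (level (H.src e), k.val) := by
  cases k using Fin.cases with
  | zero => rfl
  | succ i => rfl

theorem expansionLevel_src_lt_tgt {level : H.Vert → ℕ}
    (hlevel : ∀ e, level (H.src e) < level (H.tgt e)) (p : H.expansion.Edge) :
    H.expansionLevel level (H.expansion.src p) < H.expansionLevel level (H.expansion.tgt p) := by
  obtain ⟨e, k⟩ := p
  rw [expansionLevel_src]
  cases k using Fin.lastCases with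
  | last =>
    rw [expansion_tgt_last]
    exact Prod.Lex.toLex_lt_toLex.2 (Or.inl (hlevel e))
  | cast i =>
    rw [expansion_tgt_castSucc]
    exact Prod.Lex.toLex_lt_toLex.2 (Or.inr ⟨rfl, Nat.lt_succ_self _⟩)

theorem expansion_acyclic {level : H.Vert → ℕ}
    (hlevel : ∀ e, level (H.src e) < level (H.tgt e)) (v : H.expansion.Vert) :
    ¬ Relation.TransGen H.expansion.Adj v v := by
  intro hcycle
  have hlt : Relation.TransGen (· < ·) (H.expansionLevel level v) (H.expansionLevel level v) :=
    hcycle.lift _ fun _ _ ⟨e, hsrc, htgt⟩ => hsrc ▸ htgt ▸ H.expansionLevel_src_lt_tgt hlevel e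
  rw [Relation.transGen_eq_self] at hlt
  exact lt_irrefl _ hlt

end Expansion

namespace IsLayeredFor

variable {ι : Type} [DecidableEq ι] {H : SuperGraph ι} {f : (ι → Bool) → Prop} {level : H.Vert → ℕ}

theorem weight_nonneg (h : H.IsLayeredFor f level) (b : Bool) (z : ι → Bool)
    (p : H.expansion.Edge) : 0 ≤ H.expansion.weight b z p := by
  obtain ⟨e, k⟩ := p
  cases k using Fin.lastCases with
  | last => rw [expansion_weight_last]
  | cast i =>
    rw [expansion_weight_castSucc]
    exact mul_nonneg (h.scale_nonneg z e) (sparseWeight_pos _ _ _ _).le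

theorem weight_local (h : H.IsLayeredFor f level) (b : Bool) {z z' : ι → Bool}
    {p : H.expansion.Edge} (hz : AgreeOn (H.expansion.label (H.expansion.tgt p)) z z') :
    H.expansion.weight b z p = H.expansion.weight b z' p := by
  obtain ⟨e, k⟩ := p
  cases k using Fin.lastCases with
  | last => rw [expansion_weight_last, expansion_weight_last]
  | cast i =>
    rw [expansion_label_tgt_castSucc] at hz
    rw [expansion_weight_castSucc, expansion_weight_castSucc,
      h.scale_local z z' e fun j hj => hz j (Finset.mem_union_left _ hj),
      sparseWeight_congr b i fun j hj => hz j (Finset.mem_union_right _ hj)]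

theorem weight_compat (h : H.IsLayeredFor f level) {x y : ι → Bool} {p : H.expansion.Edge} {j : ι}
    (hj : H.expansion.label (H.expansion.tgt p) = insert j (H.expansion.label (H.expansion.src p)))
    (hagree : AgreeOn (H.expansion.label (H.expansion.src p)) x y) (hne : x j ≠ y j) :
    H.expansion.weight false x p = H.expansion.weight true y p := by
  obtain ⟨e, k⟩ := p
  cases k using Fin.lastCases with
  | last => rw [expansion_weight_last, expansion_weight_last]
  | cast i =>
    have hload : sparseElem (H.loadSet e) i = j := by
      rw [expansion_label_tgt_castSucc_eq_insert] at hj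
      exact (Finset.mem_insert.1 (hj ▸ Finset.mem_insert_self _ _)).resolve_right
        (H.sparseElem_notMem_label_src e i)
    rw [expansion_label_src] at hagree
    rw [expansion_weight_castSucc, expansion_weight_castSucc,
      h.scale_local x y e fun i hi => hagree i (Finset.mem_union_left _ hi),
      sparseWeight_false_eq_true i (fun i hi => hagree i (Finset.mem_union_right _ hi))
        (hload ▸ hne)]

theorem flow_eq_zero_of_weight_eq_zero (h : H.IsLayeredFor f level) {y : ι → Bool} (hy : f y)
    {p : H.expansion.Edge} (hp : H.expansion.Loading p) (hw : H.expansion.weight true y p = 0) :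
    H.expansion.flow y p = 0 := by
  obtain ⟨e, k⟩ := p
  cases k using Fin.lastCases with
  | last => exact absurd hp (H.not_expansion_loading_last (h.label_mono e))
  | cast i =>
    rw [expansion_weight_castSucc] at hw
    have hscale := (mul_eq_zero.1 hw).resolve_right (sparseWeight_pos _ _ _ _).ne'
    exact (hscale ▸ h.flow_le_scale y hy e).antisymm (h.flow_nonneg y hy e)

theorem isLearningGraphFor (h : H.IsLayeredFor f level) :
    H.expansion.IsLearningGraphFor Set.univ f where
  acyclic := H.expansion_acyclic (level := level) fun e => h.level_step e ▸ Nat.lt_succ_self _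
  rooted := fun ⟨e, k⟩ =>
    (H.reflTransGen_expansion_inl (h.rooted e)).trans (H.reflTransGen_expansion_src e k)
  label_root := h.label_root
  label_step := by
    rintro ⟨e, k⟩ hk
    cases k using Fin.lastCases with
    | last => exact absurd hk (H.not_expansion_loading_last (h.label_mono e))
    | cast i => exact ⟨_, H.sparseElem_notMem_label_src e i,
        H.expansion_label_tgt_castSucc_eq_insert e i⟩
  weight_nonneg := fun b z _ p => h.weight_nonneg b z p
  weight_local := fun b _ _ _ _ _ hz => h.weight_local b hz
  weight_compat := fun _ _ _ _ _ _ _ _ _ hj hagree hne => h.weight_compat hj hagree hne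
  flow_nonneg := fun y _ hy p => h.flow_nonneg y hy p.1
  flow_root := fun y _ hy => (H.netOut_expansion_inl y H.root).trans (h.flow_root y hy)
  flow_source := by
    rintro y - hy (v | p) hv
    · rw [netOut_expansion_inl]
      exact h.flow_source y hy v fun hroot => hv (congrArg Sum.inl hroot)
    · rw [netOut_expansion_inr]
  flow_support := fun _ _ hy _ hp hw => h.flow_eq_zero_of_weight_eq_zero hy hp hw
  sink_certificate := by
    rintro y - hy (v | p) hv
    · rw [netOut_expansion_inl] at hv
      exact h.sink_certificate y hy v hv
    · rw [netOut_expansion_inr] at hv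
      exact absurd hv (lt_irrefl _)

theorem negComplexity_le (h : H.IsLayeredFor f level) (z : ι → Bool) :
    H.expansion.negComplexity z ≤ ∑ e, H.scale z e *
      (6 * (((H.loadSet e).card : ℝ) * (onesOn z (H.loadSet e) + 1)) *
        Real.log (((H.loadSet e).card : ℝ) + 1)) := by
  refine (H.sum_expansion_loading h.label_mono _).trans_le (Finset.sum_le_sum fun e _ => ?_)
  simp only [expansion_weight_castSucc, ← Finset.mul_sum]
  exact mul_le_mul_of_nonneg_left (sum_sparseWeight_false_le _ z) (h.scale_nonneg z e)

theorem posComplexity_le (h : H.IsLayeredFor f level) {L : ℕ} (hL : ∀ e, level (H.tgt e) ≤ L)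
    {y : ι → Bool} (hy : f y) : H.expansion.posComplexity y ≤ 2 * L := by
  have hedge (e : H.Edge) : ∑ i, H.flow y e ^ 2 / H.expansion.weight true y ⟨e, Fin.castSucc i⟩ ≤
      2 * H.flow y e := by
    have hflow := h.flow_nonneg y hy e
    have hscale := h.flow_le_scale y hy e
    have hdiv : H.flow y e ^ 2 / H.scale y e ≤ H.flow y e :=
      div_le_of_le_mul₀ (hflow.trans hscale) hflow
        (sq (H.flow y e) ▸ mul_le_mul_of_nonneg_left hscale hflow)
    calc ∑ i, H.flow y e ^ 2 / H.expansion.weight true y ⟨e, Fin.castSucc i⟩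
        = H.flow y e ^ 2 / H.scale y e * ∑ i, (sparseWeight (H.loadSet e) true y i)⁻¹ := by
          simp only [expansion_weight_castSucc, Finset.mul_sum, div_eq_mul_inv, mul_inv, mul_assoc]
      _ ≤ H.flow y e * 2 :=
          mul_le_mul hdiv (sum_inv_sparseWeight_true_le _ _)
            (Finset.sum_nonneg fun i _ => inv_nonneg.2 (sparseWeight_pos _ _ _ _).le) hflow
      _ = 2 * H.flow y e := mul_comm _ _
  calc H.expansion.posComplexity y
      ≤ ∑ e, 2 * H.flow y e :=
        (H.sum_expansion_loading h.label_mono _).trans_le (Finset.sum_le_sum fun e _ => hedge e)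
    _ ≤ 2 * L := by
        rw [← Finset.mul_sum]
        exact mul_le_mul_of_nonneg_left (h.sum_flow_le hL hy) zero_le_two

end IsLayeredFor

end SuperGraph

/-! ## Sums over the super edges -/

/-- The pairs of elements of `B`. -/
def pairsIn {n : ℕ} (B : Finset (Fin n)) : Finset (Slot n) :=
  Finset.univ.filter fun e => ∀ u ∈ e.1, u ∈ B

theorem mem_pairsIn {n : ℕ} {B : Finset (Fin n)} {e : Slot n} :
    e ∈ pairsIn B ↔ ∀ u ∈ e.1, u ∈ B := by
  simp [pairsIn]

/-- A real function of the super edges, given by one function for each of their nine kinds. These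
functions do not see the proofs stored in the constructors of `TriEdge`, so that they can be summed
over finsets. -/
structure EdgeFun (n : ℕ) where
  star (X : Finset (Fin n)) (t : Fin n) : ℝ
  starPair (X : Finset (Fin n)) (t : Fin n) (e : Slot n) : ℝ
  walkA0 (X A : Finset (Fin n)) : ℝ
  walkA1 (X A : Finset (Fin n)) (j : Fin n) : ℝ
  walkA2 (X A : Finset (Fin n)) (j : Fin n) : ℝ
  walkB0 (X A : Finset (Fin n)) (w : Fin n) (B : Finset (Fin n)) : ℝ
  walkB1 (X A : Finset (Fin n)) (w : Fin n) (B : Finset (Fin n)) (j : Fin n) : ℝ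
  walkB2 (X A : Finset (Fin n)) (w : Fin n) (B : Finset (Fin n)) (j : Fin n) : ℝ
  pair (X A : Finset (Fin n)) (w : Fin n) (B : Finset (Fin n)) (e : Slot n) : ℝ

namespace EdgeFun

open Finset

variable {n : ℕ}

/-- The value of an `EdgeFun` at a super edge. -/
def eval {x a b : ℕ} (f : EdgeFun n) : TriEdge n x a b → ℝ
  | .star X t _ _ => f.star X t
  | .starPair X t e _ _ => f.starPair X t e
  | .walkA0 X A _ _ => f.walkA0 X A
  | .walkA1 X A j _ _ _ => f.walkA1 X A j
  | .walkA2 X A j _ _ _ => f.walkA2 X A j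
  | .walkB0 X A w B _ _ _ _ => f.walkB0 X A w B
  | .walkB1 X A w B j _ _ _ _ _ _ => f.walkB1 X A w B j
  | .walkB2 X A w B j _ _ _ _ _ _ => f.walkB2 X A w B j
  | .pair X A w B e _ _ _ _ _ => f.pair X A w B e

/-- The sum of an `EdgeFun` over the super edges that belong to `X`. -/
def sumAt (f : EdgeFun n) (a b : ℕ) (X : Finset (Fin n)) : ℝ :=
  (∑ t ∈ X, f.star X t) + ((∑ t ∈ X, ∑ e, f.starPair X t e) +
  ((∑ A ∈ powersetCard (a - 2) univ, f.walkA0 X A) +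
  ((∑ A ∈ powersetCard (a - 2) univ, ∑ j ∈ univ \ A, f.walkA1 X A j) +
  ((∑ A ∈ powersetCard (a - 1) univ, ∑ j ∈ univ \ A, f.walkA2 X A j) +
  ((∑ A ∈ powersetCard a univ, ∑ w, ∑ B ∈ powersetCard (b - 2) A, f.walkB0 X A w B) +
  ((∑ A ∈ powersetCard a univ, ∑ w, ∑ B ∈ powersetCard (b - 2) A, ∑ j ∈ A \ B,
    f.walkB1 X A w B j) +
  ((∑ A ∈ powersetCard a univ, ∑ w, ∑ B ∈ powersetCard (b - 1) A, ∑ j ∈ A \ B,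
    f.walkB2 X A w B j) +
  (∑ A ∈ powersetCard a univ, ∑ w, ∑ B ∈ powersetCard b A, ∑ e ∈ pairsIn B,
    f.pair X A w B e))))))))

end EdgeFun

/-- The nine kinds of super edges as iterated dependent sums. -/
abbrev TriEdgeSum (n x a b : ℕ) : Type :=
  Σ X : {X : Finset (Fin n) // X.card = x},
    {t // t ∈ X.1} ⊕ ({t // t ∈ X.1} × Slot n) ⊕ {A : Finset (Fin n) // A.card = a - 2} ⊕
    (Σ A : {A : Finset (Fin n) // A.card = a - 2}, {j // j ∉ A.1}) ⊕
    (Σ A : {A : Finset (Fin n) // A.card = a - 1}, {j // j ∉ A.1}) ⊕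
    (Σ A : {A : Finset (Fin n) // A.card = a}, Σ _ : Fin n, {B // B ⊆ A.1 ∧ B.card = b - 2}) ⊕
    (Σ A : {A : Finset (Fin n) // A.card = a}, Σ _ : Fin n,
      Σ B : {B // B ⊆ A.1 ∧ B.card = b - 2}, {j // j ∈ A.1 ∧ j ∉ B.1}) ⊕
    (Σ A : {A : Finset (Fin n) // A.card = a}, Σ _ : Fin n,
      Σ B : {B // B ⊆ A.1 ∧ B.card = b - 1}, {j // j ∈ A.1 ∧ j ∉ B.1}) ⊕
    (Σ A : {A : Finset (Fin n) // A.card = a}, Σ _ : Fin n,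
      Σ B : {B // B ⊆ A.1 ∧ B.card = b}, {e : Slot n // ∀ u ∈ e.1, u ∈ B.1})

/-- The correspondence between super edges and elements of the iterated dependent sum. -/
def triEdgeEquivSum (n x a b : ℕ) : TriEdge n x a b ≃ TriEdgeSum n x a b where
  toFun
    | .star X t hX ht => ⟨⟨X, hX⟩, .inl ⟨t, ht⟩⟩
    | .starPair X t e hX ht => ⟨⟨X, hX⟩, .inr (.inl (⟨t, ht⟩, e))⟩
    | .walkA0 X A hX hA => ⟨⟨X, hX⟩, .inr (.inr (.inl ⟨A, hA⟩))⟩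
    | .walkA1 X A j hX hA hj => ⟨⟨X, hX⟩, .inr (.inr (.inr (.inl ⟨⟨A, hA⟩, ⟨j, hj⟩⟩)))⟩
    | .walkA2 X A j hX hA hj => ⟨⟨X, hX⟩, .inr (.inr (.inr (.inr (.inl ⟨⟨A, hA⟩, ⟨j, hj⟩⟩))))⟩
    | .walkB0 X A w B hX hA hBA hB =>
        ⟨⟨X, hX⟩, .inr (.inr (.inr (.inr (.inr (.inl ⟨⟨A, hA⟩, w, ⟨B, hBA, hB⟩⟩)))))⟩
    | .walkB1 X A w B j hX hA hBA hB hjA hj =>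
        ⟨⟨X, hX⟩, .inr (.inr (.inr (.inr (.inr (.inr (.inl
          ⟨⟨A, hA⟩, w, ⟨B, hBA, hB⟩, ⟨j, hjA, hj⟩⟩))))))⟩
    | .walkB2 X A w B j hX hA hBA hB hjA hj =>
        ⟨⟨X, hX⟩, .inr (.inr (.inr (.inr (.inr (.inr (.inr (.inl
          ⟨⟨A, hA⟩, w, ⟨B, hBA, hB⟩, ⟨j, hjA, hj⟩⟩)))))))⟩
    | .pair X A w B e hX hA hBA hB he =>
        ⟨⟨X, hX⟩, .inr (.inr (.inr (.inr (.inr (.inr (.inr (.inr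
          ⟨⟨A, hA⟩, w, ⟨B, hBA, hB⟩, ⟨e, he⟩⟩)))))))⟩
  invFun
    | ⟨X, .inl t⟩ => .star X.1 t.1 X.2 t.2
    | ⟨X, .inr (.inl (t, e))⟩ => .starPair X.1 t.1 e X.2 t.2
    | ⟨X, .inr (.inr (.inl A))⟩ => .walkA0 X.1 A.1 X.2 A.2
    | ⟨X, .inr (.inr (.inr (.inl ⟨A, j⟩)))⟩ => .walkA1 X.1 A.1 j.1 X.2 A.2 j.2
    | ⟨X, .inr (.inr (.inr (.inr (.inl ⟨A, j⟩))))⟩ => .walkA2 X.1 A.1 j.1 X.2 A.2 j.2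
    | ⟨X, .inr (.inr (.inr (.inr (.inr (.inl ⟨A, w, B⟩)))))⟩ =>
        .walkB0 X.1 A.1 w B.1 X.2 A.2 B.2.1 B.2.2
    | ⟨X, .inr (.inr (.inr (.inr (.inr (.inr (.inl ⟨A, w, B, j⟩))))))⟩ =>
        .walkB1 X.1 A.1 w B.1 j.1 X.2 A.2 B.2.1 B.2.2 j.2.1 j.2.2
    | ⟨X, .inr (.inr (.inr (.inr (.inr (.inr (.inr (.inl ⟨A, w, B, j⟩)))))))⟩ =>
        .walkB2 X.1 A.1 w B.1 j.1 X.2 A.2 B.2.1 B.2.2 j.2.1 j.2.2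
    | ⟨X, .inr (.inr (.inr (.inr (.inr (.inr (.inr (.inr ⟨A, w, B, e⟩)))))))⟩ =>
        .pair X.1 A.1 w B.1 e.1 X.2 A.2 B.2.1 B.2.2 e.2
  left_inv e := by cases e <;> rfl
  right_inv s := by
    rcases s with ⟨X, t | ⟨t, e⟩ | A | ⟨A, j⟩ | ⟨A, j⟩ | ⟨A, w, B⟩ | ⟨A, w, B, j⟩ |
      ⟨A, w, B, j⟩ | ⟨A, w, B, e⟩⟩ <;> rfl

theorem sum_subtype_eq_sum {α M : Type*} [AddCommMonoid M] {p : α → Prop} [Fintype {i // p i}]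
    {s : Finset α} (hs : ∀ i, i ∈ s ↔ p i) {F : {i // p i} → M} {f : α → M}
    (hF : ∀ i, F i = f i) : ∑ i, F i = ∑ i ∈ s, f i :=
  (Fintype.sum_congr _ _ hF).trans (Finset.sum_subtype s hs f).symm

set_option synthInstance.maxSize 1024 in
-- for the `Fintype` instance of the ninefold sum `TriEdgeSum`
theorem EdgeFun.sum_eval {n : ℕ} (x a b : ℕ) (f : EdgeFun n) :
    ∑ e : TriEdge n x a b, f.eval e = ∑ X ∈ Finset.powersetCard x .univ, f.sumAt a b X := by
  have card_iff (k : ℕ) (A : Finset (Fin n)) :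
      A ∈ Finset.powersetCard k .univ ↔ A.card = k := Finset.mem_powersetCard_univ
  have subset_iff (k : ℕ) (A B : Finset (Fin n)) :
      B ∈ Finset.powersetCard k A ↔ B ⊆ A ∧ B.card = k := Finset.mem_powersetCard
  have compl_iff (A : Finset (Fin n)) (j : Fin n) : j ∈ Finset.univ \ A ↔ j ∉ A := by simp
  have sdiff_iff (A B : Finset (Fin n)) (j : Fin n) : j ∈ A \ B ↔ j ∈ A ∧ j ∉ B :=
    Finset.mem_sdiff
  rw [← (triEdgeEquivSum n x a b).symm.sum_comp, Fintype.sum_sigma]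
  refine sum_subtype_eq_sum (card_iff x) fun X => ?_
  simp only [sumAt, Fintype.sum_sum_type, Fintype.sum_sigma, Fintype.sum_prod_type]
  congr 1
  · exact sum_subtype_eq_sum (fun _ => .rfl) fun t => rfl
  congr 1
  · exact sum_subtype_eq_sum (fun _ => .rfl) fun t => rfl
  congr 1
  · exact sum_subtype_eq_sum (card_iff _) fun A => rfl
  congr 1
  · exact sum_subtype_eq_sum (card_iff _) fun A => sum_subtype_eq_sum (compl_iff _) fun j => rfl
  congr 1
  · exact sum_subtype_eq_sum (card_iff _) fun A => sum_subtype_eq_sum (compl_iff _) fun j => rfl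
  congr 1
  · exact sum_subtype_eq_sum (card_iff _) fun A => Fintype.sum_congr _ _ fun w =>
      sum_subtype_eq_sum (subset_iff _ _) fun B => rfl
  congr 1
  · exact sum_subtype_eq_sum (card_iff _) fun A => Fintype.sum_congr _ _ fun w =>
      sum_subtype_eq_sum (subset_iff _ _) fun B => sum_subtype_eq_sum (sdiff_iff _ _) fun j => rfl
  congr 1
  · exact sum_subtype_eq_sum (card_iff _) fun A => Fintype.sum_congr _ _ fun w =>
      sum_subtype_eq_sum (subset_iff _ _) fun B => sum_subtype_eq_sum (sdiff_iff _ _) fun j => rfl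
  · exact sum_subtype_eq_sum (card_iff _) fun A => Fintype.sum_congr _ _ fun w =>
      sum_subtype_eq_sum (subset_iff _ _) fun B =>
        sum_subtype_eq_sum (fun _ => mem_pairsIn) fun e => rfl

/-! ## The flow in a Johnson walk -/

section Johnson

open Finset

theorem unif_nonneg (N k : ℕ) : 0 ≤ unif N k := by
  unfold unif
  positivity

theorem card_powersetCard_mul_unif {α : Type*} {U : Finset α} {k : ℕ} (hk : k ≤ U.card) :
    ((powersetCard k U).card : ℝ) * unif U.card k = 1 := by
  have hpos : (U.card.choose k : ℝ) ≠ 0 := by exact_mod_cast (Nat.choose_pos hk).ne'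
  rw [card_powersetCard, unif, mul_one_div_cancel hpos]

theorem unif_mul_add_one_sub {M k : ℕ} (hk : k ≤ M) :
    unif M k * (M + 1 - k) = (M + 1) * unif (M + 1) k := by
  have hM : (M.choose k : ℝ) ≠ 0 := by exact_mod_cast (Nat.choose_pos hk).ne'
  have hM' : ((M + 1).choose k : ℝ) ≠ 0 := by exact_mod_cast (Nat.choose_pos (by lia)).ne'
  have hchoose : (M.choose k : ℝ) * (M + 1) = (M + 1).choose k * (M + 1 - k) := by
    have h := congrArg (Nat.cast (R := ℝ)) (Nat.choose_mul_succ_eq M k)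
    push_cast [Nat.cast_sub (show k ≤ M + 1 by lia)] at h
    exact h
  unfold unif
  field_simp
  linarith

theorem sum_powersetCard_sum_sdiff {α M : Type*} [DecidableEq α] [AddCommMonoid M] (U : Finset α)
    (k : ℕ) (f : Finset α → α → M) :
    ∑ A ∈ powersetCard k U, ∑ j ∈ U \ A, f A j =
      ∑ B ∈ powersetCard (k + 1) U, ∑ j ∈ B, f (B.erase j) j := by
  rw [sum_sigma', sum_sigma']
  refine sum_bij' (fun p _ => ⟨insert p.2 p.1, p.2⟩) (fun p _ => ⟨p.1.erase p.2, p.2⟩)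
    ?_ ?_ ?_ ?_ ?_
  · rintro ⟨A, j⟩ hp
    simp only [mem_sigma, mem_powersetCard, mem_sdiff] at hp ⊢
    exact ⟨⟨insert_subset hp.2.1 hp.1.1, by rw [card_insert_of_notMem hp.2.2, hp.1.2]⟩,
      mem_insert_self _ _⟩
  · rintro ⟨B, j⟩ hp
    simp only [mem_sigma, mem_powersetCard, mem_sdiff] at hp ⊢
    exact ⟨⟨(erase_subset _ _).trans hp.1.1, by rw [card_erase_of_mem hp.2, hp.1.2]; rfl⟩,
      hp.1.1 hp.2, notMem_erase _ _⟩
  · rintro ⟨A, j⟩ hp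
    rw [erase_insert (mem_sdiff.1 (mem_sigma.1 hp).2).2]
  · rintro ⟨B, j⟩ hp
    rw [insert_erase (mem_sigma.1 hp).2]
  · rintro ⟨A, j⟩ hp
    rw [erase_insert (mem_sdiff.1 (mem_sigma.1 hp).2).2]

theorem sum_ite_insert_eq {α M : Type*} [DecidableEq α] [AddCommMonoid M] (U A₀ : Finset α)
    (k : ℕ) (φ : Finset α → α → M) :
    (∑ A ∈ powersetCard k U, ∑ j ∈ U \ A, if insert j A = A₀ then φ A j else 0) =
      ∑ A ∈ powersetCard (k + 1) U, if A = A₀ then ∑ j ∈ A, φ (A.erase j) j else 0 := by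
  rw [sum_powersetCard_sum_sdiff]
  refine sum_congr rfl fun A _ => ?_
  rw [sum_congr rfl fun j hj => by rw [insert_erase hj]]
  split_ifs <;> simp

variable {n : ℕ}

theorem walkFlow1_nonneg {N k : ℕ} (hk : k ≤ N) (u : Fin n) (A : Finset (Fin n)) (j : Fin n) :
    0 ≤ walkFlow1 N k u A j := by
  have hkN : (k : ℝ) ≤ N := by exact_mod_cast hk
  have hunif := unif_nonneg N (k - 2)
  unfold walkFlow1
  split_ifs
  · exact div_nonneg hunif (by linarith)
  · exact hunif
  · exact le_rfl

theorem walkFlow1_le {N k : ℕ} (hk : k ≤ N) (u : Fin n) (A : Finset (Fin n)) (j : Fin n) :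
    walkFlow1 N k u A j ≤ unif N (k - 2) := by
  have hkN : (k : ℝ) ≤ N := by exact_mod_cast hk
  have hunif := unif_nonneg N (k - 2)
  unfold walkFlow1
  split_ifs
  · exact div_le_self hunif (by linarith)
  · exact le_rfl
  · exact hunif

theorem walkFlow2_nonneg {N k : ℕ} (hk : k ≤ N) (u v : Fin n) (A : Finset (Fin n)) (j : Fin n) :
    0 ≤ walkFlow2 N k u v A j := by
  have hkN : (k : ℝ) ≤ N := by exact_mod_cast hk
  have hunif := unif_nonneg (N - 1) (k - 2)
  unfold walkFlow2
  split_ifs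
  · exact div_nonneg hunif (by linarith)
  · exact hunif
  · exact le_rfl
  · exact le_rfl

theorem walkFlow2_le {N k : ℕ} (hk : k ≤ N) (u v : Fin n) (A : Finset (Fin n)) (j : Fin n) :
    walkFlow2 N k u v A j ≤ unif (N - 1) (k - 2) := by
  have hkN : (k : ℝ) ≤ N := by exact_mod_cast hk
  have hunif := unif_nonneg (N - 1) (k - 2)
  unfold walkFlow2
  split_ifs
  · exact div_le_self hunif (by linarith)
  · exact le_rfl
  · exact hunif
  · exact hunif

variable {U A : Finset (Fin n)} {k : ℕ} {u v : Fin n}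

theorem sum_walkFlow1_out (hk : 2 ≤ k) (hkU : k ≤ U.card) (hu : u ∈ U) (hAU : A ⊆ U)
    (hA : A.card = k - 2) :
    ∑ j ∈ U \ A, walkFlow1 U.card k u A j = unif U.card (k - 2) := by
  have hkU' : (k : ℝ) ≤ U.card := by exact_mod_cast hkU
  unfold walkFlow1
  split_ifs with huA
  · rw [sum_const, nsmul_eq_mul, cast_card_sdiff hAU, hA, Nat.cast_sub hk]
    have hne : (U.card : ℝ) - k + 2 ≠ 0 := by linarith
    push_cast
    field_simp
    ring
  · rw [sum_ite_eq', if_pos (mem_sdiff.2 ⟨hu, huA⟩)]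

theorem sum_walkFlow1_in (hk : 2 ≤ k) (hkU : k ≤ U.card) (hA : A.card = k - 1) :
    ∑ j ∈ A, walkFlow1 U.card k u (A.erase j) j =
      if u ∈ A then unif (U.card - 1) (k - 2) else 0 := by
  split_ifs with huA
  · have hspread : ∀ j ∈ A.erase u, walkFlow1 U.card k u (A.erase j) j =
        unif U.card (k - 2) / ((U.card : ℝ) - k + 2) := fun j hj =>
      if_pos (mem_erase.2 ⟨(mem_erase.1 hj).1.symm, huA⟩)
    have hdirect : walkFlow1 U.card k u (A.erase u) u = unif U.card (k - 2) := by
      rw [walkFlow1, if_neg (notMem_erase u A), if_pos rfl]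
    rw [← add_sum_erase A _ huA, hdirect, sum_congr rfl hspread, sum_const,
      card_erase_of_mem huA, hA, nsmul_eq_mul]
    obtain ⟨l, rfl⟩ := Nat.exists_eq_add_of_le' hk
    obtain ⟨N, hN⟩ := Nat.exists_eq_add_of_le' (by lia : 1 ≤ U.card)
    rw [hN] at hkU ⊢
    have hlN : (l : ℝ) + 1 ≤ N := by exact_mod_cast (by lia : l + 1 ≤ N)
    have hunif := unif_mul_add_one_sub (M := N) (k := l) (by lia)
    have hne : (N : ℝ) + 1 - (l + 2) + 2 ≠ 0 := by linarith
    simp only [Nat.add_sub_cancel, show l + 2 - 1 - 1 = l by lia]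
    push_cast
    field_simp
    linarith
  · refine sum_eq_zero fun j hj => ?_
    rw [walkFlow1, if_neg fun h => huA (mem_of_mem_erase h), if_neg]
    rintro rfl
    exact huA hj

theorem sum_walkFlow2_out (hk : 2 ≤ k) (hkU : k ≤ U.card) (hv : v ∈ U) (hAU : A ⊆ U)
    (hA : A.card = k - 1) :
    ∑ j ∈ U \ A, walkFlow2 U.card k u v A j =
      if u ∈ A then unif (U.card - 1) (k - 2) else 0 := by
  have hkU' : (k : ℝ) ≤ U.card := by exact_mod_cast hkU
  unfold walkFlow2
  split_ifs with huA hvA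
  · rw [sum_const, nsmul_eq_mul, cast_card_sdiff hAU, hA, Nat.cast_sub (by lia)]
    have hne : (U.card : ℝ) - k + 1 ≠ 0 := by linarith
    push_cast
    field_simp
    ring
  · rw [sum_ite_eq', if_pos (mem_sdiff.2 ⟨hv, hvA⟩)]
  · exact sum_const_zero

theorem sum_walkFlow2_in (hk : 2 ≤ k) (hkU : k ≤ U.card) (huv : u ≠ v) (hA : A.card = k) :
    ∑ j ∈ A, walkFlow2 U.card k u v (A.erase j) j =
      if u ∈ A ∧ v ∈ A then unif (U.card - 2) (k - 2) else 0 := by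
  split_ifs with h
  · obtain ⟨huA, hvA⟩ := h
    have huA' : u ∈ A.erase v := mem_erase.2 ⟨huv, huA⟩
    have hspread : ∀ j ∈ (A.erase v).erase u, walkFlow2 U.card k u v (A.erase j) j =
        unif (U.card - 1) (k - 2) / ((U.card : ℝ) - k + 1) := by
      intro j hj
      obtain ⟨hju, hj⟩ := mem_erase.1 hj
      rw [walkFlow2, if_pos (mem_erase.2 ⟨hju.symm, huA⟩),
        if_pos (mem_erase.2 ⟨(mem_erase.1 hj).1.symm, hvA⟩)]
    have hdirect : walkFlow2 U.card k u v (A.erase v) v = unif (U.card - 1) (k - 2) := by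
      rw [walkFlow2, if_pos huA', if_neg (notMem_erase v A), if_pos rfl]
    have hnone : walkFlow2 U.card k u v (A.erase u) u = 0 := by
      rw [walkFlow2, if_neg (notMem_erase u A)]
    rw [← add_sum_erase A _ hvA, ← add_sum_erase _ _ huA', hdirect, hnone,
      sum_congr rfl hspread, sum_const, card_erase_of_mem huA', card_erase_of_mem hvA, hA,
      nsmul_eq_mul]
    obtain ⟨l, rfl⟩ := Nat.exists_eq_add_of_le' hk
    obtain ⟨N, hN⟩ := Nat.exists_eq_add_of_le' (hk.trans hkU)
    rw [hN] at hkU ⊢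
    have hlN : (l : ℝ) ≤ N := by exact_mod_cast (by lia : l ≤ N)
    have hunif := unif_mul_add_one_sub (M := N) (k := l) (by lia)
    have hne : (N : ℝ) + 2 - (l + 2) + 1 ≠ 0 := by linarith
    simp only [Nat.add_sub_cancel, show N + 2 - 1 = N + 1 by lia, show l + 2 - 1 - 1 = l by lia]
    push_cast
    field_simp
    linarith
  · refine sum_eq_zero fun j hj => ?_
    unfold walkFlow2
    split_ifs with hu hv hjv
    · exact absurd ⟨mem_of_mem_erase hu, mem_of_mem_erase hv⟩ h
    · exact absurd ⟨mem_of_mem_erase hu, hjv ▸ hj⟩ h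
    · rfl
    · rfl

end Johnson

/-! ## Certificates, locality and the chosen triangles -/

section Locality

open Finset

variable {n : ℕ}

theorem mem_crossSlots {X A : Finset (Fin n)} {e : Slot n} :
    e ∈ crossSlots X A ↔ ∃ u ∈ X, ∃ v ∈ A, e.1 = s(u, v) := by
  simp [crossSlots]

theorem crossSlots_mono {X X' A A' : Finset (Fin n)} (hX : X ⊆ X') (hA : A ⊆ A') :
    crossSlots X A ⊆ crossSlots X' A' := by
  intro e he
  obtain ⟨u, hu, v, hv, h⟩ := mem_crossSlots.1 he
  exact mem_crossSlots.2 ⟨u, hX hu, v, hA hv, h⟩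

theorem adj_congr {S : Finset (Slot n)} {z z' : Slot n → Bool} {u v : Fin n}
    (h : AgreeOn S z z') (hS : ∀ e : Slot n, e.1 = s(u, v) → e ∈ S) :
    (graphOf z).Adj u v ↔ (graphOf z').Adj u v := by
  refine exists_congr fun hd => ?_
  rw [h _ (hS ⟨s(u, v), hd⟩ rfl)]

theorem inNbhd_congr {S : Finset (Slot n)} {z z' : Slot n → Bool} {t : Fin n}
    {B : Finset (Fin n)} {e : Slot n} (h : AgreeOn S z z') (hS : crossSlots {t} B ⊆ S)
    (he : ∀ u ∈ e.1, u ∈ B) : InNbhd z t e ↔ InNbhd z' t e :=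
  forall₂_congr fun u hu => adj_congr h fun _ he' =>
    hS (mem_crossSlots.2 ⟨t, mem_singleton_self t, u, he u hu, he'⟩)

theorem inDelta_congr {S : Finset (Slot n)} {z z' : Slot n → Bool} {X A : Finset (Fin n)}
    {e : Slot n} (h : AgreeOn S z z') (hS : crossSlots X A ⊆ S) (he : ∀ u ∈ e.1, u ∈ A) :
    InDelta z X e ↔ InDelta z' X e :=
  forall₂_congr fun _ ht => not_congr (inNbhd_congr h
    ((crossSlots_mono (singleton_subset_iff.2 ht) subset_rfl).trans hS) he)

theorem inNbhd_iff {z : Slot n → Bool} {t u v : Fin n} {e : Slot n} (he : e.1 = s(u, v)) :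
    InNbhd z t e ↔ (graphOf z).Adj t u ∧ (graphOf z).Adj t v := by
  simp [InNbhd, he]

theorem triScale_nonneg {x a b : ℕ} (z : Slot n → Bool) (e : TriEdge n x a b) :
    0 ≤ triScale z e := by
  have hunif := unif_nonneg
  have hunif₂ (N k N' k' : ℕ) := mul_nonneg (hunif N k) (hunif N' k')
  cases e <;> simp only [triScale] <;> (try split_ifs) <;>
    first
    | exact le_rfl
    | exact hunif _ _
    | exact hunif₂ _ _ _ _
    | exact mul_nonneg (hunif₂ _ _ _ _) (hunif _ _)

theorem triScale_local {x a b : ℕ} {z z' : Slot n → Bool} (e : TriEdge n x a b)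
    (h : AgreeOn (triLabel e.src) z z') : triScale z e = triScale z' e := by
  classical
  cases e with
  | starPair X t e hX ht =>
    simp only [triScale]
    exact if_congr (inNbhd_congr h subset_rfl fun _ _ => mem_univ _) rfl rfl
  | pair X A w B e hX hA hBA hB he =>
    simp only [triScale]
    exact if_congr (and_congr (inNbhd_congr h subset_union_right he)
      (inDelta_congr h subset_union_left fun u hu => hBA (he u hu))) rfl rfl
  | _ => rfl

theorem isOneCertificate_of_triangle {y : Slot n → Bool} {t u v : Fin n} {S : Finset (Slot n)}
    (htu : (graphOf y).Adj t u) (htv : (graphOf y).Adj t v) (huv : (graphOf y).Adj u v)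
    (htuS : ∀ e : Slot n, e.1 = s(t, u) → e ∈ S) (htvS : ∀ e : Slot n, e.1 = s(t, v) → e ∈ S)
    (huvS : ∀ e : Slot n, e.1 = s(u, v) → e ∈ S) :
    IsOneCertificate Set.univ HasTriangle y S := fun _ _ hz =>
  ⟨t, u, v, (adj_congr hz htuS).2 htu, (adj_congr hz htvS).2 htv, (adj_congr hz huvS).2 huv⟩

/-- The triple `p = (t, u, v)` is the triangle towards which the flow of the part of the graph
that belongs to `X` is routed; it avoids `X` only if `uv` has no common neighbour in `X`. -/
structure IsChosen (y : Slot n → Bool) (X : Finset (Fin n)) (p : Fin n × Fin n × Fin n) :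
    Prop where
  eq : chosenTriangle y X = some p
  adj₁₂ : (graphOf y).Adj p.1 p.2.1
  adj₁₃ : (graphOf y).Adj p.1 p.2.2
  adj₂₃ : (graphOf y).Adj p.2.1 p.2.2
  avoid : p.1 ∉ X → ∀ t ∈ X, ¬ ((graphOf y).Adj t p.2.1 ∧ (graphOf y).Adj t p.2.2)

theorem exists_isChosen {y : Slot n → Bool} (hy : HasTriangle y) (X : Finset (Fin n)) :
    ∃ p, IsChosen y X p := by
  by_cases hX : ∃ p : Fin n × Fin n × Fin n, p.1 ∈ X ∧ (graphOf y).Adj p.1 p.2.1 ∧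
      (graphOf y).Adj p.1 p.2.2 ∧ (graphOf y).Adj p.2.1 p.2.2
  · obtain ⟨hmem, h₁₂, h₁₃, h₂₃⟩ := hX.choose_spec
    exact ⟨hX.choose, dif_pos hX, h₁₂, h₁₃, h₂₃, fun hnot => absurd hmem hnot⟩
  · have htri : ∃ p : Fin n × Fin n × Fin n, (graphOf y).Adj p.1 p.2.1 ∧
        (graphOf y).Adj p.1 p.2.2 ∧ (graphOf y).Adj p.2.1 p.2.2 := by
      obtain ⟨t, u, v, h⟩ := hy
      exact ⟨(t, u, v), h⟩
    obtain ⟨h₁₂, h₁₃, h₂₃⟩ := htri.choose_spec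
    exact ⟨htri.choose, (dif_neg hX).trans (dif_pos htri), h₁₂, h₁₃, h₂₃,
      fun _ t ht h => hX ⟨(t, htri.choose.2), ht, h.1, h.2, h₂₃⟩⟩

theorem IsChosen.triFlow_eq {x a b : ℕ} {y : Slot n → Bool} {e : TriEdge n x a b}
    {p : Fin n × Fin n × Fin n} (hp : IsChosen y e.setX p) :
    triFlow y e = triFlowTo p.1 p.2.1 p.2.2 e := by
  unfold triFlow
  rw [hp.eq]

theorem triFlowTo_nonneg {x a b : ℕ} (han : a ≤ n) (hba : b ≤ a) (t u v : Fin n)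
    (e : TriEdge n x a b) : 0 ≤ triFlowTo t u v e := by
  have hunif := unif_nonneg
  have hunif₂ (N k N' k' : ℕ) := mul_nonneg (hunif N k) (hunif N' k')
  cases e <;> simp only [triFlowTo] <;> split_ifs <;>
    first
    | exact le_rfl
    | exact hunif _ _
    | exact hunif₂ _ _ _ _
    | exact mul_nonneg (hunif _ _) (walkFlow1_nonneg han _ _ _)
    | exact mul_nonneg (hunif _ _) (walkFlow2_nonneg han _ _ _ _)
    | exact mul_nonneg (hunif₂ _ _ _ _) (hunif _ _)
    | exact mul_nonneg (hunif₂ _ _ _ _) (walkFlow1_nonneg hba _ _ _)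
    | exact mul_nonneg (hunif₂ _ _ _ _) (walkFlow2_nonneg hba _ _ _ _)

theorem IsChosen.triFlowTo_le_triScale {x a b : ℕ} (han : a ≤ n) (hba : b ≤ a)
    {y : Slot n → Bool} {p : Fin n × Fin n × Fin n} {e : TriEdge n x a b}
    (hp : IsChosen y e.setX p) : triFlowTo p.1 p.2.1 p.2.2 e ≤ triScale y e := by
  have hunif := unif_nonneg
  have hunif₂ (N k N' k' : ℕ) := mul_nonneg (hunif N k) (hunif N' k')
  have ite_le {P : Prop} [Decidable P] {r : ℝ} (hr : P → r ≤ triScale y e) :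
      (if P then r else 0) ≤ triScale y e := by
    split_ifs with hP
    exacts [hr hP, triScale_nonneg y e]
  have inNbhd {w : Fin n} {e' : Slot n} (hw : w = p.1) (he' : e'.1 = s(p.2.1, p.2.2)) :
      InNbhd y w e' := hw ▸ (inNbhd_iff he').2 ⟨hp.adj₁₂, hp.adj₁₃⟩
  cases e with
  | star | walkA0 | walkB0 => exact ite_le fun _ => le_rfl
  | starPair X t e => exact ite_le fun h => (if_pos (inNbhd h.2.1 h.2.2)).ge
  | walkA1 => exact ite_le fun _ => mul_le_mul_of_nonneg_left (walkFlow1_le han _ _ _) (hunif _ _)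
  | walkA2 =>
    exact ite_le fun _ => mul_le_mul_of_nonneg_left (walkFlow2_le han _ _ _ _) (hunif _ _)
  | walkB1 =>
    exact ite_le fun _ => mul_le_mul_of_nonneg_left (walkFlow1_le hba _ _ _) (hunif₂ _ _ _ _)
  | walkB2 =>
    exact ite_le fun _ => mul_le_mul_of_nonneg_left (walkFlow2_le hba _ _ _ _) (hunif₂ _ _ _ _)
  | pair X A w B e =>
    exact ite_le fun h => (if_pos ⟨inNbhd h.2.1 h.2.2, fun t ht hN =>
      hp.avoid h.1 t ht ((inNbhd_iff h.2.2).1 hN)⟩).ge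

end Locality

/-! ## Levels and reachability -/

section Levels

open Finset

variable {n x a b : ℕ}

/-- The number of super edges on the paths from the root to a vertex. The truncated subtractions
are exact on the vertices that are reached, where `a - 2 ≤ A.card` and `b - 2 ≤ B.card`. -/
def triLevel (a b : ℕ) : TriVert n → ℕ
  | .root => 0
  | .star _ _ => 1
  | .starPair _ _ _ => 2
  | .walkA _ A => A.card + 3 - a
  | .walkB _ _ _ B => B.card + 6 - b
  | .pair _ _ _ _ _ => 7

theorem triLevel_tgt (hb : 2 ≤ b) (hba : b ≤ a) (e : TriEdge n x a b) :
    triLevel a b e.tgt = triLevel a b e.src + 1 := by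
  cases e <;> simp only [TriEdge.tgt, TriEdge.src, triLevel] <;>
    (try rw [card_insert_of_notMem ‹_›]) <;> lia

theorem triLevel_tgt_le (hb : 2 ≤ b) (ha : 2 ≤ a) (e : TriEdge n x a b) :
    triLevel a b e.tgt ≤ 7 := by
  cases e <;> simp only [TriEdge.tgt, triLevel] <;>
    (try rw [card_insert_of_notMem ‹_›]) <;> lia

theorem triLabel_mono (e : TriEdge n x a b) : triLabel e.src ⊆ triLabel e.tgt := by
  cases e with
  | star | walkA0 => exact empty_subset _
  | starPair | walkB0 | pair => exact subset_union_left
  | walkA1 | walkA2 => exact crossSlots_mono subset_rfl (subset_insert _ _)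
  | walkB1 | walkB2 =>
    exact union_subset_union subset_rfl (crossSlots_mono subset_rfl (subset_insert _ _))

/-- The vertex `v` is reached from the root in `triangleSuperGraph n x a b`. -/
def TriReachable (n x a b : ℕ) (v : TriVert n) : Prop :=
  Relation.ReflTransGen (triangleSuperGraph n x a b).Adj TriVert.root v

theorem TriReachable.step (e : TriEdge n x a b) (h : TriReachable n x a b e.src) :
    TriReachable n x a b e.tgt :=
  Relation.ReflTransGen.tail h ⟨e, rfl, rfl⟩

theorem triReachable_walkA0 {X A : Finset (Fin n)} (hX : X.card = x) (hA : A.card = a - 2) :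
    TriReachable n x a b (.walkA X A) :=
  TriReachable.step (.walkA0 X A hX hA) .refl

theorem triReachable_walkA1 (ha : 2 ≤ a) {X A : Finset (Fin n)} (hX : X.card = x)
    (hA : A.card = a - 1) : TriReachable n x a b (.walkA X A) := by
  obtain ⟨j, hj⟩ : A.Nonempty := card_pos.1 (by lia)
  have hcard : (A.erase j).card = a - 2 := by rw [card_erase_of_mem hj]; lia
  have hstep := TriReachable.step (.walkA1 X (A.erase j) j hX hcard (notMem_erase j A))
    (triReachable_walkA0 (b := b) hX hcard)
  rwa [TriEdge.tgt, insert_erase hj] at hstep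

theorem triReachable_walkA2 (ha : 2 ≤ a) {X A : Finset (Fin n)} (hX : X.card = x)
    (hA : A.card = a) : TriReachable n x a b (.walkA X A) := by
  obtain ⟨j, hj⟩ : A.Nonempty := card_pos.1 (by lia)
  have hcard : (A.erase j).card = a - 1 := by rw [card_erase_of_mem hj]; lia
  have hstep := TriReachable.step (.walkA2 X (A.erase j) j hX hcard (notMem_erase j A))
    (triReachable_walkA1 (b := b) ha hX hcard)
  rwa [TriEdge.tgt, insert_erase hj] at hstep

theorem triReachable_walkB0 (ha : 2 ≤ a) {X A B : Finset (Fin n)} (w : Fin n)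
    (hX : X.card = x) (hA : A.card = a) (hBA : B ⊆ A) (hB : B.card = b - 2) :
    TriReachable n x a b (.walkB X A w B) :=
  TriReachable.step (.walkB0 X A w B hX hA hBA hB) (triReachable_walkA2 ha hX hA)

theorem triReachable_walkB1 (ha : 2 ≤ a) (hb : 2 ≤ b) {X A B : Finset (Fin n)} (w : Fin n)
    (hX : X.card = x) (hA : A.card = a) (hBA : B ⊆ A) (hB : B.card = b - 1) :
    TriReachable n x a b (.walkB X A w B) := by
  obtain ⟨j, hj⟩ : B.Nonempty := card_pos.1 (by lia)
  have hcard : (B.erase j).card = b - 2 := by rw [card_erase_of_mem hj]; lia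
  have hsub := (erase_subset j B).trans hBA
  have hstep := TriReachable.step
    (.walkB1 X A w (B.erase j) j hX hA hsub hcard (hBA hj) (notMem_erase j B))
    (triReachable_walkB0 ha w hX hA hsub hcard)
  rwa [TriEdge.tgt, insert_erase hj] at hstep

theorem triReachable_walkB2 (ha : 2 ≤ a) (hb : 2 ≤ b) {X A B : Finset (Fin n)} (w : Fin n)
    (hX : X.card = x) (hA : A.card = a) (hBA : B ⊆ A) (hB : B.card = b) :
    TriReachable n x a b (.walkB X A w B) := by
  obtain ⟨j, hj⟩ : B.Nonempty := card_pos.1 (by lia)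
  have hcard : (B.erase j).card = b - 1 := by rw [card_erase_of_mem hj]; lia
  have hsub := (erase_subset j B).trans hBA
  have hstep := TriReachable.step
    (.walkB2 X A w (B.erase j) j hX hA hsub hcard (hBA hj) (notMem_erase j B))
    (triReachable_walkB1 ha hb w hX hA hsub hcard)
  rwa [TriEdge.tgt, insert_erase hj] at hstep

theorem triReachable_src (hb : 2 ≤ b) (hba : b ≤ a) (e : TriEdge n x a b) :
    TriReachable n x a b e.src := by
  have ha := hb.trans hba
  cases e with
  | star | walkA0 => exact .refl
  | starPair X t e hX ht => exact TriReachable.step (.star X t hX ht) .refl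
  | walkA1 X A j hX hA hj => exact triReachable_walkA0 hX hA
  | walkA2 X A j hX hA hj => exact triReachable_walkA1 ha hX hA
  | walkB0 X A w B hX hA hBA hB => exact triReachable_walkA2 ha hX hA
  | walkB1 X A w B j hX hA hBA hB hjA hj => exact triReachable_walkB0 ha w hX hA hBA hB
  | walkB2 X A w B j hX hA hBA hB hjA hj => exact triReachable_walkB1 ha hb w hX hA hBA hB
  | pair X A w B e hX hA hBA hB he => exact triReachable_walkB2 ha hb w hX hA hBA hB

end Levels

/-! ## Conservation of the flow -/

section FlowConservation

open Finset

variable {n x a b : ℕ} {T : Finset (Fin n) → Fin n × Fin n × Fin n}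

/-- The flow of the learning graph, when the part that belongs to `X` is routed towards the triangle
`T X`: the values of `triFlowTo` as functions on finsets. -/
noncomputable def flowFun (x a b : ℕ) (T : Finset (Fin n) → Fin n × Fin n × Fin n) : EdgeFun n where
  star X t := if (T X).1 ∈ X ∧ t = (T X).1 then unif n x else 0
  starPair X t e :=
    if (T X).1 ∈ X ∧ t = (T X).1 ∧ e.1 = s((T X).2.1, (T X).2.2) then unif n x else 0
  walkA0 X _ := if (T X).1 ∉ X then unif n x * unif n (a - 2) else 0
  walkA1 X A j := if (T X).1 ∉ X then unif n x * walkFlow1 n a (T X).2.1 A j else 0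
  walkA2 X A j := if (T X).1 ∉ X then unif n x * walkFlow2 n a (T X).2.1 (T X).2.2 A j else 0
  walkB0 X A w _ :=
    if (T X).1 ∉ X ∧ (T X).2.1 ∈ A ∧ (T X).2.2 ∈ A ∧ w = (T X).1 then
      unif n x * unif (n - 2) (a - 2) * unif a (b - 2) else 0
  walkB1 X A w B j :=
    if (T X).1 ∉ X ∧ (T X).2.1 ∈ A ∧ (T X).2.2 ∈ A ∧ w = (T X).1 then
      unif n x * unif (n - 2) (a - 2) * walkFlow1 a b (T X).2.1 B j else 0
  walkB2 X A w B j :=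
    if (T X).1 ∉ X ∧ (T X).2.1 ∈ A ∧ (T X).2.2 ∈ A ∧ w = (T X).1 then
      unif n x * unif (n - 2) (a - 2) * walkFlow2 a b (T X).2.1 (T X).2.2 B j else 0
  pair X _ w _ e :=
    if (T X).1 ∉ X ∧ w = (T X).1 ∧ e.1 = s((T X).2.1, (T X).2.2) then
      unif n x * unif (n - 2) (a - 2) * unif (a - 2) (b - 2) else 0

theorem flowFun_eval {y : Slot n → Bool} (hT : ∀ X, IsChosen y X (T X)) (e : TriEdge n x a b) :
    (flowFun x a b T).eval e = triFlow y e := by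
  rw [(hT _).triFlow_eq]
  cases e <;> rfl

theorem sum_ite_eq_mk {B : Finset (Slot n)} {u v : Fin n} (huv : u ≠ v) (c : ℝ) :
    (∑ e ∈ B, if e.1 = s(u, v) then c else 0) =
      if (⟨s(u, v), by simpa using huv⟩ : Slot n) ∈ B then c else 0 := by
  rw [← sum_ite_eq' B (⟨s(u, v), by simpa using huv⟩ : Slot n) fun _ => c]
  exact sum_congr rfl fun e _ => if_congr
    ⟨fun h => Subtype.ext h, fun h => congrArg Subtype.val h⟩ rfl rfl

variable {X A B : Finset (Fin n)} {w : Fin n}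

theorem sum_flowFun_starPair (huv : (T X).2.1 ≠ (T X).2.2) (t : Fin n) :
    ∑ e, (flowFun x a b T).starPair X t e = (flowFun x a b T).star X t := by
  simp only [flowFun, ← and_assoc, ite_and (_ ∧ _)]
  split_ifs
  · rw [sum_ite_eq_mk huv, if_pos (mem_univ _)]
  · exact sum_const_zero

theorem sum_flowFun_walkA1_out (ha : 2 ≤ a) (han : a ≤ n) (hA : A.card = a - 2) :
    ∑ j ∈ univ \ A, (flowFun x a b T).walkA1 X A j = (flowFun x a b T).walkA0 X A := by
  have hout := sum_walkFlow1_out (u := (T X).2.1) ha (han.trans_eq (card_fin n).symm) (mem_univ _)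
    (subset_univ A) hA
  rw [card_fin] at hout
  simp only [flowFun]
  split_ifs
  · exact sum_const_zero
  · rw [← mul_sum, hout]

theorem sum_flowFun_walkA1_in (ha : 2 ≤ a) (han : a ≤ n) (hA : A.card = a - 1) :
    ∑ j ∈ A, (flowFun x a b T).walkA1 X (A.erase j) j =
      ∑ j ∈ univ \ A, (flowFun x a b T).walkA2 X A j := by
  have hn : a ≤ (univ : Finset (Fin n)).card := han.trans_eq (card_fin n).symm
  have hin := sum_walkFlow1_in (u := (T X).2.1) ha hn hA
  have hout := sum_walkFlow2_out (u := (T X).2.1) (v := (T X).2.2) ha hn (mem_univ _)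
    (subset_univ A) hA
  rw [card_fin] at hin hout
  simp only [flowFun]
  split_ifs
  · simp only [sum_const_zero]
  · rw [← mul_sum, ← mul_sum, hin, hout]

theorem sum_flowFun_walkA2_in (hb : 2 ≤ b) (hba : b ≤ a) (han : a ≤ n)
    (huv : (T X).2.1 ≠ (T X).2.2) (hA : A.card = a) :
    ∑ j ∈ A, (flowFun x a b T).walkA2 X (A.erase j) j =
      ∑ w, ∑ B ∈ powersetCard (b - 2) A, (flowFun x a b T).walkB0 X A w B := by
  have hin := sum_walkFlow2_in (hb.trans hba) (han.trans_eq (card_fin n).symm) huv hA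
  rw [card_fin] at hin
  have hcard := card_powersetCard_mul_unif (U := A) (k := b - 2) (by lia)
  rw [hA] at hcard
  simp only [flowFun]
  by_cases hX : (T X).1 ∈ X
  · simp only [hX, not_true, if_false, false_and, sum_const_zero]
  simp only [hX, not_false_eq_true, true_and, if_true, sum_const, nsmul_eq_mul]
  rw [← mul_sum, hin]
  by_cases hA : (T X).2.1 ∈ A ∧ (T X).2.2 ∈ A
  · simp only [hA, and_self, true_and, if_true, mul_ite, mul_zero]
    rw [sum_ite_eq', if_pos (mem_univ _)]
    linear_combination (- unif n x * unif (n - 2) (a - 2)) * hcard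
  · rw [if_neg hA, mul_zero, eq_comm]
    exact sum_eq_zero fun w _ => by rw [if_neg fun h => hA ⟨h.1, h.2.1⟩, mul_zero]

theorem sum_flowFun_walkB1_out (hb : 2 ≤ b) (hba : b ≤ a) (hA : A.card = a) (hBA : B ⊆ A)
    (hB : B.card = b - 2) :
    ∑ j ∈ A \ B, (flowFun x a b T).walkB1 X A w B j = (flowFun x a b T).walkB0 X A w B := by
  simp only [flowFun]
  split_ifs with h
  · have hout := sum_walkFlow1_out hb (hba.trans_eq hA.symm) h.2.1 hBA hB
    rw [hA] at hout
    rw [← mul_sum, hout]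
  · exact sum_const_zero

theorem sum_flowFun_walkB1_in (hb : 2 ≤ b) (hba : b ≤ a) (hA : A.card = a) (hBA : B ⊆ A)
    (hB : B.card = b - 1) :
    ∑ j ∈ B, (flowFun x a b T).walkB1 X A w (B.erase j) j =
      ∑ j ∈ A \ B, (flowFun x a b T).walkB2 X A w B j := by
  simp only [flowFun]
  split_ifs with h
  · have hin := sum_walkFlow1_in (u := (T X).2.1) hb (hba.trans_eq hA.symm) hB
    have hout := sum_walkFlow2_out (u := (T X).2.1) hb (hba.trans_eq hA.symm) h.2.2.1 hBA hB
    rw [hA] at hin hout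
    rw [← mul_sum, ← mul_sum, hin, hout]
  · simp only [sum_const_zero]

theorem sum_flowFun_walkB2_in (hb : 2 ≤ b) (hba : b ≤ a) (huv : (T X).2.1 ≠ (T X).2.2)
    (hA : A.card = a) (hBA : B ⊆ A) (hB : B.card = b) :
    ∑ j ∈ B, (flowFun x a b T).walkB2 X A w (B.erase j) j =
      ∑ e ∈ pairsIn B, (flowFun x a b T).pair X A w B e := by
  have hin := sum_walkFlow2_in hb (hba.trans_eq hA.symm) huv hB
  rw [hA] at hin
  simp only [flowFun, ← and_assoc, ite_and (_ ∧ _) (_ = s(_, _))]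
  by_cases hw : (T X).1 ∉ X ∧ w = (T X).1
  · simp only [hw, not_false_eq_true, and_self, true_and, if_true, and_true]
    rw [sum_ite_eq_mk huv]
    have hmem : (⟨s((T X).2.1, (T X).2.2), by simpa using huv⟩ : Slot n) ∈ pairsIn B ↔
        (T X).2.1 ∈ B ∧ (T X).2.2 ∈ B := by
      simp [mem_pairsIn]
    by_cases huvB : (T X).2.1 ∈ B ∧ (T X).2.2 ∈ B
    · rw [if_pos (hmem.2 huvB)]
      simp only [hBA huvB.1, hBA huvB.2, and_self, if_true]
      rw [← mul_sum, hin, if_pos huvB]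
    · rw [if_neg (mt hmem.1 huvB)]
      split_ifs
      · rw [← mul_sum, hin, if_neg huvB, mul_zero]
      · exact sum_const_zero
  · have hw' : ¬ ((((T X).1 ∉ X ∧ (T X).2.1 ∈ A) ∧ (T X).2.2 ∈ A) ∧ w = (T X).1) :=
      fun h => hw ⟨h.1.1.1, h.2⟩
    simp only [hw, hw', if_false, sum_const_zero]

end FlowConservation

namespace EdgeFun

variable {n x a b : ℕ}

open Classical in
/-- The restriction of `f` to the super edges that leave the vertex `V`. -/
noncomputable def atSrc (f : EdgeFun n) (V : TriVert n) : EdgeFun n where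
  star X t := if .root = V then f.star X t else 0
  starPair X t e := if .star X t = V then f.starPair X t e else 0
  walkA0 X A := if .root = V then f.walkA0 X A else 0
  walkA1 X A j := if .walkA X A = V then f.walkA1 X A j else 0
  walkA2 X A j := if .walkA X A = V then f.walkA2 X A j else 0
  walkB0 X A w B := if .walkA X A = V then f.walkB0 X A w B else 0
  walkB1 X A w B j := if .walkB X A w B = V then f.walkB1 X A w B j else 0
  walkB2 X A w B j := if .walkB X A w B = V then f.walkB2 X A w B j else 0
  pair X A w B e := if .walkB X A w B = V then f.pair X A w B e else 0

open Classical in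
/-- The restriction of `f` to the super edges that enter the vertex `V`. -/
noncomputable def atTgt (f : EdgeFun n) (V : TriVert n) : EdgeFun n where
  star X t := if .star X t = V then f.star X t else 0
  starPair X t e := if .starPair X t e = V then f.starPair X t e else 0
  walkA0 X A := if .walkA X A = V then f.walkA0 X A else 0
  walkA1 X A j := if .walkA X (insert j A) = V then f.walkA1 X A j else 0
  walkA2 X A j := if .walkA X (insert j A) = V then f.walkA2 X A j else 0
  walkB0 X A w B := if .walkB X A w B = V then f.walkB0 X A w B else 0
  walkB1 X A w B j := if .walkB X A w (insert j B) = V then f.walkB1 X A w B j else 0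
  walkB2 X A w B j := if .walkB X A w (insert j B) = V then f.walkB2 X A w B j else 0
  pair X A w B e := if .pair X A w B e = V then f.pair X A w B e else 0

open Classical in
theorem eval_atSrc (f : EdgeFun n) (V : TriVert n) (e : TriEdge n x a b) :
    (f.atSrc V).eval e = if e.src = V then f.eval e else 0 := by
  cases e <;> rfl

open Classical in
theorem eval_atTgt (f : EdgeFun n) (V : TriVert n) (e : TriEdge n x a b) :
    (f.atTgt V).eval e = if e.tgt = V then f.eval e else 0 := by
  cases e <;> rfl

end EdgeFun

section NetOut

open Finset

variable {n x a b : ℕ} {y : Slot n → Bool} {T : Finset (Fin n) → Fin n × Fin n × Fin n}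

open Classical in
theorem netOut_triangleSuperGraph (y : Slot n → Bool) (V : TriVert n) :
    (triangleSuperGraph n x a b).netOut y V =
      (∑ e : TriEdge n x a b, if e.src = V then triFlow y e else 0) -
        ∑ e : TriEdge n x a b, if e.tgt = V then triFlow y e else 0 :=
  rfl

theorem netOut_eq_sum_sumAt (hT : ∀ X, IsChosen y X (T X)) (V : TriVert n) :
    (triangleSuperGraph n x a b).netOut y V =
      ∑ X ∈ powersetCard x univ, ((flowFun x a b T).atSrc V).sumAt a b X -
        ∑ X ∈ powersetCard x univ, ((flowFun x a b T).atTgt V).sumAt a b X := by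
  rw [netOut_triangleSuperGraph, ← EdgeFun.sum_eval, ← EdgeFun.sum_eval]
  simp only [EdgeFun.eval_atSrc, EdgeFun.eval_atTgt, flowFun_eval hT]

theorem netOut_root (hx : x ≤ n) (han : a ≤ n) (hT : ∀ X, IsChosen y X (T X)) :
    (triangleSuperGraph n x a b).netOut y TriVert.root = 1 := by
  have hsumX := card_powersetCard_mul_unif (U := (univ : Finset (Fin n))) (k := x)
    (by rwa [card_fin])
  have hsumA := card_powersetCard_mul_unif (U := (univ : Finset (Fin n))) (k := a - 2)
    (by rw [card_fin]; lia)
  rw [card_fin] at hsumX hsumA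
  rw [netOut_eq_sum_sumAt hT]
  simp only [EdgeFun.sumAt, EdgeFun.atSrc, EdgeFun.atTgt, reduceCtorEq, if_false, if_true,
    sum_const_zero, add_zero, zero_add, sub_zero]
  have hX : ∀ X ∈ powersetCard x (univ : Finset (Fin n)),
      (∑ t ∈ X, (flowFun x a b T).star X t) +
        ∑ A ∈ powersetCard (a - 2) univ, (flowFun x a b T).walkA0 X A = unif n x := by
    intro X _
    simp only [flowFun]
    by_cases hX : (T X).1 ∈ X
    · simp [hX]
    · simp only [hX, false_and, if_false, sum_const_zero, zero_add, not_false_eq_true, if_true,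
        sum_const, nsmul_eq_mul]
      linear_combination unif n x * hsumA
  rw [sum_congr rfl hX, sum_const, nsmul_eq_mul, hsumX]

theorem netOut_star (hT : ∀ X, IsChosen y X (T X)) (X₀ : Finset (Fin n)) (t₀ : Fin n) :
    (triangleSuperGraph n x a b).netOut y (.star X₀ t₀) = 0 := by
  rw [netOut_eq_sum_sumAt hT, sub_eq_zero]
  refine sum_congr rfl fun X _ => ?_
  simp only [EdgeFun.sumAt, EdgeFun.atSrc, EdgeFun.atTgt, reduceCtorEq, if_false, sum_const_zero,
    add_zero, zero_add]
  refine sum_congr rfl fun t _ => ?_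
  split_ifs
  · exact sum_flowFun_starPair (hT X).adj₂₃.ne t
  · exact sum_const_zero

theorem netOut_walkA (hb : 2 ≤ b) (hba : b ≤ a) (han : a ≤ n) (hT : ∀ X, IsChosen y X (T X))
    (X₀ A₀ : Finset (Fin n)) :
    (triangleSuperGraph n x a b).netOut y (.walkA X₀ A₀) = 0 := by
  classical
  have ha := hb.trans hba
  rw [netOut_eq_sum_sumAt hT, sub_eq_zero]
  refine sum_congr rfl fun X _ => ?_
  simp only [EdgeFun.sumAt, EdgeFun.atSrc, EdgeFun.atTgt, reduceCtorEq, if_false, sum_const_zero,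
    add_zero, zero_add, TriVert.walkA.injEq]
  by_cases hX : X = X₀
  swap
  · simp only [hX, false_and, if_false, sum_const_zero]
  simp only [hX, true_and, sum_ite_insert_eq, sum_ite_irrel, sum_const_zero]
  rw [show a - 2 + 1 = a - 1 by lia, show a - 1 + 1 = a by lia]
  refine congrArg₂ (· + ·) (sum_congr rfl fun A hA => ?_)
    (congrArg₂ (· + ·) (sum_congr rfl fun A hA => ?_) (sum_congr rfl fun A hA => ?_))
  all_goals
    refine if_congr Iff.rfl ?_ rfl
    rw [mem_powersetCard_univ] at hA
  · exact sum_flowFun_walkA1_out ha han hA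
  · exact (sum_flowFun_walkA1_in ha han hA).symm
  · exact (sum_flowFun_walkA2_in hb hba han (hT X₀).adj₂₃.ne hA).symm

theorem netOut_walkB (hb : 2 ≤ b) (hba : b ≤ a) (hT : ∀ X, IsChosen y X (T X))
    (X₀ A₀ : Finset (Fin n)) (w₀ : Fin n) (B₀ : Finset (Fin n)) :
    (triangleSuperGraph n x a b).netOut y (.walkB X₀ A₀ w₀ B₀) = 0 := by
  classical
  rw [netOut_eq_sum_sumAt hT, sub_eq_zero]
  refine sum_congr rfl fun X _ => ?_
  simp only [EdgeFun.sumAt, EdgeFun.atSrc, EdgeFun.atTgt, reduceCtorEq, if_false, sum_const_zero,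
    add_zero, zero_add, TriVert.walkB.injEq]
  simp only [← sum_add_distrib]
  refine sum_congr rfl fun A hA => sum_congr rfl fun w _ => ?_
  rw [mem_powersetCard_univ] at hA
  by_cases hXAw : X = X₀ ∧ A = A₀ ∧ w = w₀
  swap
  · have hne (B) : ¬ (X = X₀ ∧ A = A₀ ∧ w = w₀ ∧ B = B₀) := fun h => hXAw ⟨h.1, h.2.1, h.2.2.1⟩
    simp only [hne, if_false, sum_const_zero]
  simp only [hXAw, true_and, sum_ite_insert_eq, sum_ite_irrel, sum_const_zero]
  rw [show b - 2 + 1 = b - 1 by lia, show b - 1 + 1 = b by lia]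
  obtain ⟨-, rfl, -⟩ := hXAw
  refine congrArg₂ (· + ·) (sum_congr rfl fun B hB => ?_)
    (congrArg₂ (· + ·) (sum_congr rfl fun B hB => ?_) (sum_congr rfl fun B hB => ?_))
  all_goals
    refine if_congr Iff.rfl ?_ rfl
    rw [mem_powersetCard] at hB
  · exact sum_flowFun_walkB1_out hb hba hA hB.1 hB.2
  · exact (sum_flowFun_walkB1_in hb hba hA hB.1 hB.2).symm
  · exact (sum_flowFun_walkB2_in hb hba (hT X₀).adj₂₃.ne hA hB.1 hB.2).symm

theorem triFlow_nonneg (hba : b ≤ a) (han : a ≤ n) (hT : ∀ X, IsChosen y X (T X))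
    (e : TriEdge n x a b) : 0 ≤ triFlow y e :=
  (triFlowTo_nonneg han hba _ _ _ e).trans_eq (hT _).triFlow_eq.symm

theorem netOut_nonpos_of_forall_src_ne (hba : b ≤ a) (han : a ≤ n)
    (hT : ∀ X, IsChosen y X (T X)) {V : TriVert n} (hV : ∀ e : TriEdge n x a b, e.src ≠ V) :
    (triangleSuperGraph n x a b).netOut y V ≤ 0 := by
  rw [netOut_triangleSuperGraph, sum_eq_zero fun e _ => if_neg (hV e), zero_sub, neg_nonpos]
  refine sum_nonneg fun e _ => ?_
  split_ifs
  exacts [triFlow_nonneg hba han hT e, le_rfl]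

theorem exists_triFlow_ne_zero_of_netOut_neg (hba : b ≤ a) (han : a ≤ n)
    (hT : ∀ X, IsChosen y X (T X)) {V : TriVert n}
    (hV : (triangleSuperGraph n x a b).netOut y V < 0) :
    ∃ e : TriEdge n x a b, e.tgt = V ∧ triFlow y e ≠ 0 := by
  classical
  by_contra! hzero
  have hin : (∑ e : TriEdge n x a b, if e.tgt = V then triFlow y e else 0) = 0 :=
    sum_eq_zero fun e _ => ite_eq_right_iff.2 (hzero e)
  refine hV.not_ge ?_
  rw [netOut_triangleSuperGraph, hin, sub_zero]
  refine sum_nonneg fun e _ => ?_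
  split_ifs
  exacts [triFlow_nonneg hba han hT e, le_rfl]

theorem mem_crossSlots_singleton {t v : Fin n} {B : Finset (Fin n)} {e : Slot n} (hv : v ∈ B)
    (he : e.1 = s(t, v)) : e ∈ crossSlots {t} B :=
  mem_crossSlots.2 ⟨t, mem_singleton_self t, v, hv, he⟩

theorem isOneCertificate_label_tgt_starPair (hT : ∀ X, IsChosen y X (T X)) {X : Finset (Fin n)}
    {t : Fin n} {e : Slot n} {hX : X.card = x} {ht : t ∈ X}
    (hflow : triFlow y (.starPair X t e hX ht : TriEdge n x a b) ≠ 0) :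
    IsOneCertificate Set.univ HasTriangle y (triLabel (.starPair X t e)) := by
  rw [(hT X).triFlow_eq] at hflow
  obtain ⟨⟨-, rfl, he⟩, -⟩ := ite_ne_right_iff.1 hflow
  exact isOneCertificate_of_triangle (hT X).adj₁₂ (hT X).adj₁₃ (hT X).adj₂₃
    (fun _ h => mem_union_left _ (mem_crossSlots_singleton (mem_univ _) h))
    (fun _ h => mem_union_left _ (mem_crossSlots_singleton (mem_univ _) h))
    (fun _ h => mem_union_right _ (mem_singleton.2 (Subtype.ext (h.trans he.symm))))

theorem isOneCertificate_label_tgt_pair (hT : ∀ X, IsChosen y X (T X)) {X A B : Finset (Fin n)}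
    {w : Fin n} {e : Slot n} {hX : X.card = x} {hA : A.card = a} {hBA : B ⊆ A} {hB : B.card = b}
    {heB : ∀ u ∈ e.1, u ∈ B}
    (hflow : triFlow y (.pair X A w B e hX hA hBA hB heB : TriEdge n x a b) ≠ 0) :
    IsOneCertificate Set.univ HasTriangle y (triLabel (.pair X A w B e)) := by
  rw [(hT X).triFlow_eq] at hflow
  obtain ⟨⟨-, rfl, he⟩, -⟩ := ite_ne_right_iff.1 hflow
  have hu : (T X).2.1 ∈ B := heB _ (he ▸ Sym2.mem_mk_left _ _)
  have hv : (T X).2.2 ∈ B := heB _ (he ▸ Sym2.mem_mk_right _ _)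
  exact isOneCertificate_of_triangle (hT X).adj₁₂ (hT X).adj₁₃ (hT X).adj₂₃
    (fun _ h => mem_union_left _ (mem_union_right _ (mem_crossSlots_singleton hu h)))
    (fun _ h => mem_union_left _ (mem_union_right _ (mem_crossSlots_singleton hv h)))
    (fun _ h => mem_union_right _ (mem_singleton.2 (Subtype.ext (h.trans he.symm))))

theorem netOut_nonpos (hb : 2 ≤ b) (hba : b ≤ a) (han : a ≤ n) (hT : ∀ X, IsChosen y X (T X))
    {V : TriVert n} (hV : V ≠ .root) : (triangleSuperGraph n x a b).netOut y V ≤ 0 := by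
  cases V with
  | root => exact absurd rfl hV
  | star X t => exact (netOut_star hT X t).le
  | walkA X A => exact (netOut_walkA hb hba han hT X A).le
  | walkB X A w B => exact (netOut_walkB hb hba hT X A w B).le
  | starPair => exact netOut_nonpos_of_forall_src_ne hba han hT fun e => by cases e <;> nofun
  | pair => exact netOut_nonpos_of_forall_src_ne hba han hT fun e => by cases e <;> nofun

theorem isOneCertificate_of_netOut_neg (hb : 2 ≤ b) (hba : b ≤ a) (han : a ≤ n)
    (hT : ∀ X, IsChosen y X (T X)) {V : TriVert n}
    (hV : (triangleSuperGraph n x a b).netOut y V < 0) :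
    IsOneCertificate Set.univ HasTriangle y (triLabel V) := by
  obtain ⟨e, rfl, hflow⟩ := exists_triFlow_ne_zero_of_netOut_neg hba han hT hV
  cases e with
  | starPair => exact isOneCertificate_label_tgt_starPair hT hflow
  | pair => exact isOneCertificate_label_tgt_pair hT hflow
  | star => exact absurd (netOut_star hT _ _) hV.ne
  | walkA0 | walkA1 | walkA2 => exact absurd (netOut_walkA hb hba han hT _ _) hV.ne
  | walkB0 | walkB1 | walkB2 => exact absurd (netOut_walkB hb hba hT _ _ _ _) hV.ne

theorem triangleSuperGraph_isLayeredFor (hx : x ≤ n) (hb : 2 ≤ b) (hba : b ≤ a) (han : a ≤ n) :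
    (triangleSuperGraph n x a b).IsLayeredFor HasTriangle (triLevel a b) where
  level_root := rfl
  level_step := triLevel_tgt hb hba
  rooted := triReachable_src hb hba
  label_root := rfl
  label_mono := triLabel_mono
  scale_nonneg := triScale_nonneg
  scale_local _ _ e h := triScale_local e h
  flow_nonneg y hy e := by
    choose T hT using exists_isChosen hy
    exact triFlow_nonneg hba han hT e
  flow_le_scale y hy e := by
    obtain ⟨p, hp⟩ := exists_isChosen hy e.setX
    exact hp.triFlow_eq.trans_le (hp.triFlowTo_le_triScale han hba)
  flow_root y hy := by
    choose T hT using exists_isChosen hy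
    exact netOut_root hx han hT
  flow_source y hy V hV := by
    choose T hT using exists_isChosen hy
    exact netOut_nonpos hb hba han hT hV
  sink_certificate y hy V hV := by
    choose T hT using exists_isChosen hy
    exact isOneCertificate_of_netOut_neg hb hba han hT hV

end NetOut

/-! ## Averages over subsets of a fixed size -/

section Averages

open Finset

theorem unif_pred_pred {N k : ℕ} (hk : 1 ≤ k) (hkN : k ≤ N) :
    unif (N - 1) (k - 1) = (N : ℝ) / k * unif N k := by
  obtain ⟨k, rfl⟩ := Nat.exists_eq_add_of_le' hk
  obtain ⟨N, rfl⟩ := Nat.exists_eq_add_of_le' (hk.trans hkN)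
  have hpred : (N.choose k : ℝ) ≠ 0 := by exact_mod_cast (Nat.choose_pos (by lia)).ne'
  have hsucc : ((N + 1).choose (k + 1) : ℝ) ≠ 0 := by
    exact_mod_cast (Nat.choose_pos (by lia)).ne'
  have hchoose : ((N : ℝ) + 1) * N.choose k = (N + 1).choose (k + 1) * ((k : ℝ) + 1) := by
    exact_mod_cast Nat.add_one_mul_choose_eq N k
  simp only [unif, Nat.add_sub_cancel]
  push_cast
  field_simp
  linarith

theorem unif_sub_two {N k : ℕ} (hk : 2 ≤ k) (hkN : k ≤ N) :
    unif (N - 2) (k - 2) = (N : ℝ) * (N - 1) / (k * (k - 1)) * unif N k := by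
  have hpred := unif_pred_pred (N := N - 1) (k := k - 1) (by lia) (by lia)
  rw [unif_pred_pred (by lia) hkN, Nat.cast_sub (by lia), Nat.cast_sub (by lia)] at hpred
  rw [show N - 2 = N - 1 - 1 by lia, show k - 2 = k - 1 - 1 by lia, hpred]
  have hk' : (2 : ℝ) ≤ k := by exact_mod_cast hk
  have hk₁ : (k : ℝ) - 1 ≠ 0 := by linarith
  push_cast
  field_simp

theorem unif_mul_sum_powersetCard_filter {α ι : Type*} [DecidableEq α] {U : Finset α} {d k : ℕ}
    (hdk : d ≤ k) (hkU : k ≤ U.card) (I : Finset ι) (supp : ι → Finset α)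
    (hsupp : ∀ i ∈ I, supp i ⊆ U ∧ (supp i).card = d) (h : ι → ℝ) :
    unif (U.card - d) (k - d) * ∑ B ∈ powersetCard k U, ∑ i ∈ I with supp i ⊆ B, h i =
      ∑ i ∈ I, h i := by
  have hpos : ((U.card - d).choose (k - d) : ℝ) ≠ 0 := by
    exact_mod_cast (Nat.choose_pos (by lia)).ne'
  simp only [sum_filter]
  rw [sum_comm, mul_sum]
  refine sum_congr rfl fun i hi => ?_
  obtain ⟨hiU, hid⟩ := hsupp i hi
  rw [← sum_filter, sum_const, nsmul_eq_mul,
    card_filter_powersetCard_subset _ U k hiU (hid.trans_le hdk), hid, ← mul_assoc, unif,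
    one_div_mul_cancel hpos, one_mul]

section Avg

variable {α : Type*} {U : Finset α} {k : ℕ} {F G : Finset α → ℝ}

/-- The average of `F` over the `k`-subsets of `U`. -/
noncomputable def avg (U : Finset α) (k : ℕ) (F : Finset α → ℝ) : ℝ :=
  unif U.card k * ∑ A ∈ powersetCard k U, F A

theorem avg_mono (h : ∀ A ⊆ U, A.card = k → F A ≤ G A) : avg U k F ≤ avg U k G :=
  mul_le_mul_of_nonneg_left (sum_le_sum fun A hA =>
    h A (mem_powersetCard.1 hA).1 (mem_powersetCard.1 hA).2) (unif_nonneg _ _)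

theorem avg_const (hk : k ≤ U.card) (c : ℝ) : avg U k (fun _ => c) = c := by
  rw [avg, sum_const, nsmul_eq_mul]
  linear_combination c * card_powersetCard_mul_unif hk

theorem avg_le_const (hk : k ≤ U.card) {c : ℝ} (h : ∀ A ⊆ U, A.card = k → F A ≤ c) :
    avg U k F ≤ c :=
  (avg_mono h).trans_eq (avg_const hk c)

theorem avg_sum (hk : k ≤ U.card) (f : α → ℝ) :
    avg U k (fun A => ∑ j ∈ A, f j) = (k : ℝ) / U.card * ∑ j ∈ U, f j := by
  classical
  obtain rfl | hk₀ := Nat.eq_zero_or_pos k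
  · simp [avg]
  have hcount := unif_mul_sum_powersetCard_filter (d := 1) hk₀ hk U singleton
    (fun j hj => ⟨singleton_subset_iff.2 hj, card_singleton j⟩) f
  have hfilter : ∀ A ∈ powersetCard k U, ∑ j ∈ U with {j} ⊆ A, f j = ∑ j ∈ A, f j := by
    intro A hA
    simp only [singleton_subset_iff, filter_mem_eq_inter,
      inter_eq_right.2 (mem_powersetCard.1 hA).1]
  rw [sum_congr rfl hfilter, unif_pred_pred hk₀ hk] at hcount
  have hk' : (k : ℝ) ≠ 0 := by positivity
  have hU' : (U.card : ℝ) ≠ 0 := by exact_mod_cast (hk₀.trans_le hk).ne'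
  rw [← hcount, avg]
  field_simp

theorem avg_le (hk : k ≤ U.card) (c₁ c₂ : ℝ) (f : α → ℝ)
    (h : ∀ A ⊆ U, A.card = k → F A ≤ c₁ * ∑ j ∈ A, f j + c₂) :
    avg U k F ≤ c₁ * ((k : ℝ) / U.card * ∑ j ∈ U, f j) + c₂ := by
  refine (avg_mono h).trans_eq ?_
  have hconst : unif U.card k * ∑ _A ∈ powersetCard k U, c₂ = c₂ := avg_const hk c₂
  rw [← avg_sum hk, avg, avg, sum_add_distrib, ← mul_sum]
  linear_combination hconst

end Avg

variable {n : ℕ}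

theorem unif_mul_sum_pairsIn {U : Finset (Fin n)} {k : ℕ} (hk : 2 ≤ k) (hkU : k ≤ U.card)
    (h : Slot n → ℝ) :
    unif (U.card - 2) (k - 2) * ∑ B ∈ powersetCard k U, ∑ e ∈ pairsIn B, h e =
      ∑ e ∈ pairsIn U, h e := by
  have hsupp (B : Finset (Fin n)) (e : Slot n) : e.1.toFinset ⊆ B ↔ e ∈ pairsIn B := by
    simp only [mem_pairsIn, subset_iff, Sym2.mem_toFinset]
  have hcount := unif_mul_sum_powersetCard_filter hk hkU (pairsIn U) (fun e => e.1.toFinset)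
    (fun e he => ⟨(hsupp U e).2 he, Sym2.card_toFinset_of_not_isDiag _ e.2⟩) h
  have hfilter : ∀ B ∈ powersetCard k U, {e ∈ pairsIn U | e.1.toFinset ⊆ B} = pairsIn B := by
    intro B hB
    simp only [hsupp, filter_mem_eq_inter, inter_eq_right]
    exact fun e he => mem_pairsIn.2 fun u hu =>
      (mem_powersetCard.1 hB).1 (mem_pairsIn.1 he u hu)
  rw [sum_congr rfl fun B hB => by rw [hfilter B hB]] at hcount
  exact hcount

theorem pairsIn_univ : pairsIn (univ : Finset (Fin n)) = univ := by
  simp [pairsIn]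

theorem sum_card_of_disjoint_le {α : Type*} [DecidableEq α] (U D : Finset α) (x : ℕ)
    (hD : D ⊆ U) :
    (∑ X ∈ powersetCard x U, if Disjoint X D then D.card else 0) ≤ U.card.choose (x + 1) := by
  calc (∑ X ∈ powersetCard x U, if Disjoint X D then D.card else 0)
      ≤ ∑ X ∈ powersetCard x U, ∑ j ∈ U \ X, if Disjoint X D ∧ j ∈ D then 1 else 0 := by
        refine sum_le_sum fun X _ => ?_
        split_ifs with hX
        · simp only [hX, true_and, ← card_filter, filter_mem_eq_inter]
          refine card_le_card fun j hj => ?_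
          exact mem_inter.2 ⟨mem_sdiff.2 ⟨hD hj, disjoint_right.1 hX hj⟩, hj⟩
        · exact Nat.zero_le _
    _ = ∑ B ∈ powersetCard (x + 1) U, ∑ j ∈ B, if Disjoint (B.erase j) D ∧ j ∈ D then 1 else 0 :=
        sum_powersetCard_sum_sdiff U x _
    _ ≤ ∑ B ∈ powersetCard (x + 1) U, 1 := by
        refine sum_le_sum fun B _ => ?_
        rw [← card_filter, card_le_one]
        simp only [mem_filter]
        intro i hi j hj
        by_contra hij
        exact disjoint_left.1 hi.2.1 (mem_erase.2 ⟨Ne.symm hij, hj.1⟩) hj.2.2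
    _ = U.card.choose (x + 1) := by rw [sum_const, smul_eq_mul, mul_one, card_powersetCard]

theorem unif_mul_choose_succ_le {x : ℕ} (hx : 1 ≤ x) (hxn : x ≤ n) :
    unif n x * n.choose (x + 1) ≤ (n : ℝ) / x := by
  have hpos : (0 : ℝ) < n.choose x := by exact_mod_cast Nat.choose_pos hxn
  have hx' : (0 : ℝ) < x := by exact_mod_cast hx
  have : (0 : ℝ) ≤ n.choose (x + 1) := Nat.cast_nonneg _
  have hchoose : (n.choose (x + 1) : ℝ) * (x + 1) = n.choose x * ((n : ℝ) - x) := by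
    rw [← Nat.cast_sub hxn]
    exact_mod_cast Nat.choose_succ_right_eq n x
  rw [unif, one_div_mul_eq_div, div_le_div_iff₀ hpos hx']
  nlinarith

end Averages

/-! ## The cost of loading -/

section Cost

open Finset

variable {n : ℕ}

/-- The negative complexity of `SparseLoad S`, up to a logarithmic factor. -/
noncomputable def loadCost (z : Slot n → Bool) (S : Finset (Slot n)) : ℝ :=
  S.card * (onesOn z S + 1)

theorem loadCost_nonneg (z : Slot n → Bool) (S : Finset (Slot n)) : 0 ≤ loadCost z S := by
  unfold loadCost
  positivity

theorem loadCost_mono (z : Slot n → Bool) {S S' : Finset (Slot n)} (h : S ⊆ S') :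
    loadCost z S ≤ loadCost z S' := by
  have hcard : (S.card : ℝ) ≤ S'.card := by exact_mod_cast card_le_card h
  have hones : (onesOn z S : ℝ) ≤ onesOn z S' := by exact_mod_cast onesOn_mono z h
  unfold loadCost
  gcongr

theorem loadCost_le_two (z : Slot n → Bool) {S : Finset (Slot n)} (h : S.card ≤ 1) :
    loadCost z S ≤ 2 := by
  have hcard : (S.card : ℝ) ≤ 1 := by exact_mod_cast h
  have hones : (onesOn z S : ℝ) ≤ 1 := by exact_mod_cast (onesOn_le_card z S).trans h
  unfold loadCost
  nlinarith [(Nat.cast_nonneg S.card : (0 : ℝ) ≤ S.card)]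

open Classical in
/-- The adjacency relation of the graph `z`, as a `0`-`1` function. -/
noncomputable def adjInd (z : Slot n → Bool) (u v : Fin n) : ℝ :=
  if (graphOf z).Adj u v then 1 else 0

theorem adjInd_nonneg (z : Slot n → Bool) (u v : Fin n) : 0 ≤ adjInd z u v := by
  unfold adjInd
  split_ifs <;> norm_num

/-- The degree of the vertex `u` of the graph `z`, as a real number. -/
noncomputable def degree (z : Slot n → Bool) (u : Fin n) : ℝ := ∑ v, adjInd z u v

theorem degree_nonneg (z : Slot n → Bool) (u : Fin n) : 0 ≤ degree z u :=
  sum_nonneg fun v _ => adjInd_nonneg z u v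

theorem sum_degree {m : ℕ} {z : Slot n → Bool} (hz : z ∈ graphsWithEdges n m) :
    ∑ u, degree z u = 2 * m := by
  classical
  have hdegree (u : Fin n) : degree z u = (graphOf z).degree u := by
    unfold degree adjInd
    rw [sum_boole, ← SimpleGraph.card_neighborFinset_eq_degree,
      SimpleGraph.neighborFinset_eq_filter]
  have hedges : (graphOf z).edgeFinset.card = m := by
    rw [← hz, Set.ncard_eq_toFinset_card', SimpleGraph.edgeFinset]
  have hsum := (graphOf z).sum_degrees_eq_twice_card_edges
  rw [hedges] at hsum
  rw [sum_congr rfl fun u _ => hdegree u]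
  exact_mod_cast hsum

theorem card_le_card_of_forall_eq_mk {F : Finset (Slot n)} {R : Finset (Fin n × Fin n)}
    (h : ∀ e ∈ F, ∃ p ∈ R, e.1 = s(p.1, p.2)) : F.card ≤ R.card := by
  classical
  rw [← card_image_of_injective F Subtype.val_injective]
  refine (card_le_card (t := R.image fun p => s(p.1, p.2)) fun e he => ?_).trans card_image_le
  obtain ⟨e', he', rfl⟩ := mem_image.1 he
  obtain ⟨p, hp, h⟩ := h e' he'
  exact mem_image.2 ⟨p, hp, h.symm⟩

theorem card_slot_le : Fintype.card (Slot n) ≤ n ^ 2 := by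
  have h := card_le_card_of_forall_eq_mk (F := (univ : Finset (Slot n))) (R := univ) fun e _ => by
    obtain ⟨e, -⟩ := e
    induction e using Sym2.ind with
    | _ u v => exact ⟨(u, v), mem_univ _, rfl⟩
  rwa [card_univ, card_univ, Fintype.card_prod, Fintype.card_fin, ← pow_two] at h

theorem card_crossSlots_le (X A : Finset (Fin n)) : (crossSlots X A).card ≤ X.card * A.card := by
  rw [← card_product]
  refine card_le_card_of_forall_eq_mk fun e he => ?_
  obtain ⟨u, hu, v, hv, h⟩ := mem_crossSlots.1 he
  exact ⟨(u, v), mk_mem_product hu hv, h⟩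

theorem onesOn_crossSlots_le (z : Slot n → Bool) (X A : Finset (Fin n)) :
    (onesOn z (crossSlots X A) : ℝ) ≤ ∑ u ∈ X, ∑ v ∈ A, adjInd z u v := by
  classical
  have h : onesOn z (crossSlots X A) ≤
      ((X ×ˢ A).filter fun p => (graphOf z).Adj p.1 p.2).card := by
    refine card_le_card_of_forall_eq_mk fun e he => ?_
    obtain ⟨hmem, hone⟩ := mem_filter.1 he
    obtain ⟨u, hu, v, hv, huv⟩ := mem_crossSlots.1 hmem
    refine ⟨(u, v), mem_filter.2 ⟨mk_mem_product hu hv, ?_⟩, huv⟩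
    obtain ⟨e, hdiag⟩ := e
    obtain rfl : e = s(u, v) := huv
    exact ⟨hdiag, hone⟩
  unfold adjInd
  rw [← sum_product', sum_boole]
  exact_mod_cast h

theorem loadCost_crossSlots_le (z : Slot n → Bool) (X A : Finset (Fin n)) :
    loadCost z (crossSlots X A) ≤
      (X.card : ℝ) * A.card * ((∑ u ∈ X, ∑ v ∈ A, adjInd z u v) + 1) := by
  have hcard : ((crossSlots X A).card : ℝ) ≤ (X.card : ℝ) * A.card := by
    exact_mod_cast card_crossSlots_le X A
  have hones := onesOn_crossSlots_le z X A
  unfold loadCost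
  gcongr

theorem crossSlots_insert (X A : Finset (Fin n)) (j : Fin n) :
    crossSlots X (insert j A) = crossSlots X A ∪ crossSlots X {j} := by
  ext e
  simp only [mem_crossSlots, mem_insert, mem_union, mem_singleton]
  constructor
  · rintro ⟨u, hu, v, rfl | hv, h⟩
    · exact Or.inr ⟨u, hu, v, rfl, h⟩
    · exact Or.inl ⟨u, hu, v, hv, h⟩
  · rintro (⟨u, hu, v, hv, h⟩ | ⟨u, hu, v, hv, h⟩)
    · exact ⟨u, hu, v, Or.inr hv, h⟩
    · exact ⟨u, hu, v, Or.inl hv, h⟩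

open Classical in
theorem card_inNbhd_le (z : Slot n → Bool) (t : Fin n) :
    ((univ.filter fun e => InNbhd z t e).card : ℝ) ≤ n * degree z t := by
  have h : (univ.filter fun e => InNbhd z t e).card ≤
      ((univ : Finset (Fin n)) ×ˢ univ.filter fun v => (graphOf z).Adj t v).card := by
    refine card_le_card_of_forall_eq_mk fun e he => ?_
    have hadj := (mem_filter.1 he).2
    obtain ⟨e, _⟩ := e
    induction e using Sym2.ind with
    | _ u v =>
      exact ⟨(u, v), mk_mem_product (mem_univ _)
        (mem_filter.2 ⟨mem_univ _, hadj v (Sym2.mem_mk_right _ _)⟩), rfl⟩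
  rw [card_product, card_fin] at h
  unfold degree adjInd
  rw [sum_boole]
  exact_mod_cast h

section Scaled

variable {x a b : ℕ}

open Classical in
/-- Upper bounds for the products of `triScale` and `loadCost` at the nine kinds of super edges. -/
noncomputable def costBound (z : Slot n → Bool) (x a b : ℕ) : EdgeFun n where
  star _ t := unif n x * (n * (degree z t + 1))
  starPair _ t e := unif n x * if InNbhd z t e then 2 else 0
  walkA0 X A := unif n x * unif n (a - 2) * (x * a * ((∑ u ∈ X, ∑ v ∈ A, adjInd z u v) + 1))
  walkA1 X _ j := unif n x * unif n (a - 2) * (x * ((∑ u ∈ X, adjInd z u j) + 1))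
  walkA2 X _ j := unif n x * unif (n - 1) (a - 2) * (x * ((∑ u ∈ X, adjInd z u j) + 1))
  walkB0 _ _ w B := unif n x * unif (n - 2) (a - 2) * unif a (b - 2) *
    (b * ((∑ v ∈ B, adjInd z w v) + 1))
  walkB1 _ _ _ _ _ := unif n x * unif (n - 2) (a - 2) * unif a (b - 2) * 2
  walkB2 _ _ _ _ _ := unif n x * unif (n - 2) (a - 2) * unif (a - 1) (b - 2) * 2
  pair X _ w _ e := unif n x * unif (n - 2) (a - 2) * unif (a - 2) (b - 2) *
    if InNbhd z w e ∧ InDelta z X e then 2 else 0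

theorem loadCost_crossSlots_univ_le (z : Slot n → Bool) (t : Fin n) :
    loadCost z (crossSlots {t} univ) ≤ n * (degree z t + 1) := by
  simpa [degree] using loadCost_crossSlots_le z {t} univ

theorem loadCost_crossSlots_le_of_card_le (z : Slot n → Bool) {X A : Finset (Fin n)}
    (hX : X.card = x) (hA : A.card ≤ a) :
    loadCost z (crossSlots X A) ≤ x * a * ((∑ u ∈ X, ∑ v ∈ A, adjInd z u v) + 1) := by
  have hsum : 0 ≤ ∑ u ∈ X, ∑ v ∈ A, adjInd z u v :=
    sum_nonneg fun u _ => sum_nonneg fun v _ => adjInd_nonneg z u v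
  have hA' : (A.card : ℝ) ≤ a := by exact_mod_cast hA
  refine (loadCost_crossSlots_le z X A).trans ?_
  rw [hX]
  gcongr

theorem loadCost_crossSlots_insert_sdiff_le (z : Slot n → Bool) {X : Finset (Fin n)}
    (hX : X.card = x) (A : Finset (Fin n)) (j : Fin n) :
    loadCost z (crossSlots X (insert j A) \ crossSlots X A) ≤
      x * ((∑ u ∈ X, adjInd z u j) + 1) := by
  refine (loadCost_mono z (sdiff_le_iff.2 (crossSlots_insert X A j).subset)).trans ?_
  simpa [hX] using loadCost_crossSlots_le z X {j}

theorem loadCost_crossSlots_singleton_le (z : Slot n → Bool) (w : Fin n) {B : Finset (Fin n)}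
    (hB : B.card ≤ b) :
    loadCost z (crossSlots {w} B) ≤ b * ((∑ v ∈ B, adjInd z w v) + 1) := by
  simpa using loadCost_crossSlots_le_of_card_le z (card_singleton w) hB

theorem loadCost_union_crossSlots_insert_sdiff_le (z : Slot n → Bool) (S : Finset (Slot n))
    (w : Fin n) (B : Finset (Fin n)) (j : Fin n) :
    loadCost z ((S ∪ crossSlots {w} (insert j B)) \ (S ∪ crossSlots {w} B)) ≤ 2 := by
  refine loadCost_le_two z ((card_le_card ?_).trans (card_crossSlots_le {w} {j}))
  rw [crossSlots_insert, ← union_assoc]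
  exact sdiff_le_iff.2 subset_rfl

theorem loadCost_insert_sdiff_le (z : Slot n → Bool) (S : Finset (Slot n)) (e : Slot n) :
    loadCost z ((S ∪ {e}) \ S) ≤ 2 :=
  loadCost_le_two z ((card_le_card (sdiff_le_iff.2 subset_rfl)).trans_eq (card_singleton e))

theorem triScale_mul_loadCost_le (z : Slot n → Bool) (e : TriEdge n x a b) :
    triScale z e * loadCost z ((triangleSuperGraph n x a b).loadSet e) ≤
      (costBound z x a b).eval e := by
  have hX := unif_nonneg n x
  have hA (N k : ℕ) : 0 ≤ unif n x * unif N k := mul_nonneg hX (unif_nonneg N k)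
  have hB (N k N' k' : ℕ) : 0 ≤ unif n x * unif N k * unif N' k' :=
    mul_nonneg (hA N k) (unif_nonneg N' k')
  cases e with
  | star X t =>
    exact mul_le_mul_of_nonneg_left
      ((loadCost_mono z sdiff_subset).trans (loadCost_crossSlots_univ_le z t)) hX
  | starPair X t e =>
    have hload := loadCost_insert_sdiff_le z (crossSlots {t} univ) e
    simp only [triScale, costBound, EdgeFun.eval, mul_ite, ite_mul, zero_mul, mul_zero]
    split_ifs
    exacts [mul_le_mul_of_nonneg_left hload hX, le_rfl]
  | walkA0 X A hXcard hAcard =>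
    exact mul_le_mul_of_nonneg_left ((loadCost_mono z sdiff_subset).trans
      (loadCost_crossSlots_le_of_card_le z hXcard (hAcard.trans_le (Nat.sub_le _ _)))) (hA _ _)
  | walkA1 X A j hXcard =>
    exact mul_le_mul_of_nonneg_left (loadCost_crossSlots_insert_sdiff_le z hXcard A j) (hA _ _)
  | walkA2 X A j hXcard =>
    exact mul_le_mul_of_nonneg_left (loadCost_crossSlots_insert_sdiff_le z hXcard A j) (hA _ _)
  | walkB0 X A w B _ _ _ hBcard =>
    exact mul_le_mul_of_nonneg_left ((loadCost_mono z (sdiff_le_iff.2 subset_rfl)).trans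
      (loadCost_crossSlots_singleton_le z w (hBcard.trans_le (Nat.sub_le _ _)))) (hB _ _ _ _)
  | walkB1 X A w B j =>
    exact mul_le_mul_of_nonneg_left
      (loadCost_union_crossSlots_insert_sdiff_le z (crossSlots X A) w B j) (hB _ _ _ _)
  | walkB2 X A w B j =>
    exact mul_le_mul_of_nonneg_left
      (loadCost_union_crossSlots_insert_sdiff_le z (crossSlots X A) w B j) (hB _ _ _ _)
  | pair X A w B e =>
    have hload := loadCost_insert_sdiff_le z (crossSlots X A ∪ crossSlots {w} B) e
    simp only [triScale, costBound, EdgeFun.eval, mul_ite, ite_mul, zero_mul, mul_zero]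
    split_ifs
    exacts [mul_le_mul_of_nonneg_left hload (hB _ _ _ _), le_rfl]

end Scaled

end Cost

/-! ## The cost of the nine kinds of super edges -/

section NegativeComplexity

open Finset

variable {n x a b : ℕ}

theorem sum_triScale_mul_loadCost_le (z : Slot n → Bool) :
    (∑ e : TriEdge n x a b, triScale z e * loadCost z ((triangleSuperGraph n x a b).loadSet e)) ≤
      ∑ X ∈ powersetCard x univ, (costBound z x a b).sumAt a b X :=
  (sum_le_sum fun e _ => triScale_mul_loadCost_le z e).trans_eq (EdgeFun.sum_eval x a b _)

theorem avg_univ_le {k : ℕ} (hk : k ≤ n) {F : Finset (Fin n) → ℝ} (c₁ c₂ : ℝ) (f : Fin n → ℝ)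
    (h : ∀ A : Finset (Fin n), A.card = k → F A ≤ c₁ * ∑ j ∈ A, f j + c₂) :
    unif n k * ∑ A ∈ powersetCard k univ, F A ≤ c₁ * ((k : ℝ) / n * ∑ j, f j) + c₂ := by
  have havg := avg_le (U := univ) (by rwa [card_fin]) c₁ c₂ f fun A _ hA => h A hA
  rwa [avg, card_fin] at havg

theorem avg_univ_le_const {k : ℕ} (hk : k ≤ n) {F : Finset (Fin n) → ℝ} {c : ℝ}
    (h : ∀ A : Finset (Fin n), A.card = k → F A ≤ c) :
    unif n k * ∑ A ∈ powersetCard k univ, F A ≤ c := by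
  have havg := avg_le_const (U := univ) (by rwa [card_fin]) fun A _ hA => h A hA
  rwa [avg, card_fin] at havg

theorem div_mul_natCast_mul (k : ℝ) (hn : n ≠ 0) (c : ℝ) : k / n * (n * c) = k * c := by
  have hn' : (n : ℝ) ≠ 0 := by exact_mod_cast hn
  field_simp

theorem sum_star_le (hx : x ≤ n) (hn : n ≠ 0) (z : Slot n → Bool) :
    ∑ X ∈ powersetCard x univ, ∑ t ∈ X, (costBound z x a b).star X t ≤
      (x : ℝ) * (∑ u, degree z u + n) := by
  have h := avg_univ_le hx n 0 (fun t => degree z t + 1)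
    (F := fun X => n * ∑ t ∈ X, (degree z t + 1)) fun X _ => (add_zero _).ge
  simp only [costBound, ← mul_sum] at h ⊢
  refine h.trans_eq ?_
  rw [add_zero, mul_left_comm, div_mul_natCast_mul _ hn, sum_add_distrib, sum_const, card_univ,
    Fintype.card_fin, nsmul_one]

theorem sum_starPair_le (hx : x ≤ n) (hn : n ≠ 0) (z : Slot n → Bool) :
    ∑ X ∈ powersetCard x univ, ∑ t ∈ X, ∑ e, (costBound z x a b).starPair X t e ≤
      2 * (x : ℝ) * ∑ u, degree z u := by
  classical
  have h := avg_univ_le hx (2 * n) 0 (degree z)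
    (F := fun X => ∑ t ∈ X, ∑ e, if InNbhd z t e then (2 : ℝ) else 0) fun X _ => by
      rw [add_zero, mul_sum]
      refine sum_le_sum fun t _ => ?_
      rw [← sum_filter, sum_const, nsmul_eq_mul]
      linarith [card_inNbhd_le z t]
  simp only [costBound, ← mul_sum]
  refine h.trans_eq ?_
  rw [add_zero, mul_assoc, mul_left_comm (n : ℝ), div_mul_natCast_mul _ hn, mul_assoc]

theorem sum_walkA0_le (hx : x ≤ n) (han : a ≤ n) (z : Slot n → Bool) :
    ∑ X ∈ powersetCard x univ, ∑ A ∈ powersetCard (a - 2) univ, (costBound z x a b).walkA0 X A ≤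
      (x : ℝ) * a * ((a : ℝ) / n * ((x : ℝ) / n * ∑ u, degree z u) + 1) := by
  have hA (X : Finset (Fin n)) : unif n (a - 2) * ∑ A ∈ powersetCard (a - 2) univ,
      ((x : ℝ) * a * ((∑ u ∈ X, ∑ v ∈ A, adjInd z u v) + 1)) ≤
        (x : ℝ) * a * ((a : ℝ) / n) * (∑ u ∈ X, degree z u) + x * a := by
    refine (avg_univ_le ((Nat.sub_le a 2).trans han) ((x : ℝ) * a) (x * a)
      (fun v => ∑ u ∈ X, adjInd z u v) fun A _ => ?_).trans ?_
    · rw [sum_comm]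
      linarith
    · have ha : ((a - 2 : ℕ) : ℝ) ≤ a := by exact_mod_cast Nat.sub_le a 2
      have hdegree : 0 ≤ ∑ u ∈ X, degree z u := sum_nonneg fun u _ => degree_nonneg z u
      rw [sum_comm, mul_assoc ((x : ℝ) * a)]
      change _ * (_ * ∑ u ∈ X, degree z u) + _ ≤ _
      gcongr
  have h := avg_univ_le hx _ _ (degree z) fun X _ => hA X
  simp only [costBound, mul_assoc, ← mul_sum] at h ⊢
  linarith

theorem sum_compl_le (z : Slot n → Bool) (X A : Finset (Fin n)) :
    ∑ j ∈ univ \ A, (x : ℝ) * ((∑ u ∈ X, adjInd z u j) + 1) ≤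
      x * (∑ u ∈ X, degree z u) + x * n := by
  have hnonneg (j : Fin n) : 0 ≤ (x : ℝ) * ((∑ u ∈ X, adjInd z u j) + 1) := by
    have : 0 ≤ ∑ u ∈ X, adjInd z u j := sum_nonneg fun u _ => adjInd_nonneg z u j
    positivity
  refine (sum_le_sum_of_subset_of_nonneg (subset_univ _) fun j _ _ => hnonneg j).trans_eq ?_
  rw [← mul_sum, sum_add_distrib, sum_comm]
  simp only [degree, sum_const, card_univ, Fintype.card_fin, nsmul_eq_mul, mul_one]
  ring

theorem avg_sum_compl_le (hx : x ≤ n) {k : ℕ} (hk : k ≤ n) (z : Slot n → Bool) :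
    unif n x * ∑ X ∈ powersetCard x univ, unif n k * ∑ A ∈ powersetCard k univ,
        ∑ j ∈ univ \ A, (x : ℝ) * ((∑ u ∈ X, adjInd z u j) + 1) ≤
      (x : ℝ) * ((x : ℝ) / n * ∑ u, degree z u) + x * n :=
  avg_univ_le hx _ _ (degree z) fun X _ => avg_univ_le_const hk fun A _ => sum_compl_le z X A

theorem sum_walkA1_le (hx : x ≤ n) (han : a ≤ n) (z : Slot n → Bool) :
    ∑ X ∈ powersetCard x univ, ∑ A ∈ powersetCard (a - 2) univ, ∑ j ∈ univ \ A,
        (costBound z x a b).walkA1 X A j ≤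
      (x : ℝ) * ((x : ℝ) / n * ∑ u, degree z u) + x * n := by
  have h := avg_sum_compl_le hx ((Nat.sub_le a 2).trans han) z
  simp only [costBound, mul_assoc, ← mul_sum] at h ⊢
  exact h

theorem sum_walkA2_le (hx : x ≤ n) (ha : 2 ≤ a) (han : a ≤ n) (z : Slot n → Bool) :
    ∑ X ∈ powersetCard x univ, ∑ A ∈ powersetCard (a - 1) univ, ∑ j ∈ univ \ A,
        (costBound z x a b).walkA2 X A j ≤
      (n : ℝ) / (a - 1) * ((x : ℝ) * ((x : ℝ) / n * ∑ u, degree z u) + x * n) := by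
  have hunif := unif_pred_pred (N := n) (k := a - 1) (by lia) (by lia)
  rw [show a - 1 - 1 = a - 2 by lia, Nat.cast_sub (by lia), Nat.cast_one] at hunif
  have hratio : (0 : ℝ) ≤ (n : ℝ) / (a - 1) := by
    have : (2 : ℝ) ≤ a := by exact_mod_cast ha
    exact div_nonneg (Nat.cast_nonneg _) (by linarith)
  have h := mul_le_mul_of_nonneg_left (avg_sum_compl_le hx ((Nat.sub_le a 1).trans han) z) hratio
  simp only [costBound, hunif, mul_assoc, mul_left_comm (unif n x), ← mul_sum] at h ⊢
  exact h

theorem sum_walkB_le (hx : x ≤ n) (ha : 2 ≤ a) (han : a ≤ n)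
    {G : Finset (Fin n) → ℝ} {c : ℝ} (h : unif n a * ∑ A ∈ powersetCard a univ, G A ≤ c) :
    ∑ _X ∈ powersetCard x (univ : Finset (Fin n)), ∑ A ∈ powersetCard a univ,
        unif n x * unif (n - 2) (a - 2) * G A ≤
      (n : ℝ) * (n - 1) / (a * (a - 1)) * c := by
  have ha' : (2 : ℝ) ≤ a := by exact_mod_cast ha
  have hn' : (2 : ℝ) ≤ n := by exact_mod_cast ha.trans han
  have hratio : 0 ≤ (n : ℝ) * (n - 1) / (a * (a - 1)) :=
    div_nonneg (mul_nonneg (by linarith) (by linarith)) (mul_nonneg (by linarith) (by linarith))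
  have hX := avg_univ_le_const hx fun _ _ => mul_le_mul_of_nonneg_left h hratio
  rw [unif_sub_two ha han]
  simp only [mul_assoc, ← mul_sum] at hX ⊢
  exact hX

theorem sum_walkB0_le (hx : x ≤ n) (hb : 2 ≤ b) (hba : b ≤ a) (han : a ≤ n)
    (z : Slot n → Bool) :
    ∑ X ∈ powersetCard x (univ : Finset (Fin n)), ∑ A ∈ powersetCard a univ, ∑ w,
        ∑ B ∈ powersetCard (b - 2) A, (costBound z x a b).walkB0 X A w B ≤
      (n : ℝ) * (n - 1) / (a * (a - 1)) *
        (b * ((b : ℝ) / a) * ((a : ℝ) / n * ∑ u, degree z u) + n * b) := by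
  have hB {A : Finset (Fin n)} (hA : A.card = a) (w : Fin n) :
      unif a (b - 2) * ∑ B ∈ powersetCard (b - 2) A, (b * ((∑ v ∈ B, adjInd z w v) + 1)) ≤
        b * ((b : ℝ) / a) * (∑ v ∈ A, adjInd z w v) + b := by
    have havg := avg_le (U := A) (k := b - 2) (by lia) (b : ℝ) b (adjInd z w)
      (F := fun B => b * ((∑ v ∈ B, adjInd z w v) + 1)) fun B _ _ => by linarith
    rw [avg, hA] at havg
    refine havg.trans ?_
    have hb' : ((b - 2 : ℕ) : ℝ) ≤ b := by exact_mod_cast Nat.sub_le b 2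
    have hsum : 0 ≤ ∑ v ∈ A, adjInd z w v := sum_nonneg fun v _ => adjInd_nonneg z w v
    rw [mul_assoc (b : ℝ)]
    gcongr
  have hA (A : Finset (Fin n)) (hA : A.card = a) :
      ∑ w, unif a (b - 2) * ∑ B ∈ powersetCard (b - 2) A, (b * ((∑ v ∈ B, adjInd z w v) + 1)) ≤
        b * ((b : ℝ) / a) * (∑ v ∈ A, ∑ w, adjInd z w v) + n * b := by
    refine (sum_le_sum fun w _ => hB hA w).trans_eq ?_
    rw [sum_add_distrib, ← mul_sum, sum_comm]
    simp only [sum_const, card_univ, Fintype.card_fin, nsmul_eq_mul]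
  have h := sum_walkB_le hx (hb.trans hba) han (avg_univ_le han _ _ _ hA)
  rw [sum_comm (s := (univ : Finset (Fin n))) (t := (univ : Finset (Fin n)))] at h
  simp only [costBound, mul_assoc, ← mul_sum] at h ⊢
  exact h

theorem sum_avg_card_sdiff_le {k : ℕ} {A : Finset (Fin n)} (hA : A.card = a) (hk : k ≤ a) :
    ∑ _w : Fin n, unif a k * ∑ B ∈ powersetCard k A, ∑ _j ∈ A \ B, (2 : ℝ) ≤ n * (a * 2) := by
  have havg := avg_le_const (U := A) (k := k) (hk.trans_eq hA.symm) (c := (a : ℝ) * 2)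
    (F := fun B => ∑ _j ∈ A \ B, (2 : ℝ)) fun B _ _ => by
      rw [sum_const, nsmul_eq_mul]
      have : ((A \ B).card : ℝ) ≤ a := by exact_mod_cast (card_le_card sdiff_subset).trans_eq hA
      linarith
  rw [avg, hA] at havg
  rw [sum_const, card_univ, Fintype.card_fin, nsmul_eq_mul]
  gcongr

theorem sum_walkB1_le (hx : x ≤ n) (hb : 2 ≤ b) (hba : b ≤ a) (han : a ≤ n)
    (z : Slot n → Bool) :
    ∑ X ∈ powersetCard x (univ : Finset (Fin n)), ∑ A ∈ powersetCard a univ, ∑ w,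
        ∑ B ∈ powersetCard (b - 2) A, ∑ j ∈ A \ B, (costBound z x a b).walkB1 X A w B j ≤
      (n : ℝ) * (n - 1) / (a * (a - 1)) * (n * (a * 2)) := by
  have h := sum_walkB_le hx (hb.trans hba) han
    (avg_univ_le_const han fun A hA => sum_avg_card_sdiff_le hA ((Nat.sub_le b 2).trans hba))
  simp only [costBound, mul_assoc, ← mul_sum] at h ⊢
  exact h

theorem sum_walkB2_le (hx : x ≤ n) (hb : 2 ≤ b) (hba : b ≤ a) (han : a ≤ n)
    (z : Slot n → Bool) :
    ∑ X ∈ powersetCard x (univ : Finset (Fin n)), ∑ A ∈ powersetCard a univ, ∑ w,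
        ∑ B ∈ powersetCard (b - 1) A, ∑ j ∈ A \ B, (costBound z x a b).walkB2 X A w B j ≤
      (n : ℝ) * (n - 1) / (a * (a - 1)) * ((a : ℝ) / (b - 1) * (n * (a * 2))) := by
  have hunif := unif_pred_pred (N := a) (k := b - 1) (by lia) (by lia)
  rw [show b - 1 - 1 = b - 2 by lia, Nat.cast_sub (by lia), Nat.cast_one] at hunif
  have hratio : (0 : ℝ) ≤ (a : ℝ) / (b - 1) := by
    have : (2 : ℝ) ≤ b := by exact_mod_cast hb
    exact div_nonneg (Nat.cast_nonneg _) (by linarith)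
  have h := sum_walkB_le hx (hb.trans hba) han (avg_univ_le_const han fun A hA =>
    mul_le_mul_of_nonneg_left (sum_avg_card_sdiff_le hA ((Nat.sub_le b 1).trans hba)) hratio)
  simp only [costBound, hunif, mul_assoc, ← mul_sum] at h ⊢
  exact h

theorem unif_mul_sum_sum_pairsIn (hb : 2 ≤ b) (hba : b ≤ a) (han : a ≤ n)
    (h : Fin n → Slot n → ℝ) :
    unif (n - 2) (a - 2) * (unif (a - 2) (b - 2) * ∑ A ∈ powersetCard a (univ : Finset (Fin n)),
      ∑ w, ∑ B ∈ powersetCard b A, ∑ e ∈ pairsIn B, h w e) = ∑ w, ∑ e, h w e := by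
  have hB (w : Fin n) (A) (hA : A ∈ powersetCard a (univ : Finset (Fin n))) :
      unif (a - 2) (b - 2) * ∑ B ∈ powersetCard b A, ∑ e ∈ pairsIn B, h w e =
        ∑ e ∈ pairsIn A, h w e := by
    have hcard := mem_powersetCard_univ.1 hA
    have hpairs := unif_mul_sum_pairsIn hb (hba.trans_eq hcard.symm) (h w)
    rwa [hcard] at hpairs
  have hA (w : Fin n) : unif (n - 2) (a - 2) *
      ∑ A ∈ powersetCard a (univ : Finset (Fin n)), ∑ e ∈ pairsIn A, h w e = ∑ e, h w e := by
    have hpairs := unif_mul_sum_pairsIn (U := univ) (hb.trans hba) (by rwa [card_fin]) (h w)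
    rwa [card_fin, pairsIn_univ] at hpairs
  rw [sum_comm, mul_sum, mul_sum]
  refine sum_congr rfl fun w _ => ?_
  rw [← hA w, mul_sum, sum_congr rfl (hB w)]

open Classical in
theorem sum_inNbhd_and_inDelta_le (x : ℕ) (z : Slot n → Bool) (e : Slot n) :
    ∑ X ∈ powersetCard x (univ : Finset (Fin n)), ∑ w,
      (if InNbhd z w e ∧ InDelta z X e then (2 : ℝ) else 0) ≤ 2 * n.choose (x + 1) := by
  have hcount := sum_card_of_disjoint_le univ (univ.filter fun w => InNbhd z w e) x
    (subset_univ _)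
  rw [card_fin] at hcount
  refine le_trans ?_ (mul_le_mul_of_nonneg_left (Nat.cast_le.2 hcount) zero_le_two)
  push_cast
  rw [mul_sum]
  refine sum_le_sum fun X _ => ?_
  have hdisjoint : InDelta z X e ↔ Disjoint X (univ.filter fun w => InNbhd z w e) := by
    rw [disjoint_left]
    simp [InDelta]
  simp only [← hdisjoint]
  by_cases hX : InDelta z X e
  · simp only [hX, and_true, if_true]
    rw [← sum_filter, sum_const, nsmul_eq_mul, mul_comm]
  · simp only [hX, and_false, if_false, sum_const_zero, mul_zero, le_refl]

theorem sum_pair_le (hx1 : 1 ≤ x) (hx : x ≤ n) (hb : 2 ≤ b) (hba : b ≤ a) (han : a ≤ n)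
    (z : Slot n → Bool) :
    ∑ X ∈ powersetCard x (univ : Finset (Fin n)), ∑ A ∈ powersetCard a univ, ∑ w,
        ∑ B ∈ powersetCard b A, ∑ e ∈ pairsIn B, (costBound z x a b).pair X A w B e ≤
      2 * ((n : ℝ) ^ 2 * ((n : ℝ) / x)) := by
  classical
  have hslots : (Fintype.card (Slot n) : ℝ) ≤ (n : ℝ) ^ 2 := by exact_mod_cast card_slot_le
  calc _ = unif n x * ∑ X ∈ powersetCard x (univ : Finset (Fin n)), ∑ w, ∑ e,
        (if InNbhd z w e ∧ InDelta z X e then (2 : ℝ) else 0) := by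
        simp only [costBound, mul_assoc, ← mul_sum]
        congr 1
        simp only [mul_sum (s := powersetCard x univ)]
        refine sum_congr rfl fun X _ => ?_
        convert unif_mul_sum_sum_pairsIn hb hba han
          fun w e => if InNbhd z w e ∧ InDelta z X e then (2 : ℝ) else 0
    _ = unif n x * ∑ e : Slot n, ∑ X ∈ powersetCard x (univ : Finset (Fin n)), ∑ w,
        (if InNbhd z w e ∧ InDelta z X e then (2 : ℝ) else 0) := by
        rw [sum_comm (s := (univ : Finset (Slot n)))]
        exact congrArg _ (sum_congr rfl fun X _ => sum_comm)
    _ ≤ unif n x * ∑ _e : Slot n, 2 * (n.choose (x + 1) : ℝ) :=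
        mul_le_mul_of_nonneg_left
          (sum_le_sum fun e _ => sum_inNbhd_and_inDelta_le x z e) (unif_nonneg _ _)
    _ = 2 * (Fintype.card (Slot n) * (unif n x * n.choose (x + 1))) := by
        rw [sum_const, card_univ, nsmul_eq_mul]
        ring
    _ ≤ 2 * ((n : ℝ) ^ 2 * ((n : ℝ) / x)) := by
        gcongr
        · exact mul_nonneg (unif_nonneg _ _) (Nat.cast_nonneg _)
        · exact unif_mul_choose_succ_le hx1 hx

end NegativeComplexity

/-! ## The complexity bounds -/

section Numeric

variable {n x a b m : ℝ}

/-- The squared complexity bound claimed for the learning graph with parameters `n`, `x`, `a`, `b`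
over graphs with `m` edges, without the logarithmic factor. -/
noncomputable def triBound (n x a b m : ℝ) : ℝ :=
  x * m + (a * x) ^ 2 * (m / n ^ 2) + (n / a) ^ 2 * (a * x ^ 2 * (m / n ^ 2) +
    n * (b ^ 2 * (m / n ^ 2) + (a / b) ^ 2 * (b + b ^ 2 / x)))

theorem triBound_eq (m : ℝ) (hn : 0 < n) (hx : 0 < x) (ha : 0 < a) (hb : 0 < b) :
    triBound n x a b m = x * m + (a * x) ^ 2 * m / n ^ 2 + x ^ 2 * m / a + n * b ^ 2 * m / a ^ 2 +
      n ^ 3 / b + n ^ 3 / x := by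
  unfold triBound
  field_simp
  ring

theorem triBound_nonneg (hx : 0 ≤ x) (ha : 0 ≤ a) (hb : 0 ≤ b) (hn : 0 ≤ n) (hm : 0 ≤ m) :
    0 ≤ triBound n x a b m := by
  unfold triBound
  positivity

theorem div_sub_one_le (hn : 0 ≤ n) (ha : 2 ≤ a) : n / (a - 1) ≤ 2 * (n / a) := by
  rw [← mul_div_assoc, div_le_div_iff₀ (by linarith) (by linarith)]
  nlinarith

theorem mul_sub_one_div_le (hn : 0 ≤ n) (ha : 2 ≤ a) :
    n * (n - 1) / (a * (a - 1)) ≤ 2 * (n / a) ^ 2 := by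
  have hpred : (n - 1) / (a - 1) ≤ 2 * (n / a) :=
    (div_le_div_of_nonneg_right (sub_le_self n zero_le_one) (by linarith)).trans
      (div_sub_one_le hn ha)
  calc n * (n - 1) / (a * (a - 1)) = n / a * ((n - 1) / (a - 1)) := mul_div_mul_comm n _ a _
    _ ≤ n / a * (2 * (n / a)) := by gcongr
    _ = 2 * (n / a) ^ 2 := by ring

theorem mul_le_cube_div (hx : x ≤ n) (ha : a ≤ n) (ha0 : 0 ≤ a) (hb : 0 < b) (hbn : b ≤ n) :
    x * a ≤ n ^ 3 / b := by
  rw [le_div_iff₀ hb]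
  have hn : 0 ≤ n := ha0.trans ha
  calc x * a * b ≤ n * n * n := by gcongr
    _ = n ^ 3 := by ring

theorem walkA0_bound_le (hx : x ≤ n) (hb : 0 < b) (hba : b ≤ a) (han : a ≤ n) :
    x * a * (a / n * (x / n * (2 * m)) + 1) ≤ 2 * ((a * x) ^ 2 * m / n ^ 2) + n ^ 3 / b := by
  have hxa := mul_le_cube_div hx han (hb.le.trans hba) hb (hba.trans han)
  calc x * a * (a / n * (x / n * (2 * m)) + 1) = 2 * ((a * x) ^ 2 * m / n ^ 2) + x * a := by ring
    _ ≤ _ := by gcongr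

theorem walkA1_bound_le (hx : x ≤ n) (hb : 0 < b) (hba : b ≤ a) (han : a ≤ n) (hm : 0 ≤ m) :
    x * (x / n * (2 * m)) + x * n ≤ 2 * (x ^ 2 * m / a) + n ^ 3 / b := by
  have hxn := mul_le_cube_div hx le_rfl ((hb.le.trans hba).trans han) hb (hba.trans han)
  have ha : 0 < a := hb.trans_le hba
  calc x * (x / n * (2 * m)) + x * n = 2 * (x ^ 2 * m / n) + x * n := by ring
    _ ≤ _ := by gcongr

theorem walkA2_bound_le (hx0 : 0 ≤ x) (hx : x ≤ n) (hb : 2 ≤ b) (hba : b ≤ a) (han : a ≤ n)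
    (hm : 0 ≤ m) :
    n / (a - 1) * (x * (x / n * (2 * m)) + x * n) ≤ 4 * (x ^ 2 * m / a) + 2 * (n ^ 3 / b) := by
  have ha : 0 < a := by linarith
  have hn : 0 < n := by linarith
  calc n / (a - 1) * (x * (x / n * (2 * m)) + x * n)
      ≤ 2 * (n / a) * (x * (x / n * (2 * m)) + x * n) := by
        gcongr
        exact div_sub_one_le hn.le (hb.trans hba)
    _ = 4 * (x ^ 2 * m / a) + 2 * (n ^ 2 * x / a) := by
        field_simp
        ring
    _ ≤ 4 * (x ^ 2 * m / a) + 2 * (n ^ 2 * n / b) := by gcongr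
    _ = _ := by ring

theorem walkB0_bound_le (hb : 2 ≤ b) (hba : b ≤ a) (han : a ≤ n) (hm : 0 ≤ m) :
    n * (n - 1) / (a * (a - 1)) * (b * (b / a) * (a / n * (2 * m)) + n * b) ≤
      4 * (n * b ^ 2 * m / a ^ 2) + 2 * (n ^ 3 / b) := by
  have ha : 0 < a := by linarith
  have hn : 0 < n := by linarith
  calc n * (n - 1) / (a * (a - 1)) * (b * (b / a) * (a / n * (2 * m)) + n * b)
      ≤ 2 * (n / a) ^ 2 * (b * (b / a) * (a / n * (2 * m)) + n * b) := by
        gcongr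
        exact mul_sub_one_div_le hn.le (hb.trans hba)
    _ = 4 * (n * b ^ 2 * m / a ^ 2) + 2 * (n ^ 3 * (b * b) / (a * a) / b) := by
        field_simp
        ring
    _ ≤ 4 * (n * b ^ 2 * m / a ^ 2) + 2 * (n ^ 3 * (a * a) / (a * a) / b) := by gcongr
    _ = _ := by rw [mul_div_cancel_right₀ _ (mul_pos ha ha).ne']

theorem walkB1_bound_le (hb : 2 ≤ b) (hba : b ≤ a) (hn : 0 ≤ n) :
    n * (n - 1) / (a * (a - 1)) * (n * (a * 2)) ≤ 4 * (n ^ 3 / b) := by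
  have ha : 0 < a := by linarith
  calc n * (n - 1) / (a * (a - 1)) * (n * (a * 2))
      ≤ 2 * (n / a) ^ 2 * (n * (a * 2)) := by
        gcongr
        exact mul_sub_one_div_le hn (hb.trans hba)
    _ = 4 * (n ^ 3 / a) := by
        field_simp
        ring
    _ ≤ 4 * (n ^ 3 / b) := by gcongr

theorem walkB2_bound_le (hb : 2 ≤ b) (hba : b ≤ a) (hn : 0 ≤ n) :
    n * (n - 1) / (a * (a - 1)) * (a / (b - 1) * (n * (a * 2))) ≤ 8 * (n ^ 3 / b) := by
  have ha : 0 < a := by linarith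
  have hb' : 0 ≤ a / (b - 1) := div_nonneg ha.le (by linarith)
  calc n * (n - 1) / (a * (a - 1)) * (a / (b - 1) * (n * (a * 2)))
      ≤ 2 * (n / a) ^ 2 * (2 * (a / b) * (n * (a * 2))) := by
        gcongr
        exacts [mul_sub_one_div_le hn (hb.trans hba), div_sub_one_le ha.le hb]
    _ = 8 * (n ^ 3 / b) := by
        field_simp
        ring

theorem sum_bounds_le_triBound (hx1 : 1 ≤ x) (hx : x ≤ n) (hb : 2 ≤ b) (hba : b ≤ a)
    (han : a ≤ n) (hm : 0 ≤ m) :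
    x * (2 * m + n) + (2 * x * (2 * m) + (x * a * (a / n * (x / n * (2 * m)) + 1) +
      ((x * (x / n * (2 * m)) + x * n) + (n / (a - 1) * (x * (x / n * (2 * m)) + x * n) +
      (n * (n - 1) / (a * (a - 1)) * (b * (b / a) * (a / n * (2 * m)) + n * b) +
      (n * (n - 1) / (a * (a - 1)) * (n * (a * 2)) +
      (n * (n - 1) / (a * (a - 1)) * (a / (b - 1) * (n * (a * 2))) +
      2 * (n ^ 2 * (n / x))))))))) ≤ 20 * triBound n x a b m := by
  have hx0 : 0 < x := by linarith
  have hb0 : 0 < b := by linarith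
  have ha0 : 0 < a := by linarith
  have hn0 : 0 < n := by linarith
  have hstar : x * (2 * m + n) ≤ 2 * (x * m) + n ^ 3 / b := by
    linarith [mul_le_cube_div hx le_rfl hn0.le hb0 (hba.trans han)]
  have hpair : 2 * (n ^ 2 * (n / x)) = 2 * (n ^ 3 / x) := by ring
  have hnonneg : 0 ≤ x * m ∧ 0 ≤ (a * x) ^ 2 * m / n ^ 2 ∧ 0 ≤ x ^ 2 * m / a ∧
      0 ≤ n * b ^ 2 * m / a ^ 2 ∧ 0 ≤ n ^ 3 / b ∧ 0 ≤ n ^ 3 / x := by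
    refine ⟨?_, ?_, ?_, ?_, ?_, ?_⟩ <;> positivity
  rw [triBound_eq m hn0 hx0 ha0 hb0]
  linarith [walkA0_bound_le hx hb0 hba han (m := m), walkA1_bound_le hx hb0 hba han hm,
    walkA2_bound_le hx0.le hx hb hba han hm, walkB0_bound_le hb hba han hm,
    walkB1_bound_le hb hba hn0.le, walkB2_bound_le hb hba hn0.le]

theorem log_succ_le_three_mul_log {n N : ℕ} (hn : 2 ≤ n) (hN : N ≤ n ^ 2) :
    Real.log ((N : ℝ) + 1) ≤ 3 * Real.log n := by
  have hcube : (N : ℝ) + 1 ≤ (n : ℝ) ^ 3 := by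
    exact_mod_cast (by nlinarith [Nat.pow_le_pow_left hn 2] : N + 1 ≤ n ^ 3)
  have hlog := Real.log_le_log (by positivity) hcube
  rwa [Real.log_pow] at hlog

end Numeric

section Complexity

open Finset

variable {n x a b : ℕ}

theorem sum_triScale_mul_loadCost_le_triBound (hx1 : 1 ≤ x) (hx : x ≤ n) (hb : 2 ≤ b) (hba : b ≤ a)
    (han : a ≤ n) {m : ℕ} {z : Slot n → Bool} (hz : z ∈ graphsWithEdges n m) :
    (∑ e : TriEdge n x a b, triScale z e * loadCost z ((triangleSuperGraph n x a b).loadSet e)) ≤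
      20 * triBound n x a b m := by
  have ha := hb.trans hba
  have hn : n ≠ 0 := by lia
  refine (sum_triScale_mul_loadCost_le z).trans (le_trans ?_ (sum_bounds_le_triBound
    (n := n) (x := x) (a := a) (b := b) (m := m) (by exact_mod_cast hx1) (by exact_mod_cast hx)
    (by exact_mod_cast hb) (by exact_mod_cast hba) (by exact_mod_cast han) (Nat.cast_nonneg m)))
  simp only [EdgeFun.sumAt, sum_add_distrib]
  rw [← sum_degree hz]
  exact add_le_add (sum_star_le hx hn z) (add_le_add (sum_starPair_le hx hn z)
    (add_le_add (sum_walkA0_le hx han z) (add_le_add (sum_walkA1_le hx han z)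
    (add_le_add (sum_walkA2_le hx ha han z) (add_le_add (sum_walkB0_le hx hb hba han z)
    (add_le_add (sum_walkB1_le hx hb hba han z) (add_le_add (sum_walkB2_le hx hb hba han z)
    (sum_pair_le hx1 hx hb hba han z))))))))

theorem negComplexity_triangle_le (hx1 : 1 ≤ x) (hx : x ≤ n) (hb : 2 ≤ b) (hba : b ≤ a)
    (han : a ≤ n) {m : ℕ} {z : Slot n → Bool} (hz : z ∈ graphsWithEdges n m) :
    (triangleLearningGraph n x a b).negComplexity z ≤
      360 * (triBound n x a b m * Real.log n) := by
  have : 0 ≤ Real.log n := Real.log_natCast_nonneg n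
  have hedge (e : TriEdge n x a b) : triScale z e *
      (6 * loadCost z ((triangleSuperGraph n x a b).loadSet e) *
        Real.log ((((triangleSuperGraph n x a b).loadSet e).card : ℝ) + 1)) ≤
      18 * Real.log n *
        (triScale z e * loadCost z ((triangleSuperGraph n x a b).loadSet e)) := by
    set S := (triangleSuperGraph n x a b).loadSet e
    have hlogS := log_succ_le_three_mul_log ((hb.trans hba).trans han)
      ((card_le_univ S).trans card_slot_le)
    have hcost := loadCost_nonneg z S
    have hscale := triScale_nonneg z e
    calc triScale z e * (6 * loadCost z S * Real.log ((S.card : ℝ) + 1))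
        ≤ triScale z e * (6 * loadCost z S * (3 * Real.log n)) := by gcongr
      _ = _ := by ring
  calc (triangleLearningGraph n x a b).negComplexity z
      ≤ ∑ e : TriEdge n x a b, triScale z e *
        (6 * loadCost z ((triangleSuperGraph n x a b).loadSet e) *
          Real.log ((((triangleSuperGraph n x a b).loadSet e).card : ℝ) + 1)) :=
        (triangleSuperGraph_isLayeredFor hx hb hba han).negComplexity_le z
    _ ≤ 18 * Real.log n * ∑ e : TriEdge n x a b,
        triScale z e * loadCost z ((triangleSuperGraph n x a b).loadSet e) :=
        (sum_le_sum fun e _ => hedge e).trans_eq (mul_sum _ _ _).symm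
    _ ≤ 18 * Real.log n * (20 * triBound n x a b m) := by
        gcongr
        exact sum_triScale_mul_loadCost_le_triBound hx1 hx hb hba han hz
    _ = 360 * (triBound n x a b m * Real.log n) := by ring

theorem complexity_triangle_le (hx1 : 1 ≤ x) (hx : x ≤ n) (hb : 2 ≤ b) (hba : b ≤ a)
    (han : a ≤ n) (m : ℕ) :
    (triangleLearningGraph n x a b).complexity (graphsWithEdges n m) HasTriangle ≤
      71 * Real.sqrt (triBound n x a b m * Real.log n) := by
  have hL := triangleSuperGraph_isLayeredFor hx hb hba han
  have hbound : 0 ≤ triBound n x a b m * Real.log n :=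
    mul_nonneg (triBound_nonneg (Nat.cast_nonneg x) (Nat.cast_nonneg a) (Nat.cast_nonneg b)
      (Nat.cast_nonneg n) (Nat.cast_nonneg m)) (Real.log_natCast_nonneg n)
  have hneg : (⨆ z : {z // z ∈ graphsWithEdges n m ∧ ¬ HasTriangle z},
      (triangleLearningGraph n x a b).negComplexity z.1) ≤
        360 * (triBound n x a b m * Real.log n) :=
    Real.iSup_le (fun z => negComplexity_triangle_le hx1 hx hb hba han z.2.1) (by positivity)
  have hpos : (⨆ y : {y // y ∈ graphsWithEdges n m ∧ HasTriangle y},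
      (triangleLearningGraph n x a b).posComplexity y.1) ≤ 2 * (7 : ℕ) :=
    Real.iSup_le (fun y => hL.posComplexity_le (triLevel_tgt_le hb (hb.trans hba)) y.2.2)
      (by positivity)
  have hpos_nonneg : 0 ≤ ⨆ y : {y // y ∈ graphsWithEdges n m ∧ HasTriangle y},
      (triangleLearningGraph n x a b).posComplexity y.1 := by
    refine Real.iSup_nonneg fun y => sum_nonneg fun e _ => ?_
    split_ifs
    · exact div_nonneg (sq_nonneg _)
        (hL.isLearningGraphFor.weight_nonneg _ _ (Set.mem_univ _) e)
    · exact le_rfl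
  unfold LGraph.complexity
  refine Real.sqrt_le_iff.2 ⟨by positivity, ?_⟩
  rw [mul_pow, Real.sq_sqrt hbound]
  refine (mul_le_mul hneg hpos hpos_nonneg (by positivity)).trans ?_
  push_cast
  linarith

end Complexity

/-! ## The choice of parameters -/

section Parameters

theorem triBound_parameters_le {r q a b : ℝ} (hr : 1 ≤ r) (hq : 0 < q) (hq1 : q ≤ 1)
    (ha : r ^ 3 ≤ a) (ha' : a ≤ 2 * r ^ 3) (hb : r ^ 2 ≤ b * q) (hb' : b * q ≤ 2 * r ^ 2) :
    triBound (r ^ 4) b a b (q ^ 3 * r ^ 8) ≤ 36 * (r ^ 10 * q) := by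
  have ha0 : 0 < a := lt_of_lt_of_le (by positivity) ha
  have hb0 : 0 < b := pos_of_mul_pos_left (lt_of_lt_of_le (by positivity) hb) hq.le
  have hxm : b * (q ^ 3 * r ^ 8) ≤ 2 * (r ^ 10 * q) := by
    calc b * (q ^ 3 * r ^ 8) = (b * q) * r ^ 8 * q * q := by ring
      _ ≤ (2 * r ^ 2) * r ^ 8 * q * 1 := by gcongr
      _ = _ := by ring
  have hax : (a * b) ^ 2 * (q ^ 3 * r ^ 8) / (r ^ 4) ^ 2 ≤ 16 * (r ^ 10 * q) := by
    calc (a * b) ^ 2 * (q ^ 3 * r ^ 8) / (r ^ 4) ^ 2 = a ^ 2 * (b * q) ^ 2 * q := by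
          field_simp
      _ ≤ (2 * r ^ 3) ^ 2 * (2 * r ^ 2) ^ 2 * q := by gcongr
      _ = _ := by ring
  have hxa : b ^ 2 * (q ^ 3 * r ^ 8) / a ≤ 4 * (r ^ 10 * q) := by
    calc b ^ 2 * (q ^ 3 * r ^ 8) / a = (b * q) ^ 2 * q * r ^ 8 / a := by ring
      _ ≤ (2 * r ^ 2) ^ 2 * q * r ^ 8 / r ^ 3 := by gcongr
      _ = 4 * (r ^ 9 * q) := by field_simp; ring
      _ ≤ 4 * (r ^ 10 * q) := by
          gcongr
          norm_num
  have hba : r ^ 4 * b ^ 2 * (q ^ 3 * r ^ 8) / a ^ 2 ≤ 4 * (r ^ 10 * q) := by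
    calc r ^ 4 * b ^ 2 * (q ^ 3 * r ^ 8) / a ^ 2 = r ^ 12 * (b * q) ^ 2 * q / a ^ 2 := by ring
      _ ≤ r ^ 12 * (2 * r ^ 2) ^ 2 * q / (r ^ 3) ^ 2 := by gcongr
      _ = 4 * (r ^ 10 * q) := by field_simp; ring
  have hnb : (r ^ 4) ^ 3 / b ≤ r ^ 10 * q := by
    rw [div_le_iff₀ hb0]
    calc (r ^ 4) ^ 3 = r ^ 10 * r ^ 2 := by ring
      _ ≤ r ^ 10 * (b * q) := by gcongr
      _ = _ := by ring
  rw [triBound_eq _ (by positivity) hb0 ha0 hb0]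
  have : 0 ≤ r ^ 10 * q := by positivity
  linarith

theorem sq_rpow_mul_rpow {n m r q : ℝ} (hn : 0 ≤ n) (hm : 0 ≤ m) (hq : 0 ≤ q)
    (hnr : n = r ^ 4) (hmq : m = q ^ 3 * r ^ 8) :
    (n ^ (11 / 12 : ℝ) * m ^ (1 / 6 : ℝ)) ^ 2 = r ^ 10 * q := by
  have hn12 : (n ^ (11 / 12 : ℝ)) ^ 12 = n ^ 11 := by
    rw [← Real.rpow_natCast, ← Real.rpow_mul hn, ← Real.rpow_natCast]
    norm_num
  have hm6 : (m ^ (1 / 6 : ℝ)) ^ 6 = m := by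
    rw [← Real.rpow_natCast, ← Real.rpow_mul hm]
    norm_num
  refine (pow_left_inj₀ (by positivity) (by positivity) (n := 6) (by norm_num)).1 ?_
  calc ((n ^ (11 / 12 : ℝ) * m ^ (1 / 6 : ℝ)) ^ 2) ^ 6 =
        (n ^ (11 / 12 : ℝ)) ^ 12 * ((m ^ (1 / 6 : ℝ)) ^ 6) ^ 2 := by ring
    _ = (r ^ 10 * q) ^ 6 := by
        rw [hn12, hm6, hnr, hmq]
        ring

/-- The parameters of the second part of the theorem, in terms of `r = n^(1/4)` and the cube root
`q` of the edge density `m / n²`: these make all the exponents integral. -/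
structure IsParameterChoice (n m a b : ℕ) (r q : ℝ) : Prop where
  one_le_r : 1 ≤ r
  q_pos : 0 < q
  q_lt_one : q < 1
  one_le_mul : 1 ≤ q * r
  n_eq : (n : ℝ) = r ^ 4
  m_eq : (m : ℝ) = q ^ 3 * r ^ 8
  a_eq : a = ⌈r ^ 3⌉₊
  b_eq : b = ⌈r ^ 2 / q⌉₊

theorem cbrt_density_lt_one {n m : ℕ} (hn : 1 ≤ n) (hm : m ≤ n.choose 2) :
    ((m : ℝ) / (n : ℝ) ^ 2) ^ (1 / 3 : ℝ) < 1 := by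
  have hn' : (1 : ℝ) ≤ n := by exact_mod_cast hn
  have hm' : (m : ℝ) ≤ (n : ℝ) * (n - 1) / 2 := by
    rw [← Nat.cast_choose_two]
    exact_mod_cast hm
  refine Real.rpow_lt_one (by positivity) ?_ (by norm_num)
  rw [div_lt_one (by positivity)]
  nlinarith

theorem exists_isParameterChoice {n m a b : ℕ} (hn : 1 ≤ n) (hm : m ≤ n.choose 2)
    (hnm : (n : ℝ) ^ (5 / 4 : ℝ) ≤ m) (ha : a = ⌈(n : ℝ) ^ (3 / 4 : ℝ)⌉₊)
    (hb : b = ⌈Real.sqrt n / ((m : ℝ) / (n : ℝ) ^ 2) ^ (1 / 3 : ℝ)⌉₊) :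
    ∃ r q : ℝ, IsParameterChoice n m a b r q := by
  have hn' : (1 : ℝ) ≤ n := by exact_mod_cast hn
  have hq_lt_one := cbrt_density_lt_one hn hm
  obtain ⟨r, hr⟩ : ∃ r : ℝ, r = (n : ℝ) ^ (1 / 4 : ℝ) := ⟨_, rfl⟩
  obtain ⟨q, hq⟩ : ∃ q : ℝ, q = ((m : ℝ) / (n : ℝ) ^ 2) ^ (1 / 3 : ℝ) := ⟨_, rfl⟩
  have hr_one : 1 ≤ r := hr ▸ Real.one_le_rpow hn' (by norm_num)
  have hpow (k : ℕ) : (n : ℝ) ^ ((k : ℝ) / 4) = r ^ k := by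
    rw [hr, ← Real.rpow_natCast, ← Real.rpow_mul (by positivity)]
    congr 1
    ring
  have hr_four : (n : ℝ) = r ^ 4 := by simpa using hpow 4
  have hr_sqrt : Real.sqrt n = r ^ 2 := by
    rw [hr_four, show r ^ 4 = (r ^ 2) ^ 2 by ring, Real.sqrt_sq (by positivity)]
  rw [show (5 / 4 : ℝ) = (5 : ℕ) / 4 by norm_num, hpow] at hnm
  rw [show (3 / 4 : ℝ) = (3 : ℕ) / 4 by norm_num, hpow] at ha
  rw [hr_sqrt, ← hq] at hb
  have hm_pos : (0 : ℝ) < m := lt_of_lt_of_le (by positivity) hnm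
  have hq_pos : 0 < q := hq ▸ Real.rpow_pos_of_pos (by positivity) _
  have hq_cube : q ^ 3 = (m : ℝ) / (n : ℝ) ^ 2 := by
    rw [hq, ← Real.rpow_natCast, ← Real.rpow_mul (by positivity)]
    norm_num
  have hmq : (m : ℝ) = q ^ 3 * r ^ 8 := by
    rw [hq_cube, hr_four]
    field_simp
  have hqr : 1 ≤ q * r := by
    refine (one_le_pow_iff_of_nonneg (by positivity) (n := 3) (by norm_num)).1 ?_
    refine le_of_mul_le_mul_left (a := r ^ 5) ?_ (by positivity)
    linarith
  exact ⟨r, q, hr_one, hq_pos, hq ▸ hq_lt_one, hqr, hr_four, hmq, ha, hb⟩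

namespace IsParameterChoice

variable {n m a b : ℕ} {r q : ℝ}

theorem two_le (h : IsParameterChoice n m a b r q) : 2 ≤ b := by
  rw [h.b_eq]
  refine Nat.lt_ceil.2 ?_
  rw [Nat.cast_one, one_lt_div h.q_pos]
  exact h.q_lt_one.trans_le (one_le_pow₀ h.one_le_r)

theorem b_le_a (h : IsParameterChoice n m a b r q) : b ≤ a := by
  have hr := h.one_le_r
  rw [h.a_eq, h.b_eq]
  refine Nat.ceil_mono ((div_le_iff₀ h.q_pos).2 ?_)
  calc r ^ 2 = r ^ 2 * 1 := (mul_one _).symm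
    _ ≤ r ^ 2 * (q * r) := by
        gcongr
        exact h.one_le_mul
    _ = r ^ 3 * q := by ring

theorem a_le_n (h : IsParameterChoice n m a b r q) : a ≤ n := by
  rw [h.a_eq, Nat.ceil_le, h.n_eq]
  exact pow_le_pow_right₀ h.one_le_r (by norm_num)

theorem triBound_le (h : IsParameterChoice n m a b r q) :
    triBound n b a b m ≤ 36 * (r ^ 10 * q) := by
  have hr := h.one_le_r
  have hb_one : 1 ≤ r ^ 2 / q :=
    (one_le_div h.q_pos).2 (h.q_lt_one.le.trans (one_le_pow₀ hr))
  have hb_lower : r ^ 2 ≤ b * q := (div_le_iff₀ h.q_pos).1 (h.b_eq ▸ Nat.le_ceil _)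
  have hb_upper : b * q ≤ 2 * r ^ 2 := by
    rw [← le_div_iff₀ h.q_pos, mul_div_assoc, h.b_eq]
    exact Nat.ceil_le_two_mul (by linarith)
  have ha_lower : r ^ 3 ≤ a := h.a_eq ▸ Nat.le_ceil _
  have ha_upper : (a : ℝ) ≤ 2 * r ^ 3 := by
    rw [h.a_eq]
    exact Nat.ceil_le_two_mul (by linarith [one_le_pow₀ hr (n := 3)])
  rw [h.n_eq, h.m_eq]
  exact triBound_parameters_le hr h.q_pos h.q_lt_one.le ha_lower ha_upper hb_lower hb_upper

theorem complexity_le (h : IsParameterChoice n m a b r q) :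
    (triangleLearningGraph n b a b).complexity (graphsWithEdges n m) HasTriangle ≤
      426 * ((n : ℝ) ^ (11 / 12 : ℝ) * (m : ℝ) ^ (1 / 6 : ℝ) * Real.sqrt (Real.log n)) := by
  have hb := h.two_le
  have hbound := h.triBound_le
  rw [← sq_rpow_mul_rpow n.cast_nonneg m.cast_nonneg h.q_pos.le h.n_eq h.m_eq] at hbound
  set T := (n : ℝ) ^ (11 / 12 : ℝ) * (m : ℝ) ^ (1 / 6 : ℝ)
  have : 0 ≤ T := by positivity
  calc (triangleLearningGraph n b a b).complexity (graphsWithEdges n m) HasTriangle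
      ≤ 71 * Real.sqrt (triBound n b a b m * Real.log n) :=
        complexity_triangle_le (by lia) (h.b_le_a.trans h.a_le_n) hb h.b_le_a h.a_le_n m
    _ ≤ 71 * Real.sqrt ((6 * T) ^ 2 * Real.log n) := by
        gcongr
        linarith
    _ = 426 * (T * Real.sqrt (Real.log n)) := by
        rw [Real.sqrt_mul (sq_nonneg _), Real.sqrt_sq (by positivity)]
        ring

end IsParameterChoice

end Parameters

theorem mainTheorem3 :
    ∃ C : ℝ, 0 < C ∧
      (∀ n x a b : ℕ, 1 ≤ x → x ≤ n → 2 ≤ b → b ≤ a → a ≤ n →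
        (triangleLearningGraph n x a b).IsLearningGraphFor Set.univ HasTriangle ∧
        ∀ m : ℕ,
          (triangleLearningGraph n x a b).complexity (graphsWithEdges n m) HasTriangle ≤
            C * Real.sqrt
              (((x : ℝ) * m + ((a : ℝ) * x) ^ 2 * ((m : ℝ) / (n : ℝ) ^ 2) +
                ((n : ℝ) / a) ^ 2 *
                  ((a : ℝ) * (x : ℝ) ^ 2 * ((m : ℝ) / (n : ℝ) ^ 2) +
                    (n : ℝ) * ((b : ℝ) ^ 2 * ((m : ℝ) / (n : ℝ) ^ 2) +
                      ((a : ℝ) / b) ^ 2 * ((b : ℝ) + (b : ℝ) ^ 2 / x)))) * Real.log n)) ∧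
      (∀ n m a b : ℕ, 1 ≤ n → m ≤ n.choose 2 → (n : ℝ) ^ (5 / 4 : ℝ) ≤ m →
        a = ⌈(n : ℝ) ^ (3 / 4 : ℝ)⌉₊ →
        b = ⌈Real.sqrt n / ((m : ℝ) / (n : ℝ) ^ 2) ^ (1 / 3 : ℝ)⌉₊ →
        (triangleLearningGraph n b a b).IsLearningGraphFor Set.univ HasTriangle ∧
        (triangleLearningGraph n b a b).complexity (graphsWithEdges n m) HasTriangle ≤
          C * ((n : ℝ) ^ (11 / 12 : ℝ) * (m : ℝ) ^ (1 / 6 : ℝ) * Real.sqrt (Real.log n))) := by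
  refine ⟨426, by norm_num, fun n x a b hx1 hx hb hba han => ⟨?_, fun m => ?_⟩,
    fun n m a b hn hm hnm ha hb => ?_⟩
  · exact (triangleSuperGraph_isLayeredFor hx hb hba han).isLearningGraphFor
  · refine (complexity_triangle_le hx1 hx hb hba han m).trans ?_
    exact mul_le_mul_of_nonneg_right (by norm_num) (Real.sqrt_nonneg _)
  · obtain ⟨r, q, h⟩ := exists_isParameterChoice hn hm hnm ha hb
    exact ⟨(triangleSuperGraph_isLayeredFor (h.b_le_a.trans h.a_le_n) h.two_le h.b_le_a
      h.a_le_n).isLearningGraphFor, h.complexity_le⟩
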